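/- **Conventions.** For real times $t=(t_1,t_2,\dots)$ put $V(t,\lambda)=\xi(t,\lambda)=\sum_{k\ge1}t_k\lambda^k$. Let $\mathcal D$ be the set of $t$ for which the series $V(t,\lambda)$ converges for every $\lambda\in\mathbb R$ and $\int_{\mathbb R}e^{V(t,\lambda)+s\lambda}\,d\lambda<\infty$ for all sufficiently small $|s|$ (for instance polynomial potentials of even degree with negative leading coefficient). Write $x=t_1$, $\partial=\partial/\partial t_1$, and let $D$ be the corresponding symbol in the algebra of formal pseudo-differential operators, $D^if=\sum_{k\ge0}\binom ik(\partial^kf)D^{i-k}$ for $i\in\mathbb Z$. For $A=\sum_ia_iD^i$ let $A_\pm$ denote the parts with $i\ge0$, $i<0$, let $A_+(f)=\sum_{i\ge0}a_i\partial^if$, $(A_+)^*(f)=\sum_{i\ge0}(-\partial)^i(a_if)$ and $\operatorname{Res}A=a_{-1}$. All identities are on $\mathcal D$; identities with $\partial_r=\partial/\partial t_r$ are at those $t\in\mathcal D$ with $t+s\,e_r\in\mathcal D$ for all small $|s|$ and include differentiability ($e_r$ is the unit vector in the direction of $t_r$). *One-matrix model.* $P_n(\lambda)=\lambda^n+O(\lambda^{n-1})$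 and $h_n(t)$ are given by $\int P_nP_m e^{V}d\lambda=h_m\delta_{nm}$, $dM$ is Lebesgue measure on Hermitian $N\times N$ matrices, and $$Z^{\rm mat}_N[t]=\int dM\,\exp\Big(\sum_{r\ge1}t_r\operatorname{Tr}M^r\Big),\qquad Z_N[t]=\frac1{N!}\int_{\mathbb R^N}\prod_{i=1}^N d\lambda_i\;e^{\sum_iV(t,\lambda_i)}\prod_{i>j}(\lambda_i-\lambda_j)^2 .$$ *Generalized Burgers–Hopf system.* A DB (Darboux–Bäcklund) orbit of ${\sf cKP}_{1,1}$ starting from $L=D$ is a sequence of nowhere vanishing functions $\Phi^{(k)}(t)$, $k\ge0$, smooth in $x$, such that, with $T^{(k)}=\Phi^{(k)}D(\Phi^{(k)})^{-1}$, $L^{(0)}=D$, $L^{(k+1)}=T^{(k)}L^{(k)}(T^{(k)})^{-1}$, $\Psi^{(0)}=0$, $\Psi^{(k+1)}=1/\Phi^{(k)}$, one has for all $k\ge0$, $r\ge1$ $$L^{(k)}=D+\Phi^{(k)}D^{-1}\Psi^{(k)},\qquad \partial_rL^{(k)}=[(L^{(k)})^r_+,L^{(k)}],$$ $$\partial_r\Phi^{(k)}=(L^{(k)})^r_+(\Phi^{(k)}),\qquad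 \partial_r\Psi^{(k)}=-\big((L^{(k)})^r_+\big)^*(\Psi^{(k)}),$$ $$\Phi^{(k+1)}=\Phi^{(k)}\,\partial^2\ln|\Phi^{(k)}|+(\Phi^{(k)})^2\Psi^{(k)} .$$ It has constant initial density $c$ if $\Phi^{(0)}(t)=\int c\,e^{\xi(t,\lambda)}d\lambda$. Its dressing operators and Baker–Akhiezer functions are $W^{(0)}=1$, $W^{(k+1)}=T^{(k)}W^{(k)}D^{-1}$, and $\psi^{(k)}(t,\lambda)=W^{(k)}(e^{\xi})=\sum_{j\ge 0} w^{(k)}_j\lambda^{-j}e^{\xi}$, where $W^{(k)}=\sum_{j\ge 0} w^{(k)}_jD^{-j}$. The fully degenerate $n$-truncated KP hierarchy built on $\varphi$ (where $\partial_r\varphi=\partial^r\varphi$) consists of $W=1+w_1D^{-1}+\dots+w_nD^{-n}$ and $L=WDW^{-1}$ with $\partial_rW=-(L^r)_-W$ and $(WD^n)(\partial^{j}\varphi)=0$ for $0\le j<n$. **Proposition 5.1.** The Hermitian one-matrix model is equivalent to the generalized Burgers–Hopf system with constant initial density. In detail, $P_n$ and $h_n$ exist, and: 1. For every constant $c\ne0$,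 a sequence $(\Phi^{(n)})_{n\ge0}$ is a DB orbit of ${\sf cKP}_{1,1}$ starting from $L=D$ with constant initial density $c$ if and only if $\Phi^{(n)}=c\,h_n$ for all $n$. 2. For every constant $c\neq 0$ and $\varphi=\int c\,e^{\xi}d\lambda$, a pair $(W,L)$ is a fully degenerate $n$-truncated KP hierarchy built on $\varphi$ if and only if $W=\sum_{j=0}^nw_jD^{-j}$ with $P_n(\lambda)=\sum_{j=0}^nw_j\lambda^{n-j}$ and $L=L^{(n)}$ is the Lax operator obtained from $\Phi^{(k)}=h_k$. 3. For the orbit with initial density $1$, the pair $(W^{(n)},L^{(n)})$ is the fully degenerate $n$-truncated KP hierarchy built on $\Phi^{(0)}$, and $$h_n=\Phi^{(n)},\qquad P_n(\lambda)e^{V(t,\lambda)}=\lambda^n\psi^{(n)}(t,\lambda)\ (\lambda\neq0),\qquad P_n(\lambda)e^{V}=\Big(\sum_{j=0}^nw^{(n)}_j\lambda^{n-j}\Big)e^{V},$$ $$\partial_r\big(P_ne^{V}\big)=(L^{(n)})^r_+\big(P_ne^{V}\big),$$ $$Z_N=h_0h_1\cdots h_{N-1}=\Phi^{(0)}\cdots\Phi^{(N-1)}=W_N[h_0,\partial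 h_0,\dots,\partial^{N-1}h_0],$$ where $W_N[f_1,\dots,f_N]=\det(\partial^{i-1}f_j)$. Moreover $Z_N$ is the $\tau$-function of $L^{(N)}$: it does not vanish, $\partial_x\partial_r\ln Z_N=\operatorname{Res}(L^{(N)})^r$, and $w^{(N)}_j=p_j(-[\partial])Z_N/Z_N$ for all $j\ge 0$ at those $t$ where $\partial_1,\dots,\partial_j$ all make sense, with $[\partial]=(\partial_1,\tfrac12\partial_2,\tfrac13\partial_3,\dots)$ and $e^{\sum_l z^ls_l}=\sum_jz^jp_j(s)$. Finally $Z^{\rm mat}_N[t]=C_N Z_N[t]$ with a constant $C_N>0$ that does not depend on $t$. The integrals defining $Z_N$ and $Z_N^{\rm mat}$ converge. -/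

import Mathlib

open MeasureTheory Filter Topology

namespace OneMatrix

noncomputable section

/-! ### Formal pseudo-differential operators -/

/-- Formal pseudo-differential operators `∑_{n ≤ N} a_n D^n` (coefficients on the left) with
coefficients in `A`. -/
structure PsiDO (A : Type*) [Zero A] where
  coeff : ℤ → A
  bdd : ∃ N : ℤ, ∀ n, N < n → coeff n = 0

namespace PsiDO

variable {A : Type*} [CommRing A]

/-- The operator `a D^n`. -/
def monomial (a : A) (n : ℤ) : PsiDO A where
  coeff m := if m = n then a else 0
  bdd := ⟨n, fun _ hm => if_neg (ne_of_gt hm)⟩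

instance : One (PsiDO A) := ⟨monomial 1 0⟩

instance : Add (PsiDO A) :=
  ⟨fun P Q =>
    { coeff := fun n => P.coeff n + Q.coeff n
      bdd := by
        obtain ⟨N, hN⟩ := P.bdd
        obtain ⟨M, hM⟩ := Q.bdd
        exact ⟨max N M, fun n hn => by
          rw [hN n (lt_of_le_of_lt (le_max_left _ _) hn),
            hM n (lt_of_le_of_lt (le_max_right _ _) hn), add_zero]⟩ }⟩

instance : Neg (PsiDO A) :=
  ⟨fun P =>
    { coeff := fun n => -P.coeff n
      bdd := by
        obtain ⟨N, hN⟩ := P.bdd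
        exact ⟨N, fun n hn => by rw [hN n hn, neg_zero]⟩ }⟩

/-- The purely differential part `P_+`. -/
def plus (P : PsiDO A) : PsiDO A where
  coeff n := if 0 ≤ n then P.coeff n else 0
  bdd := by
    obtain ⟨N, hN⟩ := P.bdd
    exact ⟨N, fun n hn => by rw [hN n hn, ite_self]⟩

/-- The purely pseudo-differential part `P_-`. -/
def minus (P : PsiDO A) : PsiDO A where
  coeff n := if n < 0 then P.coeff n else 0
  bdd := by
    obtain ⟨N, hN⟩ := P.bdd
    exact ⟨N, fun n hn => by rw [hN n hn, ite_self]⟩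

/-- The product of pseudo-differential operators, given by the generalized Leibniz rule
`D^i f = ∑_{k ≥ 0} (i choose k) (d^k f) D^{i-k}` for all `i ∈ ℤ`; here `d` is the derivation of
the coefficients.  The sum has only finitely many non-zero terms. -/
def mul (d : ZeroHom A A) (P Q : PsiDO A) : PsiDO A where
  coeff n := ∑ᶠ p : ℤ × ℕ,
    Ring.choose p.1 p.2 • (P.coeff p.1 * d^[p.2] (Q.coeff (n - p.1 + p.2)))
  bdd := by
    obtain ⟨N, hN⟩ := P.bdd
    obtain ⟨M, hM⟩ := Q.bdd
    refine ⟨N + M, fun n hn => ?_⟩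
    rw [← finsum_zero (α := ℤ × ℕ)]
    congr 1
    funext p
    by_cases h : N < p.1
    · rw [hN _ h, zero_mul, smul_zero]
    · have h2 : M < n - p.1 + p.2 := by
        have : (0 : ℤ) ≤ p.2 := Int.natCast_nonneg _
        omega
      have h3 : d^[p.2] (0 : A) = 0 := Function.iterate_fixed (map_zero d) _
      rw [hM _ h2, h3, mul_zero, smul_zero]

/-- Powers with respect to `mul`. -/
def pow (d : ZeroHom A A) (P : PsiDO A) : ℕ → PsiDO A
  | 0 => 1
  | k + 1 => mul d (pow d P k) P

/-- `[P, Q]`. -/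
def comm (d : ZeroHom A A) (P Q : PsiDO A) : PsiDO A := mul d P Q + -(mul d Q P)

/-- The action `P_+(f) = ∑_{i ≥ 0} a_i d^i f` of the differential part on a coefficient `f`. -/
def act (d : ZeroHom A A) (P : PsiDO A) (f : A) : A := ∑ᶠ i : ℕ, P.coeff i * d^[i] f

/-- The action `(P_+)^*(f) = ∑_{i ≥ 0} (-d)^i (a_i f)` of the formal adjoint of the differential
part; as `(P^*)_+ = (P_+)^*`, it is also `(P^*)_+(f)`. -/
def adjAct (d : ZeroHom A A) (P : PsiDO A) (f : A) : A :=
  ∑ᶠ i : ℕ, (-1) ^ i * d^[i] (P.coeff i * f)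

end PsiDO

/-! ### Times, flows and the potential -/

/-- The times `t = (t_1, t_2, …)`. -/
abbrev Times := ℕ+ → ℝ

/-- The coordinate direction of `t_r`. -/
def tdir (r : ℕ+) : Times := Pi.single r 1

/-- `V(t, x) = ξ(t, x) = ∑_{k ≥ 1} t_k x^k`. -/
def pot (t : Times) (x : ℝ) : ℝ := ∑' k : ℕ+, t k * x ^ (k : ℕ)

/-- The times at which the model is defined: `V(t, ·)` converges on the whole line, and
`exp V` is integrable for `t` and for all times obtained from `t` by a small change of `t_1`. -/
def timeDomain : Set Times :=
  {t | (∀ x : ℝ, Summable fun k : ℕ+ => t k * x ^ (k : ℕ)) ∧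
    ∀ᶠ s : ℝ in 𝓝 0, Integrable fun x : ℝ => Real.exp (pot (t + s • tdir 1) x)}

/-- `t` can be moved a little in both directions along `t_r` inside the domain, so that
`∂/∂t_r` makes sense at `t`. -/
def IsFlow (r : ℕ+) (t : Times) : Prop := ∀ᶠ s : ℝ in 𝓝 0, t + s • tdir r ∈ timeDomain

/-- `f` is differentiable in `t_r` at `t`, and `∂f/∂t_r = v` there. -/
def HasTimeDeriv (r : ℕ+) (f : Times → ℝ) (v : ℝ) (t : Times) : Prop :=
  HasDerivAt (fun s : ℝ => f (t + s • tdir r)) v 0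

/-- `∂f/∂t_r`. -/
def timeDeriv (r : ℕ+) (f : Times → ℝ) : Times → ℝ :=
  fun t => deriv (fun s : ℝ => f (t + s • tdir r)) 0

/-- `∂ = ∂/∂x` with `x = t_1`. -/
def dx : ZeroHom (Times → ℝ) (Times → ℝ) where
  toFun := timeDeriv 1
  map_zero' := by
    funext t
    simp [timeDeriv]

/-- Pseudo-differential operators in `D = ∂/∂t_1` whose coefficients are functions of the times. -/
abbrev Op := PsiDO (Times → ℝ)

/-- Product of operators. -/
local infixl:70 " ⬝ " => PsiDO.mul dx

/-- Equality of two operators at all times of the domain. -/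
def OpEq (P Q : Op) : Prop := ∀ t ∈ timeDomain, ∀ i : ℤ, P.coeff i t = Q.coeff i t

/-- `D^n`. -/
def Dpow (n : ℤ) : Op := PsiDO.monomial 1 n

/-- Multiplication by the function `f`. -/
def fn (f : Times → ℝ) : Op := PsiDO.monomial f 0

/-! ### Darboux–Bäcklund orbits of the free Lax operator -/

/-- `T = Φ D Φ⁻¹`. -/
def dbT (Φ : Times → ℝ) : Op := fn Φ ⬝ Dpow 1 ⬝ fn Φ⁻¹

/-- `T⁻¹ = Φ D⁻¹ Φ⁻¹`. -/
def dbTinv (Φ : Times → ℝ) : Op := fn Φ ⬝ Dpow (-1) ⬝ fn Φ⁻¹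

/-- `L^{(0)} = D`, `L^{(k+1)} = T^{(k)} L^{(k)} (T^{(k)})⁻¹`. -/
def dbLax (Φ : ℕ → Times → ℝ) : ℕ → Op
  | 0 => Dpow 1
  | k + 1 => dbT (Φ k) ⬝ dbLax Φ k ⬝ dbTinv (Φ k)

/-- `Ψ^{(0)} = 0`, `Ψ^{(k+1)} = (Φ^{(k)})⁻¹`. -/
def dbAdj (Φ : ℕ → Times → ℝ) : ℕ → Times → ℝ
  | 0 => 0
  | k + 1 => (Φ k)⁻¹

/-- The dressing operators `W^{(0)} = 1`, `W^{(k+1)} = T^{(k)} W^{(k)} D⁻¹`. -/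
def dbDress (Φ : ℕ → Times → ℝ) : ℕ → Op
  | 0 => 1
  | k + 1 => dbT (Φ k) ⬝ dbDress Φ k ⬝ Dpow (-1)

/-- `L` satisfies the KP Lax equations `∂L/∂t_r = [(L^r)_+, L]`. -/
def IsKPLax (L : Op) : Prop :=
  ∀ t ∈ timeDomain, ∀ r, IsFlow r t → ∀ i : ℤ,
    HasTimeDeriv r (L.coeff i) ((PsiDO.comm dx (L.pow dx r).plus L).coeff i t) t

/-- `Φ` is an eigenfunction of `L`: `∂Φ/∂t_r = (L^r)_+(Φ)`. -/
def IsEigenfunction (L : Op) (Φ : Times → ℝ) : Prop :=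
  ∀ t ∈ timeDomain, ∀ r, IsFlow r t → HasTimeDeriv r Φ ((L.pow dx r).act dx Φ t) t

/-- `Ψ` is an adjoint eigenfunction of `L`: `∂Ψ/∂t_r = -((L^*)^r)_+(Ψ)`. -/
def IsAdjEigenfunction (L : Op) (Ψ : Times → ℝ) : Prop :=
  ∀ t ∈ timeDomain, ∀ r, IsFlow r t → HasTimeDeriv r Ψ (-(L.pow dx r).adjAct dx Ψ t) t

/-- `L = D + Φ D⁻¹ Ψ` is a Lax operator of the constrained KP hierarchy `cKP_{1,1}`. -/
structure IsCKP (L : Op) (Φ Ψ : Times → ℝ) : Prop where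
  form : OpEq L (Dpow 1 + fn Φ ⬝ Dpow (-1) ⬝ fn Ψ)
  lax : IsKPLax L
  eigen : IsEigenfunction L Φ
  adj : IsAdjEigenfunction L Ψ

/-- The `Φ^{(k)}` are the eigenfunctions of a Darboux–Bäcklund orbit of `cKP_{1,1}` that starts
from `L^{(0)} = D`, that is, a solution of the generalized Burgers–Hopf system. -/
structure IsBHOrbit (Φ : ℕ → Times → ℝ) : Prop where
  ne_zero : ∀ k, ∀ t ∈ timeDomain, Φ k t ≠ 0
  smooth : ∀ k, ∀ t ∈ timeDomain,
    ContDiffAt ℝ (⊤ : ℕ∞) (fun s : ℝ => Φ k (t + s • tdir 1)) 0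
  ckp : ∀ k, IsCKP (dbLax Φ k) (Φ k) (dbAdj Φ k)
  recursion : ∀ k, ∀ t ∈ timeDomain,
    Φ (k + 1) t =
      Φ k t * dx^[2] (fun u => Real.log (Φ k u)) t + Φ k t ^ 2 * dbAdj Φ k t

/-- `φ(t) = ∫ ρ(x) exp ξ(t, x) dx`: the function `φ` has the spectral density `ρ`. -/
def HasDensity (ρ : ℝ → ℝ) (φ : Times → ℝ) : Prop :=
  ∀ t ∈ timeDomain, Integrable (fun x => ρ x * Real.exp (pot t x)) ∧
    φ t = ∫ x, ρ x * Real.exp (pot t x)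

/-! ### The same system through truncated dressing operators -/

/-- `W` is the dressing operator and `L = W D W⁻¹` the Lax operator of the fully degenerate
`n`-truncated KP hierarchy (the generalized Burgers–Hopf hierarchy) built on `φ`:
`W = 1 + w_1 D⁻¹ + ⋯ + w_n D⁻ⁿ` satisfies the Wilson–Sato equations
`∂W/∂t_r = -(L^r)_- W`, and the differential operator `W D^n` annihilates
`φ, ∂φ, …, ∂^{n-1}φ`, where `∂φ/∂t_r = ∂^r φ`. -/
structure IsGenBH (n : ℕ) (φ : Times → ℝ) (W L : Op) : Prop where
  free : ∀ t ∈ timeDomain, ∀ r, IsFlow r t → HasTimeDeriv r φ (dx^[(r : ℕ)] φ t) t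
  trunc : ∀ t ∈ timeDomain, ∀ i : ℤ, (i < -n ∨ 0 < i) → W.coeff i t = 0
  monic : ∀ t ∈ timeDomain, W.coeff 0 t = 1
  annih : ∀ t ∈ timeDomain, ∀ j < n, (W ⬝ Dpow n).act dx (dx^[j] φ) t = 0
  dress : OpEq (L ⬝ W) (W ⬝ Dpow 1)
  sato : ∀ t ∈ timeDomain, ∀ r, IsFlow r t → ∀ i : ℤ,
    HasTimeDeriv r (W.coeff i) (-((L.pow dx r).minus ⬝ W).coeff i t) t

/-- The Baker–Akhiezer function `ψ = W(e^ξ) = (∑_i w_i λ^i) e^{ξ(t, λ)}` of a dressing operator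
with finitely many terms. -/
def baFun (W : Op) (t : Times) (x : ℝ) : ℝ :=
  (∑ᶠ i : ℤ, W.coeff i t * x ^ i) * Real.exp (pot t x)

/-- The Wronskian `W_N[f_1, …, f_N] = det (∂^{i-1} f_j)`. -/
def wronskian {N : ℕ} (f : Fin N → Times → ℝ) (t : Times) : ℝ :=
  Matrix.det (Matrix.of fun i j : Fin N => dx^[(i : ℕ)] (f j) t)

/-- `p_j(-[∂]) f`, where `exp (∑_{l ≥ 1} z^l s_l) = ∑_j z^j p_j(s)` and
`-[∂] = (-∂_1, -∂_2 / 2, -∂_3 / 3, …)`.  Logarithmic differentiation of the generating function in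
`z` gives `p_0 = 1` and `(j + 1) p_{j+1}(-[∂]) = -∑_{i=1}^{j+1} ∂_i p_{j+1-i}(-[∂])`. -/
def schur (f : Times → ℝ) : ℕ → Times → ℝ
  | 0 => f
  | j + 1 => fun t =>
      -(∑ i : Fin (j + 1), timeDeriv (Nat.succPNat i) (schur f (j - i)) t) / (j + 1)

/-- `τ` is the tau-function of the KP hierarchy with Lax operator `L` and dressing operator `W`:
`w_j = p_j(-[∂]) τ / τ` and `∂_x ∂_r log τ = Res L^r`, wherever the flows involved make sense. -/
structure IsTau (W L : Op) (τ : Times → ℝ) : Prop where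
  ne_zero : ∀ t ∈ timeDomain, τ t ≠ 0
  dress : ∀ t ∈ timeDomain, ∀ j : ℕ, (∀ r : ℕ+, (r : ℕ) ≤ j → IsFlow r t) →
    W.coeff (-j) t = schur τ j t / τ t
  res : ∀ t ∈ timeDomain, ∀ r, IsFlow r t →
    HasTimeDeriv 1 (timeDeriv r fun u => Real.log (τ u)) ((L.pow dx r).coeff (-1) t) t

/-! ### The Hermitian one-matrix model -/

/-- The Hermitian matrix with real coordinates `X`: `M_ii = X_ii` and, for `i < j`,
`M_ij = X_ij + √-1 X_ji`, `M_ji = X_ij - √-1 X_ji`.  The measure `dM` is the Lebesgue measure in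
these coordinates. -/
def hermitian {N : ℕ} (X : Fin N → Fin N → ℝ) : Matrix (Fin N) (Fin N) ℂ :=
  Matrix.of fun i j =>
    if i = j then (X i i : ℂ)
    else if i < j then (X i j : ℂ) + X j i * Complex.I
    else (X j i : ℂ) - X i j * Complex.I

/-- `exp (∑_{r ≥ 1} t_r Tr M^r)`, where the traces of the Hermitian matrix `M^r` are real. -/
def matrixWeight {N : ℕ} (t : Times) (X : Fin N → Fin N → ℝ) : ℝ :=
  Real.exp (∑' r : ℕ+, t r * (Matrix.trace (hermitian X ^ (r : ℕ))).re)

/-- `∫ dM exp (∑_{r ≥ 1} t_r Tr M^r)` over Hermitian `N × N` matrices. -/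
def matrixIntegral (N : ℕ) (t : Times) : ℝ :=
  ∫ X : Fin N → Fin N → ℝ, matrixWeight t X

/-- The integrand `exp (∑_i V(t, x_i)) ∏_{j < i} (x_i - x_j)^2` of the eigenvalue integral. -/
def eigenvalueWeight {N : ℕ} (t : Times) (x : Fin N → ℝ) : ℝ :=
  Real.exp (∑ i, pot t (x i)) * ∏ i, ∏ j ∈ Finset.univ.filter (· < i), (x i - x j) ^ 2

/-- `Z_N[t]`, in the normalization `(1 / N!) ∫ ∏ dx_i exp (∑ V(t, x_i)) ∏_{i > j} (x_i - x_j)^2`. -/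
def Z (N : ℕ) (t : Times) : ℝ :=
  (1 / (N.factorial : ℝ)) * ∫ x : Fin N → ℝ, eigenvalueWeight t x

/-- `P t n` are the monic orthogonal polynomials for the weight `exp V(t, ·)`, with squared norms
`h n t`. -/
structure IsOrthogonal (P : Times → ℕ → Polynomial ℝ) (h : ℕ → Times → ℝ) : Prop where
  monic : ∀ t ∈ timeDomain, ∀ n, (P t n).Monic
  degree : ∀ t ∈ timeDomain, ∀ n, (P t n).natDegree = n
  integrable : ∀ t ∈ timeDomain, ∀ n m,
    Integrable fun x => (P t n).eval x * (P t m).eval x * Real.exp (pot t x)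
  orthogonal : ∀ t ∈ timeDomain, ∀ n m,
    ∫ x, (P t n).eval x * (P t m).eval x * Real.exp (pot t x) = if n = m then h m t else 0

/-- `W = ∑_{j=0}^n w_j D^{-j}` has the coefficients of `P_n(x) = ∑_{j=0}^n w_j x^{n-j}`. -/
def HasPolynomialSymbol (n : ℕ) (P : Times → ℕ → Polynomial ℝ) (W : Op) : Prop :=
  ∀ t ∈ timeDomain, ∀ i : ℤ,
    W.coeff i t = if 0 ≤ (n : ℤ) + i then (P t n).coeff ((n : ℤ) + i).toNat else 0

/-- The wave function `Ψ_n(t, x) = P_n(x) exp V(t, x)`. -/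
def wave (P : Times → ℕ → Polynomial ℝ) (n : ℕ) (t : Times) (x : ℝ) : ℝ :=
  (P t n).eval x * Real.exp (pot t x)

end

end OneMatrix

/-! ### Coefficient calculus of formal pseudo-differential operators -/

namespace OneMatrix

noncomputable section

namespace PsiDO

variable {A : Type*} [CommRing A]

/-! Since `∂_r V = λ^r`, the moments `m_k = ∫ λ^k e^V dλ` satisfy `∂_r m_k = m_{k+r}`. Apart from
the matrix integral, everything in the model is built from rational functions of the moments whose
denominators vanish nowhere on the domain. The analysis is therefore confined to
`hasTimeDeriv_moment`. The identities are proved in the ring `Rat` of such rational functions, where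
`∂_r` is an honest derivation, and are carried back to functions of the times by the evaluations `ev
t` (`Rep`, `RepOp`).

The algebra (`OrthData`) rests on nondegeneracy: a polynomial of degree `< n` orthogonal to all
polynomials of degree `< n` is zero (`eq_zero_of_orth`). Applied to `e^{-V} ∂(P_n e^V)` and to
`∂P_{n+1}` it yields `P_{n+1} = (∂ + λ - ∂ ln h_n) P_n` (`flow_p`) and `∂P_{n+1} = -(h_{n+1}/h_n)
P_n` (`polyDer_p_succ`). Read on differential operators with symbol `P_n`, the first says `T^{(n)}
P_n(D) = P_{n+1}(D)`. So the Darboux–Bäcklund chain is the chain of orthogonal polynomials, with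
`W^{(n)} = P_n(D) D^{-n}` and `L^{(n)} P_n(D) = P_n(D) D`. The second gives the form `D + h_{n+1}
D⁻¹ h_n⁻¹` of the Lax operator, and both together give the Toda equation, which is the recursion for
the eigenfunctions. For the higher flows, `e^{-V} ∂_r(P_n e^V)` is again orthogonal to degrees `<
n`, hence a left multiple of `P_n(D)`; counting orders identifies the quotient with `(L^r)_+`
(`plus_mul_sym`). The Lax, Sato and (adjoint) eigenfunction equations follow.

Conversely, an orbit is determined by `Φ^{(0)}` through the recursion. For the truncated hierarchy,
`∂^j φ = c m_j` turns the annihilation conditions into the orthogonality relations, which determine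
`W`, and `L W = W D` then determines `L`.

The eigenvalue integral is the Hankel determinant of the moments, and this equals `h_0 ⋯ h_{N-1}`.
The operators `p_j(-[∂])` are generated by the Miwa shift `m_k ↦ m_k - z m_{k+1}`. It changes the
Hankel matrix `H` into `H (1 - z C)` with `C` the companion matrix of `P_N`, so the shifted
determinant is `det H` times the reversed `P_N` (`map_miwa_hankelMom_det`): this is the τ-function
property.

For the matrix integral, the Gaussian matrix ensemble and the Gaussian eigenvalue ensemble satisfy
the same loop equations, by integration by parts. Hence their joint moments of power sums are
proportional (`LoopEq.apply_prod_eq`). Gaussian tails make these moments determine all integrals of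
`∏ w(x_i)` with measurable `w ≥ 0` (`tupleMeasure_eq`, `lintegral_prod_eq`), and `w = e^{V + x²/2}`
removes the Gaussian. -/

@[ext]
theorem ext_coeff {P Q : PsiDO A} (h : ∀ n, P.coeff n = Q.coeff n) : P = Q := by
  cases P; cases Q; congr; exact funext h

instance : Zero (PsiDO A) := ⟨⟨0, 0, fun _ _ => rfl⟩⟩

@[simp] theorem coeff_zero (n : ℤ) : (0 : PsiDO A).coeff n = 0 := rfl
@[simp] theorem coeff_add (P Q : PsiDO A) (n : ℤ) :
    (P + Q).coeff n = P.coeff n + Q.coeff n := rfl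
@[simp] theorem coeff_neg (P : PsiDO A) (n : ℤ) : (-P).coeff n = -P.coeff n := rfl
theorem coeff_monomial (a : A) (m n : ℤ) :
    (monomial a m).coeff n = if n = m then a else 0 := rfl
theorem coeff_plus (P : PsiDO A) (n : ℤ) :
    P.plus.coeff n = if 0 ≤ n then P.coeff n else 0 := rfl
theorem coeff_minus (P : PsiDO A) (n : ℤ) :
    P.minus.coeff n = if n < 0 then P.coeff n else 0 := rfl

instance : AddCommGroup (PsiDO A) where
  add_assoc P Q R := by ext n; simp [add_assoc]
  zero_add P := by ext n; simp
  add_zero P := by ext n; simp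
  nsmul := nsmulRec
  zsmul := zsmulRec
  neg_add_cancel P := by ext n; simp
  add_comm P Q := by ext n; simp [add_comm]

/-- The `n`-th coefficient as an additive map. -/
def coeffHom (n : ℤ) : PsiDO A →+ A where
  toFun P := P.coeff n
  map_zero' := rfl
  map_add' _ _ := rfl

@[simp] theorem coeff_sub (P Q : PsiDO A) (n : ℤ) :
    (P - Q).coeff n = P.coeff n - Q.coeff n := map_sub (coeffHom n) P Q

theorem coeff_sum {ι : Type*} (s : Finset ι) (f : ι → PsiDO A) (n : ℤ) :
    (∑ i ∈ s, f i).coeff n = ∑ i ∈ s, (f i).coeff n := map_sum (coeffHom n) f s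

theorem iterate_zeroHom_zero (d : ZeroHom A A) (k : ℕ) : d^[k] (0 : A) = 0 :=
  Function.iterate_fixed (map_zero d) _

/-- The finite range of indices that contribute to the `n`-th coefficient of a product of two
operators of orders at most `N` and `M`. -/
def mulSupport (N M n : ℤ) : Finset (ℤ × ℕ) :=
  Finset.Icc (n - M) N ×ˢ Finset.range (N + M - n + 1).toNat

theorem coeff_mul_term_eq_zero (d : ZeroHom A A) {P Q : PsiDO A} {N M : ℤ}
    (hP : ∀ i, N < i → P.coeff i = 0) (hQ : ∀ i, M < i → Q.coeff i = 0) (n : ℤ) {p : ℤ × ℕ}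
    (hp : p ∉ mulSupport N M n) :
    Ring.choose p.1 p.2 • (P.coeff p.1 * d^[p.2] (Q.coeff (n - p.1 + p.2))) = 0 := by
  by_cases h1 : N < p.1
  · rw [hP _ h1, zero_mul, smul_zero]
  by_cases h2 : M < n - p.1 + p.2
  · rw [hQ _ h2, iterate_zeroHom_zero, mul_zero, smul_zero]
  exfalso
  apply hp
  simp only [mulSupport, Finset.mem_product, Finset.mem_Icc, Finset.mem_range]
  refine ⟨⟨?_, ?_⟩, ?_⟩ <;> omega

/-- The summation set may be any finite set containing the window where terms can be non-zero, so
that products with different order bounds can be compared over a common index set. -/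
theorem coeff_mul (d : ZeroHom A A) {P Q : PsiDO A} {N M : ℤ}
    (hP : ∀ i, N < i → P.coeff i = 0) (hQ : ∀ i, M < i → Q.coeff i = 0) (n : ℤ)
    {s : Finset (ℤ × ℕ)} (hs : mulSupport N M n ⊆ s) :
    (mul d P Q).coeff n = ∑ p ∈ s,
      Ring.choose p.1 p.2 • (P.coeff p.1 * d^[p.2] (Q.coeff (n - p.1 + p.2))) := by
  refine finsum_eq_sum_of_support_subset _ fun p hp => ?_
  by_contra h
  exact hp (coeff_mul_term_eq_zero d hP hQ n fun h' => h (hs h'))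

theorem add_bdd {P Q : PsiDO A} {N M : ℤ} (hP : ∀ i, N < i → P.coeff i = 0)
    (hQ : ∀ i, M < i → Q.coeff i = 0) : ∀ i, max N M < i → (P + Q).coeff i = 0 := by
  intro i hi
  rw [coeff_add, hP i (lt_of_le_of_lt (le_max_left _ _) hi),
    hQ i (lt_of_le_of_lt (le_max_right _ _) hi), add_zero]

theorem mulSupport_mono {N N' M M' : ℤ} (hN : N ≤ N') (hM : M ≤ M') (n : ℤ) :
    mulSupport N M n ⊆ mulSupport N' M' n := by
  intro p hp
  simp only [mulSupport, Finset.mem_product, Finset.mem_Icc, Finset.mem_range] at *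
  refine ⟨⟨?_, ?_⟩, ?_⟩ <;> omega

theorem add_mul' (d : ZeroHom A A) (P Q R : PsiDO A) :
    mul d (P + Q) R = mul d P R + mul d Q R := by
  obtain ⟨N, hN⟩ := P.bdd
  obtain ⟨M, hM⟩ := Q.bdd
  obtain ⟨K, hK⟩ := R.bdd
  ext n
  rw [coeff_add, coeff_mul d (add_bdd hN hM) hK n subset_rfl,
    coeff_mul d hN hK n (mulSupport_mono (le_max_left N M) le_rfl n),
    coeff_mul d hM hK n (mulSupport_mono (le_max_right N M) le_rfl n), ← Finset.sum_add_distrib]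
  refine Finset.sum_congr rfl fun p _ => ?_
  rw [coeff_add, add_mul, smul_add]

/-- The `n`-th coefficient of a product only depends on the coefficients of high order. -/
theorem coeff_mul_congr (d : ZeroHom A A) {P P' Q Q' : PsiDO A} {N M : ℤ}
    (hP : ∀ i, N < i → P.coeff i = 0) (hQ : ∀ i, M < i → Q.coeff i = 0)
    (hP' : ∀ i, N < i → P'.coeff i = 0) (hQ' : ∀ i, M < i → Q'.coeff i = 0) (n : ℤ)
    (hPP : ∀ i, n - M ≤ i → P.coeff i = P'.coeff i)
    (hQQ : ∀ i, n - N ≤ i → Q.coeff i = Q'.coeff i) :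
    (mul d P Q).coeff n = (mul d P' Q').coeff n := by
  rw [coeff_mul d hP hQ n subset_rfl, coeff_mul d hP' hQ' n subset_rfl]
  refine Finset.sum_congr rfl fun p hp => ?_
  simp only [mulSupport, Finset.mem_product, Finset.mem_Icc, Finset.mem_range] at hp
  rw [hPP _ (by omega), hQQ _ (by omega)]

theorem mul_bdd (d : ZeroHom A A) {P Q : PsiDO A} {N M : ℤ}
    (hP : ∀ i, N < i → P.coeff i = 0) (hQ : ∀ i, M < i → Q.coeff i = 0) :
    ∀ i, N + M < i → (mul d P Q).coeff i = 0 := by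
  intro i hi
  rw [coeff_mul d hP hQ i subset_rfl]
  refine Finset.sum_eq_zero fun p hp => ?_
  simp only [mulSupport, Finset.mem_product, Finset.mem_Icc, Finset.mem_range] at hp
  omega

/-- The coefficients of `(a D^i) (b D^j)`. -/
theorem coeff_monomial_mul (d : ZeroHom A A) (a : A) (i : ℤ) (Q : PsiDO A) {M : ℤ}
    (hQ : ∀ j, M < j → Q.coeff j = 0) (n : ℤ) {K : ℕ} (hK : i + M - n < K) :
    (mul d (monomial a i) Q).coeff n =
      ∑ k ∈ Finset.range K, Ring.choose i k • (a * d^[k] (Q.coeff (n - i + k))) := by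
  have hP : ∀ j, i < j → (monomial a i).coeff j = 0 := fun j hj => by
    rw [coeff_monomial, if_neg (by omega)]
  rw [coeff_mul d hP hQ n (s := {i} ×ˢ Finset.range K ∪ mulSupport i M n)
    Finset.subset_union_right]
  rw [← Finset.sum_subset (Finset.subset_union_left (s₁ := {i} ×ˢ Finset.range K)),
    Finset.sum_product, Finset.sum_singleton]
  · refine Finset.sum_congr rfl fun k _ => ?_
    simp [coeff_monomial]
  · intro p _ hp
    by_cases h : p.1 = i
    · have h2 : ¬ p.2 < K := fun h2 => hp (by simp [← h, h2])
      rw [hQ _ (by omega), iterate_zeroHom_zero, mul_zero, smul_zero]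
    · rw [coeff_monomial, if_neg h, zero_mul, smul_zero]

/-- Only the vanishing of the iterated derivatives of `1` enters. The statement therefore also
serves for `dx`, which is not a derivation on all functions of the times. -/
theorem coeff_mul_monomial_one (d : ZeroHom A A) (hd : ∀ k, d^[k + 1] 1 = 0) (P : PsiDO A)
    (j n : ℤ) : (mul d P (monomial 1 j)).coeff n = P.coeff (n - j) := by
  obtain ⟨N, hN⟩ := P.bdd
  have hQ : ∀ i, j < i → (monomial (1 : A) j).coeff i = 0 := fun i hi => by
    rw [coeff_monomial, if_neg (by omega)]
  rw [coeff_mul d hN hQ n subset_rfl]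
  have key : ∀ p : ℤ × ℕ, p ≠ (n - j, 0) → Ring.choose p.1 p.2 • (P.coeff p.1 *
      d^[p.2] ((monomial (1 : A) j).coeff (n - p.1 + p.2))) = 0 := by
    rintro ⟨i, k⟩ hp
    rw [coeff_monomial]
    split_ifs with h
    · cases k with
      | zero => exact absurd (by ext <;> simp at h ⊢; omega) hp
      | succ k => rw [hd, mul_zero, smul_zero]
    · rw [iterate_zeroHom_zero, mul_zero, smul_zero]
  by_cases hm : (n - j, 0) ∈ mulSupport N j n
  · rw [Finset.sum_eq_single_of_mem _ hm fun p _ => key p]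
    simp [coeff_monomial]
  · rw [Finset.sum_eq_zero fun p hp => key p fun h => hm (h ▸ hp)]
    symm
    apply hN
    simp only [mulSupport, Finset.mem_product, Finset.mem_Icc, Finset.mem_range] at hm
    omega

/-- Right division by a monic operator `W` of order `n` lowers orders by `n`; the equations are only
required after applying a ring homomorphism. -/
theorem coeff_eq_zero_of_mul {B : Type*} [CommRing B] (ev : A →+* B) (d : ZeroHom A A)
    {X W : PsiDO A} {n : ℤ} (hn : ev (W.coeff n) = 1)
    (hW : ∀ k i, n < i → ev (d^[k] (W.coeff i)) = 0) (m : ℤ)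
    (hXW : ∀ i, m + n ≤ i → ev ((mul d X W).coeff i) = 0) : ev (X.coeff m) = 0 := by
  obtain ⟨N, hN⟩ := X.bdd
  obtain ⟨M, hM⟩ := W.bdd
  -- Descending induction on the order, starting above the top order `N` of `X`. In the coefficient
  -- of order `i + n` of `X W` every term but `(i, 0)` dies: higher coefficients of `X` vanish by
  -- induction, and the other terms meet a coefficient of `W` of order above `n`.
  have main : ∀ e : ℕ, ∀ i, m ≤ i → N - e < i → ev (X.coeff i) = 0 := by
    intro e
    induction e with
    | zero => exact fun i _ hi => by rw [hN i (by simpa using hi), map_zero]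
    | succ e ih =>
      intro i hmi hi
      have h := hXW (i + n) (by omega)
      rw [coeff_mul d hN hM _ (s := mulSupport N M (i + n) ∪ {(i, 0)})
        Finset.subset_union_left, map_sum, Finset.sum_eq_single (i, 0)] at h
      · simpa [hn] using h
      · rintro ⟨j, k⟩ _ hp
        rw [map_zsmul, map_mul]
        rcases lt_trichotomy j i with hj | rfl | hj
        · rw [hW _ _ (by simp only; omega), mul_zero, smul_zero]
        · have : k ≠ 0 := fun hk => hp (by rw [hk])
          rw [hW _ _ (by simp only; omega), mul_zero, smul_zero]
        · rw [ih j (by omega) (by push_cast at hi; omega), zero_mul, smul_zero]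
      · intro h; simp at h
  exact main (N - m + 1).toNat m le_rfl (by omega)

/-- The part of order at least `L`. -/
def cut (L : ℤ) (P : PsiDO A) : PsiDO A where
  coeff n := if L ≤ n then P.coeff n else 0
  bdd := by
    obtain ⟨N, hN⟩ := P.bdd
    exact ⟨N, fun n hn => by rw [hN n hn, ite_self]⟩

theorem coeff_cut (L : ℤ) (P : PsiDO A) (n : ℤ) :
    (cut L P).coeff n = if L ≤ n then P.coeff n else 0 := rfl

theorem cut_eq_sum (L : ℤ) {P : PsiDO A} {N : ℤ} (hN : ∀ i, N < i → P.coeff i = 0) :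
    cut L P = ∑ i ∈ Finset.Icc L N, monomial (P.coeff i) i := by
  ext n
  rw [coeff_sum, coeff_cut]
  simp only [coeff_monomial, Finset.sum_ite_eq, Finset.mem_Icc]
  by_cases h : L ≤ n <;> by_cases h' : n ≤ N <;> simp [h, h', hN n, not_le.mp]

/-! ### Associativity of the product when the coefficients carry a derivation -/

section Derivation

variable (d : Derivation ℤ A A)

/-- A derivation as a map preserving zero. -/
def zeroHom : ZeroHom A A := ⟨d, map_zero d⟩

theorem zeroHom_iterate_add (k : ℕ) (a b : A) :
    (zeroHom d)^[k] (a + b) = (zeroHom d)^[k] a + (zeroHom d)^[k] b := by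
  induction k generalizing a b with
  | zero => rfl
  | succ k ih =>
    simp only [Function.iterate_succ_apply]
    rw [← ih]; congr 1; exact map_add d a b

theorem zeroHom_iterate_zsmul (k : ℕ) (c : ℤ) (a : A) :
    (zeroHom d)^[k] (c • a) = c • (zeroHom d)^[k] a := by
  induction k generalizing a with
  | zero => rfl
  | succ k ih =>
    simp only [Function.iterate_succ_apply]
    rw [← ih]; congr 1; exact map_zsmul d c a

theorem zeroHom_iterate_one (k : ℕ) : (zeroHom d)^[k + 1] (1 : A) = 0 := by
  rw [Function.iterate_succ_apply]
  have : zeroHom d 1 = 0 := d.map_one_eq_zero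
  rw [this, iterate_zeroHom_zero]

theorem zeroHom_iterate_mul (k : ℕ) (a b : A) :
    (zeroHom d)^[k] (a * b) = ∑ ij ∈ Finset.HasAntidiagonal.antidiagonal k,
      k.choose ij.1 • ((zeroHom d)^[ij.1] a * (zeroHom d)^[ij.2] b) := by
  induction k with
  | zero => simp
  | succ k ih =>
    rw [Function.iterate_succ_apply', ih, Finset.sum_antidiagonal_choose_succ_nsmul
      (M := A) fun i j => (zeroHom d)^[i] a * (zeroHom d)^[j] b]
    have hd : ∀ x, zeroHom d x = d x := fun _ => rfl
    rw [hd, map_sum, ← Finset.sum_add_distrib]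
    refine Finset.sum_congr rfl fun p hp => ?_
    rw [map_nsmul, d.leibniz, ← hd, ← hd, ← Function.iterate_succ_apply' (zeroHom d),
      ← Function.iterate_succ_apply' (zeroHom d), smul_eq_mul, smul_eq_mul, smul_add,
      Nat.choose_symm_of_eq_add (Finset.HasAntidiagonal.mem_antidiagonal.mp hp).symm, mul_comm ((zeroHom d)^[p.2] b)]

theorem mul_add' (P Q R : PsiDO A) :
    mul (zeroHom d) P (Q + R) = mul (zeroHom d) P Q + mul (zeroHom d) P R := by
  obtain ⟨N, hN⟩ := P.bdd
  obtain ⟨M, hM⟩ := Q.bdd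
  obtain ⟨K, hK⟩ := R.bdd
  ext n
  rw [coeff_add, coeff_mul _ hN (add_bdd hM hK) n subset_rfl,
    coeff_mul _ hN hM n (mulSupport_mono le_rfl (le_max_left M K) n),
    coeff_mul _ hN hK n (mulSupport_mono le_rfl (le_max_right M K) n), ← Finset.sum_add_distrib]
  refine Finset.sum_congr rfl fun p _ => ?_
  rw [coeff_add, zeroHom_iterate_add, mul_add, smul_add]

theorem coeff_mul_monomial {X : PsiDO A} {N : ℤ} (hX : ∀ i, N < i → X.coeff i = 0) (c : A)
    (l : ℤ) (e : ℕ) : (mul (zeroHom d) X (monomial c l)).coeff (N + l - e) =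
      ∑ p ∈ Finset.HasAntidiagonal.antidiagonal e,
        Ring.choose (N - p.1) p.2 • (X.coeff (N - p.1) * (zeroHom d)^[p.2] c) := by
  classical
  have hc : ∀ i, l < i → (monomial c l).coeff i = 0 := fun i hi => by
    rw [coeff_monomial, if_neg (by omega)]
  have hinj : Set.InjOn (fun p : ℕ × ℕ => (N - (p.1 : ℤ), p.2))
      (Finset.HasAntidiagonal.antidiagonal e : Finset (ℕ × ℕ)) := by
    rintro ⟨a, b⟩ _ ⟨a', b'⟩ _ h
    simp only [Prod.mk.injEq] at h ⊢
    omega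
  rw [coeff_mul _ hX hc _ (s := (Finset.HasAntidiagonal.antidiagonal e).image
    (fun p : ℕ × ℕ => (N - (p.1 : ℤ), p.2)) ∪ mulSupport N l (N + l - e))
    Finset.subset_union_right, ← Finset.sum_subset Finset.subset_union_left,
    Finset.sum_image hinj]
  · refine Finset.sum_congr rfl fun p hp => ?_
    rw [Finset.HasAntidiagonal.mem_antidiagonal] at hp
    rw [coeff_monomial, if_pos (by omega)]
  · rintro ⟨i, k⟩ _ hp
    by_cases hi : N < i
    · rw [hX _ hi, zero_mul, smul_zero]
    rw [coeff_monomial]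
    split_ifs with h
    · exfalso
      refine hp (Finset.mem_image.mpr ⟨((N - i).toNat, k), ?_, ?_⟩)
      · rw [Finset.HasAntidiagonal.mem_antidiagonal]; simp only at h ⊢; omega
      · simp only [Prod.mk.injEq, and_true]; omega
    · rw [iterate_zeroHom_zero, mul_zero, smul_zero]

theorem coeff_monomial_mul' (a : A) (i : ℤ) {Y : PsiDO A} {M : ℤ}
    (hY : ∀ i, M < i → Y.coeff i = 0) (e : ℕ) :
    (mul (zeroHom d) (monomial a i) Y).coeff (i + M - e) =
      ∑ p ∈ Finset.HasAntidiagonal.antidiagonal e,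
        Ring.choose i p.1 • (a * (zeroHom d)^[p.1] (Y.coeff (M - p.2))) := by
  rw [coeff_monomial_mul _ a i Y hY _ (K := e + 1) (by push_cast; omega),
    Finset.Nat.sum_antidiagonal_eq_sum_range_succ
      (fun k m => Ring.choose i k • (a * (zeroHom d)^[k] (Y.coeff (M - m))))]
  refine Finset.sum_congr rfl fun k hk => ?_
  rw [Finset.mem_range] at hk
  rw [show i + M - (e : ℤ) - i + k = M - ((e - k : ℕ) : ℤ) by omega]

theorem coeff_monomial_mul_monomial (a b : A) (i j : ℤ) (e : ℕ) :
    (mul (zeroHom d) (monomial a i) (monomial b j)).coeff (i + j - e) =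
      Ring.choose i e • (a * (zeroHom d)^[e] b) := by
  rw [coeff_monomial_mul' d a i (M := j) (fun l hl => by rw [coeff_monomial, if_neg (by omega)]),
    Finset.sum_eq_single (e, 0)]
  · simp [coeff_monomial]
  · rintro ⟨k, m⟩ hp hne
    have hm : m ≠ 0 := by
      rintro rfl
      rw [Finset.HasAntidiagonal.mem_antidiagonal] at hp
      exact hne (by simp at hp; rw [hp])
    rw [coeff_monomial, if_neg (by simp only; omega), iterate_zeroHom_zero, mul_zero, smul_zero]
  · intro h; simp at h

theorem monomial_bdd (a : A) (i : ℤ) : ∀ l, i < l → (monomial a i).coeff l = 0 :=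
  fun l hl => by rw [coeff_monomial, if_neg (by omega)]

/-- Both sides have the same terms `a (d^p b)(d^q c)`. On the left the binomial coefficient of the
order `i - p + j` splits by the Chu–Vandermonde identity; on the right the iterated derivative of a
product splits by the Leibniz rule. -/
theorem monomial_mul_assoc (a b c : A) (i j l : ℤ) :
    mul (zeroHom d) (mul (zeroHom d) (monomial a i) (monomial b j)) (monomial c l) =
    mul (zeroHom d) (monomial a i) (mul (zeroHom d) (monomial b j) (monomial c l)) := by
  have hab := mul_bdd (zeroHom d) (monomial_bdd a i) (monomial_bdd b j)
  have hbc := mul_bdd (zeroHom d) (monomial_bdd b j) (monomial_bdd c l)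
  ext n
  by_cases hn : i + j + l < n
  · rw [mul_bdd _ hab (monomial_bdd c l) n hn,
      mul_bdd _ (monomial_bdd a i) hbc n (by omega)]
  obtain ⟨e, rfl⟩ : ∃ e : ℕ, n = i + j + l - e := ⟨(i + j + l - n).toNat, by omega⟩
  rw [coeff_mul_monomial d hab, show i + j + l - (e : ℤ) = i + (j + l) - e by ring,
    coeff_monomial_mul' d a i hbc]
  have hL : ∀ p : ℕ × ℕ, Ring.choose (i + j - p.1) p.2 •
      ((mul (zeroHom d) (monomial a i) (monomial b j)).coeff (i + j - p.1) *
        (zeroHom d)^[p.2] c) = ∑ q ∈ Finset.HasAntidiagonal.antidiagonal p.2,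
      (Ring.choose i p.1 * (Ring.choose j q.2 * Ring.choose (i - p.1) q.1)) •
      (a * ((zeroHom d)^[p.1] b * (zeroHom d)^[p.2] c)) := by
    intro p
    rw [coeff_monomial_mul_monomial, ← Finset.sum_smul, ← Finset.mul_sum,
      show i + j - (p.1 : ℤ) = (i - p.1) + j by ring, Ring.add_choose_eq _ (Commute.all _ _),
      smul_mul_assoc, smul_smul, mul_assoc, mul_comm (Ring.choose i p.1)]
    congr 2
    exact Finset.sum_congr rfl fun q _ => mul_comm _ _
  have hR : ∀ p : ℕ × ℕ, Ring.choose i p.1 • (a * (zeroHom d)^[p.1]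
      ((mul (zeroHom d) (monomial b j) (monomial c l)).coeff (j + l - p.2))) =
      ∑ q ∈ Finset.HasAntidiagonal.antidiagonal p.1,
      (Ring.choose i p.1 * (Ring.choose j p.2 * p.1.choose q.1)) •
      (a * ((zeroHom d)^[q.1] b * (zeroHom d)^[q.2 + p.2] c)) := by
    intro p
    rw [coeff_monomial_mul_monomial, zeroHom_iterate_zsmul, zeroHom_iterate_mul, mul_smul_comm,
      smul_smul, Finset.mul_sum, Finset.smul_sum]
    refine Finset.sum_congr rfl fun q _ => ?_
    rw [mul_smul_comm, ← Nat.cast_smul_eq_nsmul ℤ, smul_smul, mul_assoc,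
      Function.iterate_add_apply]
  rw [Finset.sum_congr rfl fun p _ => hL p, Finset.sum_congr rfl fun p _ => hR p,
    Finset.sum_sigma', Finset.sum_sigma', eq_comm]
  -- Terms are matched by the numbers of derivatives falling on `b` and on `c`. What remains is
  -- `C(i, p+q) C(p+q, p) = C(i, p) C(i-p, q)`.
  refine Finset.sum_nbij' (fun x => ⟨(x.2.1, x.2.2 + x.1.2), (x.2.2, x.1.2)⟩)
    (fun y => ⟨(y.1.1 + y.2.1, y.2.2), (y.1.1, y.2.1)⟩) ?_ ?_ ?_ ?_ ?_
  · rintro ⟨⟨k, m⟩, p, q⟩ h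
    simp at h ⊢; omega
  · rintro ⟨⟨k, m⟩, p, q⟩ h
    simp at h ⊢; omega
  · rintro ⟨⟨k, m⟩, p, q⟩ h
    simp at h ⊢; omega
  · rintro ⟨⟨k, m⟩, p, q⟩ h
    simp at h ⊢; omega
  · rintro ⟨⟨k, m⟩, p, q⟩ h
    simp only [Finset.mem_sigma, Finset.HasAntidiagonal.mem_antidiagonal] at h
    obtain ⟨h1, h2⟩ := h
    subst h2
    have := Ring.choose_smul_choose i (Nat.le_add_right p q)
    rw [Nat.add_sub_cancel_left, nsmul_eq_mul] at this
    congr 1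
    simp only
    linear_combination Ring.choose j m * this

theorem cut_bdd {P : PsiDO A} {N : ℤ} (hN : ∀ i, N < i → P.coeff i = 0) (L : ℤ) :
    ∀ i, N < i → (cut L P).coeff i = 0 := fun i hi => by rw [coeff_cut, hN i hi, ite_self]

theorem zero_mul' (P : PsiDO A) : mul (zeroHom d) 0 P = 0 := by
  have := add_mul' (zeroHom d) 0 0 P
  rwa [add_zero, eq_comm, add_eq_left] at this

theorem mul_zero' (P : PsiDO A) : mul (zeroHom d) P 0 = 0 := by
  have := mul_add' d P 0 0
  rwa [add_zero, eq_comm, add_eq_left] at this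

/-- Left multiplication as an additive map. -/
def mulLeftHom (P : PsiDO A) : PsiDO A →+ PsiDO A where
  toFun Q := mul (zeroHom d) P Q
  map_zero' := mul_zero' d P
  map_add' := mul_add' d P

/-- Right multiplication as an additive map. -/
def mulRightHom (Q : PsiDO A) : PsiDO A →+ PsiDO A where
  toFun P := mul (zeroHom d) P Q
  map_zero' := zero_mul' d Q
  map_add' P R := add_mul' _ P R Q

theorem sum_mul' {ι : Type*} (s : Finset ι) (f : ι → PsiDO A) (Q : PsiDO A) :
    mul (zeroHom d) (∑ i ∈ s, f i) Q = ∑ i ∈ s, mul (zeroHom d) (f i) Q :=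
  map_sum (mulRightHom d Q) f s

theorem mul_sum' {ι : Type*} (s : Finset ι) (f : ι → PsiDO A) (Q : PsiDO A) :
    mul (zeroHom d) Q (∑ i ∈ s, f i) = ∑ i ∈ s, mul (zeroHom d) Q (f i) :=
  map_sum (mulLeftHom d Q) f s

/-- A given coefficient of a product depends on finitely many coefficients of the factors, so the
factors may be cut to finite sums of monomials, and additivity reduces the claim to monomials. -/
theorem mul_assoc' (P Q R : PsiDO A) :
    mul (zeroHom d) (mul (zeroHom d) P Q) R = mul (zeroHom d) P (mul (zeroHom d) Q R) := by
  obtain ⟨N, hN⟩ := P.bdd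
  obtain ⟨M, hM⟩ := Q.bdd
  obtain ⟨K, hK⟩ := R.bdd
  have key : ∀ L₁ L₂ L₃, mul (zeroHom d) (mul (zeroHom d) (cut L₁ P) (cut L₂ Q)) (cut L₃ R) =
      mul (zeroHom d) (cut L₁ P) (mul (zeroHom d) (cut L₂ Q) (cut L₃ R)) := by
    intro L₁ L₂ L₃
    simp only [cut_eq_sum _ hN, cut_eq_sum _ hM, cut_eq_sum _ hK, sum_mul', mul_sum',
      monomial_mul_assoc]
  ext n
  have hPQ := mul_bdd (zeroHom d) hN hM
  have hQR := mul_bdd (zeroHom d) hM hK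
  have cut_eq : ∀ (L : ℤ) (X : PsiDO A) i, L ≤ i → X.coeff i = (cut L X).coeff i :=
    fun L X i hi => by rw [coeff_cut, if_pos hi]
  -- With top orders `N`, `M`, `K`, the coefficient of order `n` of the triple product sees each
  -- factor only down to `n` minus the top orders of the other two.
  have hP' := cut_bdd hN (n - K - M)
  have hQ' := cut_bdd hM (n - K - N)
  have hR' := cut_bdd hK (n - N - M)
  rw [coeff_mul_congr _ hPQ hK (mul_bdd (zeroHom d) hP' hQ') hR' n
      (fun i hi => coeff_mul_congr _ hN hM hP' hQ' i (fun j hj => cut_eq _ _ _ (by omega))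
        (fun j hj => cut_eq _ _ _ (by omega))) (fun j hj => cut_eq _ _ _ (by omega)),
    coeff_mul_congr _ hN hQR hP' (mul_bdd (zeroHom d) hQ' hR') n
      (fun j hj => cut_eq _ _ _ (by omega))
      (fun i hi => coeff_mul_congr _ hM hK hQ' hR' i (fun j hj => cut_eq _ _ _ (by omega))
        (fun j hj => cut_eq _ _ _ (by omega))), key]

theorem one_eq_monomial : (1 : PsiDO A) = monomial 1 0 := rfl

theorem coeff_fn_mul (a : A) (P : PsiDO A) (n : ℤ) :
    (mul (zeroHom d) (monomial a 0) P).coeff n = a * P.coeff n := by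
  obtain ⟨N, hN⟩ := P.bdd
  rw [coeff_monomial_mul _ a 0 P hN n (K := (N - n).toNat + 1) (by push_cast; omega),
    Finset.sum_eq_single 0]
  · simp
  · intro k _ hk
    rw [Ring.choose_zero_pos ℤ (Nat.pos_of_ne_zero hk), zero_smul]
  · simp

theorem one_mul' (P : PsiDO A) : mul (zeroHom d) 1 P = P := by
  ext n
  rw [one_eq_monomial, coeff_fn_mul, one_mul]

theorem mul_one' (P : PsiDO A) : mul (zeroHom d) P 1 = P := by
  ext n
  rw [one_eq_monomial, coeff_mul_monomial_one _ (zeroHom_iterate_one d), sub_zero]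

end Derivation

end PsiDO

end

end OneMatrix

/-! ### The ring of pseudo-differential operators over a differential ring -/

namespace OneMatrix

noncomputable section

/-- Pseudo-differential operators as a ring, for a derivation `d` of the coefficients. -/
def PDO {A : Type*} [CommRing A] (_ : Derivation ℤ A A) : Type _ := PsiDO A

namespace PDO

open PsiDO Polynomial

variable {A : Type*} [CommRing A] {d : Derivation ℤ A A}

instance instAddCommGroup : AddCommGroup (PDO d) := inferInstanceAs (AddCommGroup (PsiDO A))

instance instRing : Ring (PDO d) where
  __ := instAddCommGroup (d := d)
  mul := PsiDO.mul (zeroHom d)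
  one := (1 : PsiDO A)
  left_distrib := mul_add' d
  right_distrib := add_mul' (zeroHom d)
  zero_mul := zero_mul' d
  mul_zero := mul_zero' d
  mul_assoc := mul_assoc' d
  one_mul := one_mul' d
  mul_one := mul_one' d
  zsmul := zsmulRec

/-- The coefficient of `D^n`. -/
def coeff (P : PDO d) (n : ℤ) : A := PsiDO.coeff P n

@[ext]
theorem ext {P Q : PDO d} (h : ∀ n, P.coeff n = Q.coeff n) : P = Q := PsiDO.ext_coeff h

@[simp] theorem coeff_zero (n : ℤ) : (0 : PDO d).coeff n = 0 := rfl
@[simp] theorem coeff_add (P Q : PDO d) (n : ℤ) :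
    (P + Q).coeff n = P.coeff n + Q.coeff n := rfl
@[simp] theorem coeff_neg (P : PDO d) (n : ℤ) : (-P).coeff n = -P.coeff n := rfl
@[simp] theorem coeff_sub (P Q : PDO d) (n : ℤ) :
    (P - Q).coeff n = P.coeff n - Q.coeff n := PsiDO.coeff_sub P Q n
theorem coeff_one (n : ℤ) : (1 : PDO d).coeff n = if n = 0 then 1 else 0 := rfl

theorem coeff_sum {ι : Type*} (s : Finset ι) (f : ι → PDO d) (n : ℤ) :
    (∑ i ∈ s, f i).coeff n = ∑ i ∈ s, (f i).coeff n := PsiDO.coeff_sum s f n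

theorem bdd (P : PDO d) : ∃ N : ℤ, ∀ n, N < n → P.coeff n = 0 := PsiDO.bdd P

/-- The operator `D^j`. -/
def D (j : ℤ) : PDO d := PsiDO.monomial 1 j

/-- Multiplication operators. -/
def fnHom (d : Derivation ℤ A A) : A →+* PDO d where
  toFun a := PsiDO.monomial a 0
  map_zero' := by
    ext n
    change (PsiDO.monomial (0 : A) 0).coeff n = 0
    rw [PsiDO.coeff_monomial, ite_self]
  map_one' := rfl
  map_add' a b := by
    ext n
    change (PsiDO.monomial (a + b) 0).coeff n =
      (PsiDO.monomial a 0).coeff n + (PsiDO.monomial b 0).coeff n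
    rw [PsiDO.coeff_monomial, PsiDO.coeff_monomial, PsiDO.coeff_monomial]
    split_ifs <;> simp
  map_mul' a b := by
    ext n
    refine Eq.trans ?_ (coeff_fn_mul d a (PsiDO.monomial b 0) n).symm
    change (PsiDO.monomial (a * b) 0).coeff n = _
    rw [PsiDO.coeff_monomial, PsiDO.coeff_monomial]
    split_ifs <;> simp

theorem coeff_D (j n : ℤ) : (D j : PDO d).coeff n = if n = j then 1 else 0 := rfl

theorem coeff_fnHom (a : A) (n : ℤ) : (fnHom d a).coeff n = if n = 0 then a else 0 := rfl

theorem coeff_fnHom_mul (a : A) (P : PDO d) (n : ℤ) : (fnHom d a * P).coeff n = a * P.coeff n :=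
  PsiDO.coeff_fn_mul d a P n

theorem coeff_mul_D (P : PDO d) (j n : ℤ) : (P * D j).coeff n = P.coeff (n - j) :=
  coeff_mul_monomial_one _ (zeroHom_iterate_one d) P j n

theorem D_mul_D (i j : ℤ) : (D i : PDO d) * D j = D (i + j) := by
  ext n
  rw [coeff_mul_D, coeff_D, coeff_D]
  exact if_congr (by constructor <;> intro <;> omega) rfl rfl

theorem D_zero : (D 0 : PDO d) = 1 := rfl

theorem coeff_D_one_mul (P : PDO d) (n : ℤ) :
    (D 1 * P).coeff n = P.coeff (n - 1) + d (P.coeff n) := by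
  obtain ⟨N, hN⟩ := P.bdd
  refine (coeff_monomial_mul _ 1 1 P hN n (K := (1 + N - n).toNat + 2) (by push_cast; omega)).trans ?_
  rw [← Finset.sum_subset (s₁ := Finset.range 2)
    (Finset.range_mono (Nat.le_add_left 2 _))]
  · rw [Finset.sum_range_succ, Finset.sum_range_one, Ring.choose_one_right,
      Ring.choose_zero_right]
    simp [coeff, zeroHom]
  · intro k _ hk
    have hk : 1 < k := by simpa using hk
    have : Ring.choose (1 : ℤ) k = 0 := by
      have := Ring.choose_natCast (R := ℤ) 1 k
      rw [Nat.choose_eq_zero_of_lt hk] at this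
      simpa using this
    rw [this, zero_smul]

theorem D_one_mul_fnHom (a : A) :
    (D 1 : PDO d) * fnHom d a = fnHom d a * D 1 + fnHom d (d a) := by
  ext n
  simp only [coeff_D_one_mul, coeff_add, coeff_fnHom_mul, coeff_fnHom, coeff_D]
  split_ifs with h1 h2 h2 <;> first | omega | simp

/-- Right division by a monic operator of order `n` lowers orders by `n`. -/
theorem coeff_eq_zero_of_mul {X W : PDO d} {n : ℤ} (hn : W.coeff n = 1)
    (hW : ∀ i, n < i → W.coeff i = 0) (m : ℤ) (h : ∀ i, m + n ≤ i → (X * W).coeff i = 0) :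
    X.coeff m = 0 := by
  refine PsiDO.coeff_eq_zero_of_mul (RingHom.id A) (zeroHom d) (X := X) (W := W) hn
    (fun k i hi => ?_) m h
  change (zeroHom d)^[k] (W.coeff i) = 0
  rw [hW i hi, iterate_zeroHom_zero]

/-- Cancellation of a monic operator on the right. -/
theorem eq_of_mul_right {X Y W : PDO d} {n : ℤ} (hn : W.coeff n = 1)
    (hW : ∀ i, n < i → W.coeff i = 0) (h : X * W = Y * W) : X = Y := by
  rw [← sub_eq_zero, ← sub_mul] at h
  rw [← sub_eq_zero]
  ext i
  exact coeff_eq_zero_of_mul hn hW i fun j _ => by rw [h, coeff_zero]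

theorem coeff_mul_eq_sum {P Q : PDO d} {N M : ℤ}
    (hP : ∀ i, N < i → P.coeff i = 0) (hQ : ∀ i, M < i → Q.coeff i = 0) (n : ℤ) :
    (P * Q).coeff n = ∑ p ∈ mulSupport N M n,
      Ring.choose p.1 p.2 • (P.coeff p.1 * (zeroHom d)^[p.2] (Q.coeff (n - p.1 + p.2))) :=
  PsiDO.coeff_mul (zeroHom d) hP hQ n subset_rfl

/-! ### Derivations acting on coefficients -/

/-- The coefficientwise action of a derivation. -/
def der (δ : Derivation ℤ A A) : PDO d →+ PDO d where
  toFun P := ⟨fun n => δ (P.coeff n), by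
    obtain ⟨N, hN⟩ := P.bdd
    exact ⟨N, fun n hn => by rw [hN n hn, map_zero]⟩⟩
  map_zero' := by ext n; exact map_zero δ
  map_add' P Q := by ext n; exact map_add δ _ _

theorem coeff_der (δ : Derivation ℤ A A) (P : PDO d) (n : ℤ) :
    (der δ P).coeff n = δ (P.coeff n) := rfl

/-- The product involves the coefficients and their `d`-derivatives only; as `δ` commutes with `d`,
it passes through the iterates and the Leibniz rule holds term by term. -/
theorem der_mul {δ : Derivation ℤ A A} (hδ : ∀ a, δ (d a) = d (δ a)) (P Q : PDO d) :
    der δ (P * Q) = der δ P * Q + P * der δ Q := by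
  obtain ⟨N, hN⟩ := P.bdd
  obtain ⟨M, hM⟩ := Q.bdd
  have hN' : ∀ i, N < i → (der δ P).coeff i = 0 := fun i hi => by
    rw [coeff_der, hN i hi, map_zero]
  have hM' : ∀ i, M < i → (der δ Q).coeff i = 0 := fun i hi => by
    rw [coeff_der, hM i hi, map_zero]
  have hit : ∀ k a, δ ((zeroHom d)^[k] a) = (zeroHom d)^[k] (δ a) := by
    intro k
    induction k with
    | zero => exact fun _ => rfl
    | succ k ih =>
      intro a
      rw [Function.iterate_succ_apply, ih, Function.iterate_succ_apply]
      exact congrArg _ (hδ a)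
  ext n
  rw [coeff_der, coeff_add, coeff_mul_eq_sum hN hM, coeff_mul_eq_sum hN' hM,
    coeff_mul_eq_sum hN hM', map_sum, ← Finset.sum_add_distrib]
  refine Finset.sum_congr rfl fun p _ => ?_
  rw [map_zsmul, δ.leibniz, ← smul_add, hit, coeff_der, coeff_der, smul_eq_mul, smul_eq_mul,
    add_comm, mul_comm (δ _)]

theorem der_D (δ : Derivation ℤ A A) (j : ℤ) : der δ (D j : PDO d) = 0 := by
  ext n
  rw [coeff_der, coeff_D]
  split_ifs <;> simp

/-! ### Differential operators as polynomials -/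

/-- A derivation acting on the coefficients of a polynomial. -/
def polyDer (δ : Derivation ℤ A A) : Derivation ℤ A[X] A[X] :=
  letI : Differential A := ⟨δ⟩
  Differential.mapCoeffs

theorem coeff_polyDer (δ : Derivation ℤ A A) (Q : A[X]) (i : ℕ) :
    (polyDer δ Q).coeff i = δ (Q.coeff i) := rfl

theorem polyDer_X (δ : Derivation ℤ A A) : polyDer δ (X : A[X]) = 0 :=
  letI : Differential A := ⟨δ⟩
  Differential.mapCoeffs_X

/-- The action `Q ↦ e^{-ξ} δ (Q e^ξ)` on polynomials of a derivation with `δ ξ = X^r`. -/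
def flow (δ : Derivation ℤ A A) (r : ℕ) : A[X] →+ A[X] :=
  (polyDer δ).toAddMonoidHom + AddMonoidHom.mulLeft (X ^ r)

theorem flow_apply (δ : Derivation ℤ A A) (r : ℕ) (Q : A[X]) :
    flow δ r Q = polyDer δ Q + X ^ r * Q := rfl

/-- The differential operator with symbol `Q`. -/
def sym (d : Derivation ℤ A A) : A[X] →+ PDO d where
  toFun Q := ⟨fun n => if 0 ≤ n then Q.coeff n.toNat else 0, Q.natDegree, fun n hn => by
    split_ifs
    · exact coeff_eq_zero_of_natDegree_lt (by omega)
    · rfl⟩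
  map_zero' := by
    ext n
    exact ite_self _
  map_add' P Q := by
    ext n
    change (if 0 ≤ n then (P + Q).coeff n.toNat else 0) = (if 0 ≤ n then P.coeff n.toNat else 0) +
      (if 0 ≤ n then Q.coeff n.toNat else 0)
    split_ifs <;> simp

theorem coeff_sym (Q : A[X]) (n : ℤ) :
    (sym d Q).coeff n = if 0 ≤ n then Q.coeff n.toNat else 0 := rfl

theorem sym_injective : Function.Injective (sym d) := by
  intro P Q h
  ext n
  have := congrArg (fun R : PDO d => R.coeff n) h
  simpa [coeff_sym] using this

theorem sym_C_mul (a : A) (Q : A[X]) : sym d (C a * Q) = fnHom d a * sym d Q := by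
  ext n
  rw [coeff_fnHom_mul, coeff_sym, coeff_sym]
  split_ifs <;> simp

theorem sym_one : sym d 1 = 1 := by
  ext n
  rw [coeff_sym, coeff_one]
  by_cases h : 0 ≤ n
  · rw [if_pos h, Polynomial.coeff_one]
    exact if_congr (by omega) rfl rfl
  · rw [if_neg h, if_neg (by omega)]

/-- The polynomial `Q` stands for `Q e^ξ = Q(D) e^ξ`, on which multiplication by `λ^r` is
composition with `D^r` on the right. -/
theorem sym_X_pow_mul (r : ℕ) (Q : A[X]) : sym d (X ^ r * Q) = sym d Q * D r := by
  ext n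
  rw [coeff_mul_D, coeff_sym, coeff_sym, coeff_X_pow_mul']
  split_ifs <;> first | omega | rfl | skip
  congr 1
  omega

theorem sym_polyDer (δ : Derivation ℤ A A) (Q : A[X]) :
    sym d (polyDer δ Q) = der δ (sym d Q) := by
  ext n
  rw [coeff_der, coeff_sym, coeff_sym, coeff_polyDer]
  split_ifs <;> simp

theorem sym_flow (δ : Derivation ℤ A A) (r : ℕ) (Q : A[X]) :
    sym d (flow δ r Q) = der δ (sym d Q) + sym d Q * D r := by
  rw [flow_apply, map_add, sym_polyDer, sym_X_pow_mul]

/-- Composition with `D` on the left differentiates `Q e^ξ`, and the Leibniz rule contributes the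
derivative of the coefficients and a factor `X` from the exponential. -/
theorem D_one_mul_sym (Q : A[X]) : D 1 * sym d Q = sym d (flow d 1 Q) := by
  rw [sym_flow]
  ext n
  rw [coeff_D_one_mul, coeff_add, coeff_der, Nat.cast_one, coeff_mul_D, add_comm]

theorem D_mul_sym (k : ℕ) (Q : A[X]) : D k * sym d Q = sym d ((flow d 1)^[k] Q) := by
  induction k generalizing Q with
  | zero => exact one_mul _
  | succ k ih =>
    rw [Function.iterate_succ_apply, ← ih, ← D_one_mul_sym, ← mul_assoc, D_mul_D]
    rfl

/-- The action of the differential part of `P` on `Q e^ξ`. -/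
def actPoly (P : PDO d) (Q : A[X]) : A[X] :=
  ∑ᶠ i : ℕ, C (P.coeff i) * (flow d 1)^[i] Q

theorem finite_support_coeff_mul {M : Type*} [MulZeroClass M] (c : A → M) (hc : c 0 = 0)
    (P : PDO d) (f : ℕ → M) {N : ℕ} (hN : ∀ i : ℤ, N < i → P.coeff i = 0) :
    (Function.support fun i : ℕ => c (P.coeff i) * f i) ⊆ Finset.range (N + 1) := by
  intro i hi
  by_contra h
  apply hi
  simp only [Finset.coe_range, Set.mem_Iio, not_lt] at h
  change c (P.coeff i) * f i = 0
  rw [hN i (by omega), hc, zero_mul]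

theorem nat_bdd (P : PDO d) : ∃ N : ℕ, ∀ i : ℤ, N < i → P.coeff i = 0 := by
  obtain ⟨N, hN⟩ := P.bdd
  exact ⟨N.toNat, fun i hi => hN i (by omega)⟩

theorem actPoly_eq_sum (P : PDO d) (Q : A[X]) {N : ℕ} (hN : ∀ i : ℤ, N < i → P.coeff i = 0) :
    actPoly P Q = ∑ i ∈ Finset.range (N + 1), C (P.coeff i) * (flow d 1)^[i] Q :=
  finsum_eq_sum_of_support_subset _ (finite_support_coeff_mul C C_0 P _ hN)

/-- The action of the differential part of `P` on `f`. -/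
def act (P : PDO d) (f : A) : A := PsiDO.act (zeroHom d) P f

theorem act_eq_sum (P : PDO d) (f : A) {N : ℕ} (hN : ∀ i : ℤ, N < i → P.coeff i = 0) :
    P.act f = ∑ i ∈ Finset.range (N + 1), P.coeff i * (zeroHom d)^[i] f :=
  finsum_eq_sum_of_support_subset _ (finite_support_coeff_mul id rfl P _ hN)

/-- The differential part of `P`. -/
def plus (P : PDO d) : PDO d := PsiDO.plus P

/-- The purely pseudo-differential part of `P`. -/
def minus (P : PDO d) : PDO d := PsiDO.minus P

theorem coeff_plus (P : PDO d) (n : ℤ) : P.plus.coeff n = if 0 ≤ n then P.coeff n else 0 := rfl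

theorem coeff_minus (P : PDO d) (n : ℤ) : P.minus.coeff n = if n < 0 then P.coeff n else 0 := rfl

theorem plus_add_minus (P : PDO d) : P.plus + P.minus = P := by
  ext n
  rw [coeff_add, coeff_plus, coeff_minus]
  split_ifs <;> first | omega | simp

theorem plus_eq_sum (P : PDO d) {N : ℕ} (hN : ∀ i : ℤ, N < i → P.coeff i = 0) :
    P.plus = ∑ i ∈ Finset.range (N + 1), fnHom d (P.coeff i) * D i := by
  ext n
  simp only [coeff_plus, coeff_sum, coeff_fnHom_mul, coeff_D, mul_ite, mul_one, mul_zero]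
  split_ifs with h
  · lift n to ℕ using h
    simp only [Nat.cast_inj, Finset.sum_ite_eq, Finset.mem_range]
    split_ifs with h
    · rfl
    · exact hN n (by omega)
  · rw [Finset.sum_eq_zero]
    intro i _
    rw [if_neg (by omega)]

/-- This converts equations for functions `Q e^ξ` into equations between operators, where monic
factors can be cancelled on the right. -/
theorem sym_actPoly (P : PDO d) (Q : A[X]) : sym d (actPoly P Q) = P.plus * sym d Q := by
  obtain ⟨N, hN⟩ := P.nat_bdd
  rw [actPoly_eq_sum P Q hN, plus_eq_sum P hN, map_sum, Finset.sum_mul]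
  exact Finset.sum_congr rfl fun i _ => by rw [sym_C_mul, mul_assoc, D_mul_sym]

/-- `P_+(f)` is the free term of `P f`. -/
theorem coeff_zero_mul_fnHom (P : PDO d) (f : A) : (P * fnHom d f).coeff 0 = P.act f := by
  obtain ⟨N, hN⟩ := P.nat_bdd
  rw [act_eq_sum P f hN]
  have h := coeff_mul_monomial d (X := P) hN f 0 N
  rw [show (N : ℤ) + 0 - N = 0 by ring] at h
  refine h.trans ?_
  rw [Finset.Nat.antidiagonal_eq_map', Finset.sum_map]
  refine Finset.sum_congr rfl fun i hi => ?_
  rw [Finset.mem_range] at hi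
  change Ring.choose ((N : ℤ) - ((N - i : ℕ) : ℤ)) i •
    (P.coeff ((N : ℤ) - ((N - i : ℕ) : ℤ)) * (zeroHom d)^[i] f) = _
  rw [show (N : ℤ) - ((N - i : ℕ) : ℤ) = i by omega, Ring.choose_natCast, Nat.choose_self]
  simp

/-- The action of the adjoint of the differential part of `P` on `f`. -/
def adjAct (P : PDO d) (f : A) : A := PsiDO.adjAct (zeroHom d) P f

/-- `(P_+)^*(f)` is the residue of `D⁻¹ f P`. -/
theorem coeff_D_inv_mul (P : PDO d) (f : A) :
    (D (-1) * (fnHom d f * P)).coeff (-1) = P.adjAct f := by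
  obtain ⟨N, hN⟩ := P.nat_bdd
  have hN' : ∀ i : ℤ, N < i → (fnHom d f * P).coeff i = 0 := fun i hi => by
    rw [coeff_fnHom_mul, hN i hi, mul_zero]
  refine (coeff_monomial_mul _ 1 (-1) (fnHom d f * P) hN' (-1) (K := N + 1)
    (by push_cast; omega)).trans ?_
  symm
  change ∑ᶠ i : ℕ, (-1) ^ i * (zeroHom d)^[i] (P.coeff i * f) = _
  rw [finsum_eq_sum_of_support_subset (s := Finset.range (N + 1))]
  · refine Finset.sum_congr rfl fun i _ => ?_
    have h := coeff_fnHom_mul f P i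
    rw [show (-1 : ℤ) - -1 + i = i by ring]
    change _ = _ • (1 * (zeroHom d)^[i] ((fnHom d f * P).coeff i))
    rw [h, Ring.choose_neg', one_mul, mul_comm f]
    simp [coeff, Units.smul_def]
  · intro i hi
    by_contra h
    apply hi
    simp only [Finset.coe_range, Set.mem_Iio, not_lt] at h
    change _ * (zeroHom d)^[i] (P.coeff i * f) = 0
    rw [hN i (by omega), zero_mul, iterate_zeroHom_zero, mul_zero]

/-- The residue of `P h D⁻¹ g` is `P_+(h) g`. -/
theorem coeff_mul_D_inv_mul_fnHom (P : PDO d) (g : A) :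
    (P * D (-1) * fnHom d g).coeff (-1) = P.coeff 0 * g := by
  obtain ⟨N, hN⟩ := P.nat_bdd
  have hN' : ∀ i, (N : ℤ) - 1 < i → (P * D (-1)).coeff i = 0 := fun i hi => by
    rw [coeff_mul_D, hN _ (by omega)]
  have h := coeff_mul_monomial d (X := P * D (-1)) hN' g 0 N
  rw [show (N : ℤ) - 1 + 0 - N = -1 by ring] at h
  refine h.trans ?_
  rw [Finset.sum_eq_single (N, 0)]
  · change Ring.choose ((N : ℤ) - 1 - N) 0 • ((P * D (-1)).coeff ((N : ℤ) - 1 - N) * g) = _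
    rw [Ring.choose_zero_right, one_smul, coeff_mul_D]
    congr 2
    ring
  · rintro ⟨i, k⟩ hp hne
    rw [Finset.HasAntidiagonal.mem_antidiagonal] at hp
    simp only at hp
    have hk : k ≠ 0 := by
      rintro rfl
      exact hne (by rw [← hp, add_zero])
    -- For `k > 0` the upper index is the natural number `k - 1 < k`, so the binomial coefficient
    -- vanishes.
    have : Ring.choose ((N : ℤ) - 1 - i) k = 0 := by
      rw [show (N : ℤ) - 1 - i = ((k - 1 : ℕ) : ℤ) by omega, Ring.choose_natCast,
        Nat.choose_eq_zero_of_lt (by omega), Nat.cast_zero]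
    simp only [this, zero_smul]
  · intro h; simp at h

end PDO

end

end OneMatrix

/-! ### Orthogonal polynomials under commuting flows, over an abstract ring -/

namespace OneMatrix

noncomputable section

open PDO Polynomial

/-- Orthogonal polynomials over a ring with commuting flows `δ_r`, for a linear functional `L`
that deforms under the flows as `Q ↦ ∫ Q e^ξ` does. -/
structure OrthData (K : Type*) [CommRing K] where
  δ : ℕ+ → Derivation ℤ K K
  comm : ∀ r a, δ r (δ 1 a) = δ 1 (δ r a)
  L : K[X] →ₗ[K] K
  der_L : ∀ r Q, δ r (L Q) = L (flow (δ r) r Q)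
  p : ℕ → K[X]
  h : ℕ → Kˣ
  coeff_self : ∀ n, (p n).coeff n = 1
  coeff_gt : ∀ n i, n < i → (p n).coeff i = 0
  orth : ∀ n j, j < n → L (X ^ j * p n) = 0
  norm : ∀ n, L (X ^ n * p n) = h n

/-- The same polynomials for a constant multiple of the functional. -/
@[reducible]
def OrthData.scale {K : Type*} [CommRing K] (S : OrthData K) (u : Kˣ)
    (hu : ∀ r, S.δ r (u : K) = 0) : OrthData K where
  δ := S.δ
  comm := S.comm
  L := (u : K) • S.L
  der_L r Q := by
    rw [LinearMap.smul_apply, LinearMap.smul_apply, smul_eq_mul, smul_eq_mul, Derivation.leibniz,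
      hu, smul_zero, add_zero, S.der_L, smul_eq_mul]
  p := S.p
  h n := u * S.h n
  coeff_self := S.coeff_self
  coeff_gt := S.coeff_gt
  orth n j hj := by rw [LinearMap.smul_apply, S.orth n j hj, smul_zero]
  norm n := by rw [LinearMap.smul_apply, S.norm, smul_eq_mul, Units.val_mul]

/-- The logarithmic derivative of a unit. -/
def logDer {K : Type*} [CommRing K] (δ : Derivation ℤ K K) (u : Kˣ) : K := δ u * ↑u⁻¹

section LogDer

variable {K : Type*} [CommRing K] (δ : Derivation ℤ K K)

theorem logDer_mul_self (u : Kˣ) : logDer δ u * u = δ u := by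
  rw [logDer, mul_assoc, Units.inv_mul, mul_one]

theorem der_unit_inv (u : Kˣ) : δ (↑u⁻¹ : K) = -(logDer δ u * ↑u⁻¹) := by
  have h : δ ((u : K) * ↑u⁻¹) = 0 := by rw [Units.mul_inv, δ.map_one_eq_zero]
  rw [δ.leibniz, smul_eq_mul, smul_eq_mul] at h
  have h2 : (↑u⁻¹ : K) * (u * δ (↑u⁻¹ : K) + ↑u⁻¹ * δ u) = 0 := by rw [h, mul_zero]
  rw [mul_add, ← mul_assoc, Units.inv_mul, one_mul] at h2
  rw [logDer]
  linear_combination h2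

theorem logDer_mul (u v : Kˣ) : logDer δ (u * v) = logDer δ u + logDer δ v := by
  rw [logDer, logDer, logDer, Units.val_mul, mul_inv, Units.val_mul, δ.leibniz, smul_eq_mul,
    smul_eq_mul]
  linear_combination (δ u * ↑u⁻¹) * v.mul_inv + (δ v * ↑v⁻¹) * u.mul_inv

theorem logDer_prod {ι : Type*} (s : Finset ι) (f : ι → Kˣ) :
    logDer δ (∏ i ∈ s, f i) = ∑ i ∈ s, logDer δ (f i) := by
  classical
  induction s using Finset.induction_on with
  | empty => simp [logDer]
  | insert a s ha ih => rw [Finset.prod_insert ha, Finset.sum_insert ha, logDer_mul, ih]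

theorem der_logDer_comm {δ δ' : Derivation ℤ K K} (h : ∀ a, δ (δ' a) = δ' (δ a)) (u : Kˣ) :
    δ (logDer δ' u) = δ' (logDer δ u) := by
  rw [logDer, logDer, δ.leibniz, δ'.leibniz, h, der_unit_inv, der_unit_inv]
  simp only [smul_eq_mul, logDer]
  ring

end LogDer

namespace OrthData

variable {K : Type*} [CommRing K] (S : OrthData K)

/-- The derivation `∂ = ∂/∂t_1`. -/
abbrev d : Derivation ℤ K K := S.δ 1

theorem L_mul (R Q : K[X]) {n : ℕ} (hR : ∀ i, n ≤ i → R.coeff i = 0) :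
    S.L (R * Q) = ∑ i ∈ Finset.range n, R.coeff i * S.L (X ^ i * Q) := by
  have : R = ∑ i ∈ Finset.range n, C (R.coeff i) * X ^ i := by
    ext k
    simp only [finsetSum_coeff, coeff_C_mul, coeff_X_pow, mul_ite, mul_one, mul_zero,
      Finset.sum_ite_eq, Finset.mem_range]
    split_ifs with h
    · rfl
    · exact hR k (not_lt.mp h)
  conv_lhs => rw [this, Finset.sum_mul, map_sum]
  exact Finset.sum_congr rfl fun i _ => by
    rw [mul_assoc, ← smul_eq_C_mul, map_smul, smul_eq_mul]

theorem L_mul_p (Q : K[X]) {n : ℕ} (hQ : ∀ i, n < i → Q.coeff i = 0) :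
    S.L (Q * S.p n) = Q.coeff n * S.h n := by
  rw [S.L_mul Q _ (n := n + 1) hQ, Finset.sum_range_succ, S.norm, Finset.sum_eq_zero, zero_add]
  intro i hi
  rw [S.orth n i (Finset.mem_range.mp hi), mul_zero]

/-- The top coefficient `q_m` of `Q` satisfies `q_m h_m = L(Q p_m)`, and expanding `p_m` in powers
makes the right side vanish. Since `h_m` is a unit, this works over rings with zero divisors. The
identities below are obtained from it by checking a degree and finitely many pairings. -/
theorem eq_zero_of_orth {Q : K[X]} {n : ℕ} (hQ : ∀ i, n ≤ i → Q.coeff i = 0)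
    (ho : ∀ j, j < n → S.L (X ^ j * Q) = 0) : Q = 0 := by
  have main : ∀ m, m ≤ n → (∀ i, m ≤ i → Q.coeff i = 0) → Q = 0 := by
    intro m
    induction m with
    | zero => exact fun _ h => by ext i; exact h i (Nat.zero_le i)
    | succ m ih =>
      intro hm h
      refine ih (by omega) fun i hi => ?_
      rcases hi.eq_or_lt with rfl | hi
      · have h1 := S.L_mul_p Q (n := m) h
        rw [mul_comm, S.L_mul _ _ (S.coeff_gt m : ∀ i, m + 1 ≤ i → _), Finset.sum_eq_zero] at h1
        · exact (Units.mul_left_eq_zero _).mp h1.symm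
        · intro i hi
          rw [ho i (by have := Finset.mem_range.mp hi; omega), mul_zero]
      · exact h i hi
  exact main n le_rfl hQ

theorem X_pow_mul_flow (r : ℕ+) (j : ℕ) (Q : K[X]) :
    X ^ j * flow (S.δ r) r Q = flow (S.δ r) r (X ^ j * Q) := by
  rw [flow_apply, flow_apply, Derivation.leibniz, Derivation.leibniz_pow, polyDer_X]
  simp only [smul_eq_mul]
  ring

theorem L_X_pow_mul_flow (r : ℕ+) (j : ℕ) (Q : K[X]) :
    S.L (X ^ j * flow (S.δ r) r Q) = S.δ r (S.L (X ^ j * Q)) := by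
  rw [X_pow_mul_flow, S.der_L]

theorem coeff_flow_one (Q : K[X]) (i : ℕ) :
    (flow S.d 1 Q).coeff i = S.d (Q.coeff i) + (X * Q).coeff i := by
  rw [flow_apply, Polynomial.coeff_add, coeff_polyDer, pow_one]

theorem p_zero : S.p 0 = 1 := by
  ext i
  rw [Polynomial.coeff_one]
  split_ifs with h
  · rw [h, S.coeff_self]
  · exact S.coeff_gt 0 i (Nat.pos_of_ne_zero h)

/-- `∂ ln h_n`. -/
def b (n : ℕ) : K := logDer S.d (S.h n)

/-- The left side is monic of degree `n + 1`, and its pairing with `X^j` is `∂ L(X^j p_n)`: zero for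
`j < n` and `∂h_n` for `j = n`. Subtracting `(∂ ln h_n) p_n` removes the last pairing, and what is
left must be `p_{n+1}`. -/
theorem flow_p (n : ℕ) : flow S.d 1 (S.p n) = S.p (n + 1) + C (S.b n) * S.p n := by
  rw [← sub_eq_zero]
  refine S.eq_zero_of_orth (n := n + 1) (fun i hi => ?_) fun j hj => ?_
  · obtain ⟨i, rfl⟩ : ∃ k, i = k + 1 := ⟨i - 1, by omega⟩
    rw [Polynomial.coeff_sub, coeff_flow_one, Polynomial.coeff_add, coeff_C_mul, coeff_X_mul,
      S.coeff_gt n (i + 1) (by omega), map_zero, zero_add, mul_zero, add_zero]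
    rcases (show n ≤ i by omega).eq_or_lt with rfl | h
    · rw [S.coeff_self, S.coeff_self, sub_self]
    · rw [S.coeff_gt n i h, S.coeff_gt _ _ (by omega), sub_self]
  · have hf : S.L (X ^ j * flow S.d 1 (S.p n)) = S.d (S.L (X ^ j * S.p n)) :=
      S.L_X_pow_mul_flow 1 j (S.p n)
    rw [mul_sub, map_sub, hf, mul_add, map_add, S.orth (n + 1) j hj, mul_left_comm,
      ← smul_eq_C_mul, map_smul, smul_eq_mul, zero_add]
    rcases (show j ≤ n by omega).eq_or_lt with rfl | h
    · rw [S.norm, b, logDer_mul_self, sub_self]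
    · rw [S.orth n j h, map_zero, mul_zero, sub_self]

/-- Differentiating `L(X^j p_{n+1}) = 0` for `j ≤ n` gives `L(X^j ∂p_{n+1}) = -L(X^{j+1} p_{n+1})`,
which is zero for `j < n` and `-h_{n+1}` for `j = n`. As `p_{n+1}` is monic, its derivative has
degree at most `n`. -/
theorem polyDer_p_succ (n : ℕ) :
    polyDer S.d (S.p (n + 1)) = -(C ((S.h (n + 1) : K) * ↑(S.h n)⁻¹) * S.p n) := by
  rw [← sub_eq_zero]
  refine S.eq_zero_of_orth (n := n + 1) (fun i hi => ?_) fun j hj => ?_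
  · rw [Polynomial.coeff_sub, coeff_polyDer, Polynomial.coeff_neg, coeff_C_mul, S.coeff_gt n i hi]
    rcases hi.eq_or_lt with rfl | h
    · rw [S.coeff_self, Derivation.map_one_eq_zero]; simp
    · rw [S.coeff_gt _ i h]; simp
  · have hf : S.L (X ^ j * flow S.d 1 (S.p (n + 1))) = S.d (S.L (X ^ j * S.p (n + 1))) :=
      S.L_X_pow_mul_flow 1 j _
    rw [flow_apply, S.orth _ j hj, map_zero, mul_add, map_add, ← mul_assoc, ← pow_add] at hf
    rw [mul_sub, mul_neg, sub_neg_eq_add, map_add, eq_neg_of_add_eq_zero_left hf, mul_left_comm,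
      ← smul_eq_C_mul, map_smul, smul_eq_mul]
    rcases (show j ≤ n by omega).eq_or_lt with rfl | h
    · rw [S.norm, S.norm, mul_assoc, Units.inv_mul, mul_one, neg_add_cancel]
    · rw [S.orth _ _ h, S.orth _ _ (by omega), mul_zero, neg_zero, add_zero]

/-- The subleading coefficient of `p n`. -/
def a : ℕ → K
  | 0 => 0
  | n + 1 => (S.p (n + 1)).coeff n

theorem a_succ (n : ℕ) : S.a (n + 1) = S.a n - S.b n := by
  have h := congrArg (fun Q => Q.coeff n) (S.flow_p n)
  simp only [coeff_flow_one, Polynomial.coeff_add, coeff_C_mul, S.coeff_self, Derivation.map_one_eq_zero] at h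
  cases n with
  | zero =>
    rw [mul_coeff_zero, coeff_X_zero] at h
    change (S.p 1).coeff 0 = 0 - _
    linear_combination -h
  | succ n =>
    rw [coeff_X_mul] at h
    change (S.p (n + 2)).coeff (n + 1) = (S.p (n + 1)).coeff n - _
    linear_combination -h

theorem a_eq (n : ℕ) : S.a n = -∑ k ∈ Finset.range n, S.b k := by
  induction n with
  | zero => simp [a]
  | succ n ih => rw [a_succ, ih, Finset.sum_range_succ]; ring

theorem d_a_succ (n : ℕ) : S.d (S.a (n + 1)) = -((S.h (n + 1) : K) * ↑(S.h n)⁻¹) := by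
  have h := congrArg (fun Q => Q.coeff n) (S.polyDer_p_succ n)
  simp only [coeff_polyDer, Polynomial.coeff_neg, coeff_C_mul, S.coeff_self, mul_one] at h
  exact h

/-- The subleading coefficient is read in two ways: `flow_p` gives `a_{n+1} - a_n = -∂ ln h_n`, and
`polyDer_p_succ` gives `∂a_{n+1} = -h_{n+1}/h_n`. Together they are the Toda equation for `∂² ln
h_n`; the lowest site has no left neighbour and is stated apart. -/
theorem toda_zero : S.d (S.b 0) = (S.h 1 : K) * ↑(S.h 0)⁻¹ := by
  have h : S.b 0 = -S.a 1 := by rw [a_succ, a]; ring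
  rw [h, map_neg, d_a_succ, neg_neg]

theorem toda_succ (n : ℕ) : S.d (S.b (n + 1)) =
    (S.h (n + 2) : K) * ↑(S.h (n + 1))⁻¹ - (S.h (n + 1) : K) * ↑(S.h n)⁻¹ := by
  have h : S.b (n + 1) = S.a (n + 1) - S.a (n + 2) := by rw [S.a_succ (n + 1)]; ring
  rw [h, map_sub, d_a_succ, d_a_succ]
  ring

/-! ### Lax and dressing operators -/

/-- `T = h D h⁻¹`. -/
def T (n : ℕ) : PDO S.d := fnHom S.d (S.h n) * D 1 * fnHom S.d ↑(S.h n)⁻¹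

/-- `T⁻¹ = h D⁻¹ h⁻¹`. -/
def Tinv (n : ℕ) : PDO S.d := fnHom S.d (S.h n) * D (-1) * fnHom S.d ↑(S.h n)⁻¹

theorem fn_inv_mul_fn (u : Kˣ) : fnHom S.d ↑u⁻¹ * fnHom S.d u = 1 := by
  rw [← map_mul, Units.inv_mul, map_one]

theorem fn_mul_fn_inv (u : Kˣ) : fnHom S.d u * fnHom S.d ↑u⁻¹ = 1 := by
  rw [← map_mul, Units.mul_inv, map_one]

theorem Tinv_mul_T (n : ℕ) : S.Tinv n * S.T n = 1 := by
  calc S.Tinv n * S.T n = fnHom S.d (S.h n) * D (-1) *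
        (fnHom S.d ↑(S.h n)⁻¹ * fnHom S.d (S.h n)) * D 1 * fnHom S.d ↑(S.h n)⁻¹ := by
        rw [T, Tinv]; noncomm_ring
    _ = _ := by
      rw [fn_inv_mul_fn, mul_one, mul_assoc (fnHom S.d _), D_mul_D, neg_add_cancel, D_zero,
        mul_one, fn_mul_fn_inv]

theorem T_eq (n : ℕ) : S.T n = D 1 - fnHom S.d (S.b n) := by
  rw [T, mul_assoc, D_one_mul_fnHom, mul_add, ← mul_assoc, fn_mul_fn_inv, one_mul, der_unit_inv,
    ← map_mul, sub_eq_add_neg, ← map_neg]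
  congr 2
  rw [mul_neg, mul_left_comm, Units.mul_inv, mul_one, b]

theorem T_mul_sym (n : ℕ) (Q : K[X]) :
    S.T n * sym S.d Q = sym S.d (flow S.d 1 Q - C (S.b n) * Q) := by
  rw [T_eq, sub_mul, D_one_mul_sym, map_sub, sym_C_mul]

/-- Since `T = D - ∂ ln h_n`, this is `flow_p` in operator form: a Darboux–Bäcklund step is a step
in the degree of the orthogonal polynomials. -/
theorem sym_p_succ (n : ℕ) : sym S.d (S.p (n + 1)) = S.T n * sym S.d (S.p n) := by
  rw [T_mul_sym, flow_p, add_sub_cancel_right]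

theorem coeff_sym_p_self (n : ℕ) : (sym S.d (S.p n)).coeff n = 1 := by
  rw [coeff_sym, if_pos (by omega), Int.toNat_natCast, S.coeff_self]

theorem coeff_sym_p_gt (n : ℕ) (i : ℤ) (hi : n < i) : (sym S.d (S.p n)).coeff i = 0 := by
  rw [coeff_sym, if_pos (by omega), S.coeff_gt _ _ (by omega)]

/-- Cancellation of `sym (p n)` on the right. -/
theorem cancel {Y Z : PDO S.d} (n : ℕ) (h : Y * sym S.d (S.p n) = Z * sym S.d (S.p n)) : Y = Z :=
  eq_of_mul_right (S.coeff_sym_p_self n) (S.coeff_sym_p_gt n) h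

/-- The Lax operators of the orbit. -/
def lax : ℕ → PDO S.d
  | 0 => D 1
  | n + 1 => S.T n * lax n * S.Tinv n

/-- The dressing operators of the orbit. -/
def dress : ℕ → PDO S.d
  | 0 => 1
  | n + 1 => S.T n * dress n * D (-1)

/-- Each conjugation by `T` is absorbed by `sym_p_succ`, so the Lax operator is `D` conjugated by
`p_n(D)`. The intertwining form avoids inverting `p_n(D)`. -/
theorem lax_mul_sym (n : ℕ) : S.lax n * sym S.d (S.p n) = sym S.d (S.p n) * D 1 := by
  induction n with
  | zero => rw [p_zero, sym_one, one_mul, mul_one]; rfl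
  | succ n ih =>
    rw [lax, sym_p_succ]
    calc S.T n * S.lax n * S.Tinv n * (S.T n * sym S.d (S.p n))
        = S.T n * S.lax n * (S.Tinv n * S.T n) * sym S.d (S.p n) := by noncomm_ring
      _ = S.T n * sym S.d (S.p n) * D 1 := by
        rw [Tinv_mul_T, mul_one, mul_assoc, ih, mul_assoc]

theorem lax_pow_mul_sym (n r : ℕ) :
    S.lax n ^ r * sym S.d (S.p n) = sym S.d (S.p n) * D r := by
  induction r with
  | zero => rw [pow_zero, one_mul, Nat.cast_zero, D_zero, mul_one]
  | succ r ih =>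
    rw [pow_succ, mul_assoc, lax_mul_sym, ← mul_assoc, ih, mul_assoc, D_mul_D]
    rfl

theorem dress_eq (n : ℕ) : S.dress n = sym S.d (S.p n) * D (-n) := by
  induction n with
  | zero => rw [p_zero, sym_one, one_mul]; rfl
  | succ n ih =>
    rw [dress, ih, sym_p_succ, ← mul_assoc, mul_assoc, D_mul_D]
    congr 2
    push_cast
    ring

/-- After composing with `p_{n+1}(D) = T p_n(D)` on the right, `D⁻¹` meets the `D` inside `T = h_n D
h_n⁻¹` and only `(h_{n+1}/h_n) p_n` is left. The claim thus becomes `polyDer_p_succ`. -/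
theorem lax_succ_eq (n : ℕ) : S.lax (n + 1) =
    D 1 + fnHom S.d (S.h (n + 1)) * D (-1) * fnHom S.d ↑(S.h n)⁻¹ := by
  refine S.cancel (n + 1) ?_
  rw [lax_mul_sym, add_mul, D_one_mul_sym]
  have h1 : fnHom S.d (S.h (n + 1)) * D (-1) * fnHom S.d ↑(S.h n)⁻¹ * sym S.d (S.p (n + 1)) =
      sym S.d (C ((S.h (n + 1) : K) * ↑(S.h n)⁻¹) * S.p n) := by
    rw [sym_p_succ, T, sym_C_mul, map_mul]
    calc _ = fnHom S.d (S.h (n + 1)) * D (-1) * (fnHom S.d ↑(S.h n)⁻¹ * fnHom S.d (S.h n)) * D 1 *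
          fnHom S.d ↑(S.h n)⁻¹ * sym S.d (S.p n) := by noncomm_ring
      _ = _ := by
        rw [fn_inv_mul_fn, mul_one, mul_assoc (fnHom S.d _), D_mul_D, neg_add_cancel, D_zero,
          mul_one]
  rw [h1, ← map_add, flow_apply, polyDer_p_succ, pow_one, neg_add_eq_sub, sub_add_cancel]
  have := sym_X_pow_mul (d := S.d) 1 (S.p (n + 1))
  rw [pow_one] at this
  rw [this]
  rfl

theorem coeff_dress (n : ℕ) (i : ℤ) :
    (S.dress n).coeff i = if 0 ≤ (n : ℤ) + i then (S.p n).coeff ((n : ℤ) + i).toNat else 0 := by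
  rw [dress_eq, coeff_mul_D, coeff_sym, sub_neg_eq_add, add_comm i]

theorem sym_p_mem_leftIdeal {n m : ℕ} (h : n ≤ m) :
    ∃ B : K[X], sym S.d (S.p m) = sym S.d B * sym S.d (S.p n) := by
  induction m, h using Nat.le_induction with
  | base => exact ⟨1, by rw [sym_one, one_mul]⟩
  | succ m _ ih =>
    obtain ⟨B, hB⟩ := ih
    exact ⟨flow S.d 1 B - C (S.b m) * B, by rw [sym_p_succ, hB, ← mul_assoc, T_mul_sym]⟩

/-- Polynomials orthogonal to all polynomials of degree `< n` are left multiples of `p n`. -/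
theorem sym_mem_leftIdeal {Q : K[X]} {n : ℕ} (ho : ∀ j, j < n → S.L (X ^ j * Q) = 0) :
    ∃ B : K[X], sym S.d Q = sym S.d B * sym S.d (S.p n) := by
  -- Induction on the excess `m` of the degree over `n`: subtracting a multiple of `p_{n+m}`, itself
  -- a left multiple of `p_n`, lowers the degree and keeps orthogonality. Once the degree is below
  -- `n`, nondegeneracy gives zero.
  have main : ∀ m, ∀ Q : K[X], (∀ i, n + m ≤ i → Q.coeff i = 0) →
      (∀ j, j < n → S.L (X ^ j * Q) = 0) →
      ∃ B : K[X], sym S.d Q = sym S.d B * sym S.d (S.p n) := by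
    intro m
    induction m with
    | zero => exact fun Q hQ ho => ⟨0, by rw [S.eq_zero_of_orth hQ ho, map_zero, zero_mul]⟩
    | succ m ih =>
      intro Q hQ ho
      have h1 : ∀ i, n + m ≤ i → (Q - C (Q.coeff (n + m)) * S.p (n + m)).coeff i = 0 := by
        intro i hi
        rw [Polynomial.coeff_sub, coeff_C_mul]
        rcases hi.eq_or_lt with rfl | hi
        · rw [S.coeff_self, mul_one, sub_self]
        · rw [S.coeff_gt _ _ hi, hQ i hi, mul_zero, sub_zero]
      have h2 : ∀ j, j < n → S.L (X ^ j * (Q - C (Q.coeff (n + m)) * S.p (n + m))) = 0 := by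
        intro j hj
        rw [mul_sub, map_sub, ho j hj, mul_left_comm, ← smul_eq_C_mul, map_smul,
          S.orth _ j (by omega), smul_zero, sub_zero]
      obtain ⟨B, hB⟩ := ih _ h1 h2
      obtain ⟨B', hB'⟩ := S.sym_p_mem_leftIdeal (Nat.le_add_right n m)
      refine ⟨B + C (Q.coeff (n + m)) * B', ?_⟩
      rw [map_sub, sym_C_mul, hB', sub_eq_iff_eq_add] at hB
      rw [hB, map_add, add_mul, sym_C_mul, mul_assoc]
  exact main (Q.natDegree + 1) Q (fun i hi => coeff_eq_zero_of_natDegree_lt (by omega)) ho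

/-- `(L^r)_+ p_n = ∂_r p_n + λ^r p_n`. -/
theorem plus_mul_sym (n : ℕ) (r : ℕ+) : (S.lax n ^ (r : ℕ)).plus * sym S.d (S.p n) =
    sym S.d (flow (S.δ r) r (S.p n)) := by
  -- Pairings with `X^j`, `j < n`, are derivatives of zero, so `∂_r p_n + λ^r p_n` is a left
  -- multiple `B` of `p_n`.
  obtain ⟨B, hB⟩ := S.sym_mem_leftIdeal (Q := flow (S.δ r) r (S.p n)) (n := n) fun j hj => by
    rw [L_X_pow_mul_flow, S.orth n j hj, map_zero]
  -- Because `L^r p_n = p_n D^r`, the product `(B - L^r) p_n` has symbol `∂_r p_n`, of degree `< n`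
  -- as `p_n` is monic. So `B - L^r` has only negative orders, while `B` is a differential operator:
  -- `B = (L^r)_+`.
  have h1 : (sym S.d B - S.lax n ^ (r : ℕ)) * sym S.d (S.p n) =
      sym S.d (polyDer (S.δ r) (S.p n)) := by
    rw [sub_mul, ← hB, lax_pow_mul_sym, flow_apply, map_add, sym_X_pow_mul, add_sub_cancel_right]
  rw [hB]
  congr 1
  ext i
  rw [coeff_plus]
  split_ifs with hi
  · have h2 : (sym S.d B - S.lax n ^ (r : ℕ)).coeff i = 0 := by
      refine coeff_eq_zero_of_mul (S.coeff_sym_p_self n) (S.coeff_sym_p_gt n) i fun j hj => ?_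
      rw [h1, coeff_sym, if_pos (by omega), coeff_polyDer]
      rcases (show n ≤ j.toNat by omega).eq_or_lt with h | h
      · rw [← h, S.coeff_self, Derivation.map_one_eq_zero]
      · rw [S.coeff_gt _ _ h, map_zero]
    rw [PDO.coeff_sub] at h2
    exact (sub_eq_zero.mp h2).symm
  · rw [coeff_sym, if_neg hi]

theorem actPoly_lax_pow (n : ℕ) (r : ℕ+) :
    actPoly (S.lax n ^ (r : ℕ)) (S.p n) = flow (S.δ r) r (S.p n) := by
  apply sym_injective (d := S.d)
  rw [sym_actPoly, plus_mul_sym]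

theorem der_sym_p (n : ℕ) (r : ℕ+) : der (S.δ r) (sym S.d (S.p n)) =
    (S.lax n ^ (r : ℕ)).plus * sym S.d (S.p n) - sym S.d (S.p n) * D (r : ℕ) := by
  rw [plus_mul_sym, sym_flow, add_sub_cancel_right]

/-- `∂_r p_n(D) = (L^r)_+ p_n(D) - p_n(D) D^r` and `p_n(D) D^r = L^r p_n(D)`, which leaves `-(L^r)_-
p_n(D)`; the factor `D^{-n}` is constant. -/
theorem der_dress (n : ℕ) (r : ℕ+) :
    der (S.δ r) (S.dress n) = -((S.lax n ^ (r : ℕ)).minus * S.dress n) := by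
  have h := plus_add_minus (S.lax n ^ (r : ℕ))
  rw [dress_eq, der_mul (S.comm r), der_D, mul_zero, add_zero, der_sym_p, ← lax_pow_mul_sym,
    ← sub_mul, ← mul_assoc, ← neg_mul, ← neg_mul]
  congr 2
  exact sub_eq_of_eq_add (by rw [neg_add_eq_sub]; exact eq_sub_of_add_eq h)

/-- Differentiate the intertwining relation `L p_n(D) = p_n(D) D`, insert the evolution of `p_n(D)`,
and cancel `p_n(D)` on the right. -/
theorem der_lax (n : ℕ) (r : ℕ+) : der (S.δ r) (S.lax n) =
    (S.lax n ^ (r : ℕ)).plus * S.lax n + -(S.lax n * (S.lax n ^ (r : ℕ)).plus) := by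
  have h := congrArg (der (S.δ r)) (S.lax_mul_sym n)
  rw [der_mul (S.comm r), der_mul (S.comm r), der_D, mul_zero, add_zero, der_sym_p] at h
  refine S.cancel n ?_
  have h2 := eq_sub_of_add_eq h
  rw [h2, add_mul, neg_mul, mul_assoc _ (S.lax n), lax_mul_sym]
  have h3 : S.lax n * (sym S.d (S.p n) * D (r : ℕ)) = sym S.d (S.p n) * D (r : ℕ) * D 1 := by
    rw [← mul_assoc, lax_mul_sym, mul_assoc, D_mul_D, mul_assoc, D_mul_D, add_comm]
  rw [mul_sub, sub_mul, h3]
  noncomm_ring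

/-- The norm `h_n = L(X^n p_n)` is the integral of `λ^n p_n e^ξ`, and the functional carries `∂^i`
and `∂_r` inside. So `h_n` inherits the linear evolution equation of `p_n e^ξ`. -/
theorem act_lax_pow (n : ℕ) (r : ℕ+) : (S.lax n ^ (r : ℕ)).act (S.h n : K) = S.δ r (S.h n) := by
  obtain ⟨N, hN⟩ := (S.lax n ^ (r : ℕ)).nat_bdd
  rw [← S.norm n, ← L_X_pow_mul_flow, ← actPoly_lax_pow, actPoly_eq_sum _ _ hN, act_eq_sum _ _ hN,
    Finset.mul_sum, map_sum]
  refine Finset.sum_congr rfl fun i hi => ?_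
  clear hi
  rw [mul_left_comm, ← smul_eq_C_mul, map_smul, smul_eq_mul]
  congr 1
  induction i with
  | zero => rfl
  | succ i ih =>
    rw [Function.iterate_succ_apply', Function.iterate_succ_apply', ih]
    exact (S.L_X_pow_mul_flow 1 n _).symm

/-- Take residues in `T⁻¹ (L^{(n+1)})^r = (L^{(n)})^r T⁻¹` with `T⁻¹ = h_n D⁻¹ h_n⁻¹`. The left side
gives `h_n` times the adjoint action on `h_n⁻¹`; the right side gives `(L^{(n)})^r_+(h_n) h_n⁻¹ =
∂_r h_n / h_n`. -/
theorem adjAct_lax_pow (n : ℕ) (r : ℕ+) :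
    (S.lax (n + 1) ^ (r : ℕ)).adjAct (↑(S.h n)⁻¹ : K) = -S.δ r (↑(S.h n)⁻¹ : K) := by
  have h1 : ∀ k : ℕ, S.Tinv n * S.lax (n + 1) ^ k = S.lax n ^ k * S.Tinv n := by
    intro k
    induction k with
    | zero => rw [pow_zero, pow_zero, mul_one, one_mul]
    | succ k ih =>
      rw [pow_succ, ← mul_assoc, ih, pow_succ, lax]
      calc S.lax n ^ k * S.Tinv n * (S.T n * S.lax n * S.Tinv n) =
          S.lax n ^ k * (S.Tinv n * S.T n) * S.lax n * S.Tinv n := by noncomm_ring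
        _ = _ := by rw [Tinv_mul_T, mul_one]
  have h2 := congrArg (fun P : PDO S.d => P.coeff (-1)) (h1 r)
  simp only [Tinv, mul_assoc] at h2
  rw [coeff_fnHom_mul, coeff_D_inv_mul, ← mul_assoc (fnHom S.d _), ← mul_assoc, ← mul_assoc,
    coeff_mul_D_inv_mul_fnHom, coeff_zero_mul_fnHom, act_lax_pow] at h2
  rw [der_unit_inv, neg_neg, logDer, ← h2]
  rw [mul_comm (S.h n : K), mul_assoc, Units.mul_inv, mul_one]

/-- `Res L^r = ∂ ∂_r ln (h_0 ⋯ h_{n-1})`. -/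
theorem coeff_lax_pow (n : ℕ) (r : ℕ+) : (S.lax n ^ (r : ℕ)).coeff (-1) =
    S.d (logDer (S.δ r) (∏ k ∈ Finset.range n, S.h k)) := by
  have h := congrArg (fun P : PDO S.d => P.coeff (-1)) (S.der_dress n r)
  simp only [coeff_der, PDO.coeff_neg] at h
  -- Residues are compared in the Sato equation. The `D⁻¹`-coefficient of the dressing operator is
  -- the subleading coefficient of `p_n`, which is `-∂ ln (h_0 ⋯ h_{n-1})` by `a_eq`.
  have ha : (S.dress n).coeff (-1) = S.a n := by
    rw [coeff_dress]
    cases n with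
    | zero => rfl
    | succ n =>
      rw [if_pos (by omega), a]
      congr 1
      omega
  have hm : ∀ i, -1 < i → (S.lax n ^ (r : ℕ)).minus.coeff i = 0 := fun i hi => by
    rw [coeff_minus, if_neg (by omega)]
  have hd : ∀ i, 0 < i → (S.dress n).coeff i = 0 := fun i hi => by
    rw [coeff_dress, if_pos (by omega), S.coeff_gt _ _ (by omega)]
  have hd0 : (S.dress n).coeff 0 = 1 := by
    rw [coeff_dress, if_pos (by omega), add_zero, Int.toNat_natCast, S.coeff_self]
  have hprod : ((S.lax n ^ (r : ℕ)).minus * S.dress n).coeff (-1) =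
      (S.lax n ^ (r : ℕ)).coeff (-1) := by
    rw [coeff_mul_eq_sum hm hd]
    rw [show PsiDO.mulSupport (-1) 0 (-1) = {(-1, 0)} from rfl, Finset.sum_singleton]
    simp [hd0, coeff_minus]
  rw [hprod, ha, a_eq] at h
  rw [← neg_inj, ← h, map_neg, logDer_prod, map_sum, map_sum]
  congr 1
  exact Finset.sum_congr rfl fun k _ => der_logDer_comm (S.comm r) _

end OrthData

end

end OneMatrix

/-! ### Analysis: the domain of times, integrability, and derivatives of the moments -/

namespace OneMatrix

noncomputable section

open Polynomial

theorem tdir_apply (r k : ℕ+) : tdir r k = if k = r then 1 else 0 := by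
  rw [tdir, Pi.single_apply]

theorem hasSum_shift (r : ℕ+) (s x : ℝ) :
    HasSum (fun k : ℕ+ => (s • tdir r) k * x ^ (k : ℕ)) (s * x ^ (r : ℕ)) := by
  convert hasSum_ite_eq r (s * x ^ (r : ℕ)) using 2 with k
  rw [Pi.smul_apply, tdir_apply, smul_eq_mul]
  split_ifs with h
  · rw [h, mul_one]
  · simp

theorem summable_shift {t : Times} {x : ℝ} (h : Summable fun k : ℕ+ => t k * x ^ (k : ℕ))
    (r : ℕ+) (s : ℝ) : Summable fun k : ℕ+ => (t + s • tdir r) k * x ^ (k : ℕ) := by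
  simp_rw [Pi.add_apply, add_mul]
  exact h.add (hasSum_shift r s x).summable

theorem pot_shift {t : Times} {x : ℝ} (h : Summable fun k : ℕ+ => t k * x ^ (k : ℕ)) (r : ℕ+)
    (s : ℝ) : pot (t + s • tdir r) x = pot t x + s * x ^ (r : ℕ) := by
  simp_rw [pot, Pi.add_apply, add_mul]
  rw [h.tsum_add (hasSum_shift r s x).summable, (hasSum_shift r s x).tsum_eq]

/-- Summability in `ℝ` is absolute, so the terms at `R` dominate the series on the ball of radius
`R`, and the convergence there is uniform. -/
theorem continuous_pot {t : Times} (h : ∀ x : ℝ, Summable fun k : ℕ+ => t k * x ^ (k : ℕ)) :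
    Continuous (pot t) := by
  rw [← continuousOn_univ]
  have hR : ∀ R : ℝ, 0 ≤ R → ContinuousOn (pot t) (Metric.ball 0 R) := by
    intro R hR
    refine continuousOn_tsum (u := fun k : ℕ+ => |t k * R ^ (k : ℕ)|) (fun k => by fun_prop)
      (h R).abs fun k x hx => ?_
    rw [Real.norm_eq_abs, abs_mul, abs_mul, abs_pow, abs_pow, abs_of_nonneg hR]
    have : |x| ≤ R := by simpa using (mem_ball_zero_iff.mp hx).le
    gcongr
  intro x _
  have hx : Metric.ball (0 : ℝ) (|x| + 1) ∈ 𝓝 x :=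
    Metric.isOpen_ball.mem_nhds (by simp)
  exact ((hR _ (by positivity)).continuousAt hx).continuousWithinAt

theorem pot_combo {t u : Times} {x : ℝ} (ht : Summable fun k : ℕ+ => t k * x ^ (k : ℕ))
    (hu : Summable fun k : ℕ+ => u k * x ^ (k : ℕ)) (a b : ℝ) :
    (Summable fun k : ℕ+ => (a • t + b • u) k * x ^ (k : ℕ)) ∧
      pot (a • t + b • u) x = a * pot t x + b * pot u x := by
  have h : (fun k : ℕ+ => (a • t + b • u) k * x ^ (k : ℕ)) =
      fun k : ℕ+ => a * (t k * x ^ (k : ℕ)) + b * (u k * x ^ (k : ℕ)) := by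
    funext k
    simp only [Pi.add_apply, Pi.smul_apply, smul_eq_mul]
    ring
  rw [pot, h]
  exact ⟨(ht.mul_left a).add (hu.mul_left b), by
    rw [(ht.mul_left a).tsum_add (hu.mul_left b), tsum_mul_left, tsum_mul_left]; rfl⟩

theorem integrable_of_mem {t : Times} (ht : t ∈ timeDomain) :
    Integrable fun x : ℝ => Real.exp (pot t x) := by
  simpa using ht.2.self_of_nhds

/-- `V` is linear in `t` and `exp` is convex, so the weight at a convex combination is dominated by
the combination of the weights. -/
theorem convex_timeDomain : Convex ℝ timeDomain := by
  intro t ht u hu a b ha hb hab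
  refine ⟨fun x => (pot_combo (ht.1 x) (hu.1 x) a b).1, ?_⟩
  filter_upwards [ht.2, hu.2] with s h1 h2
  have e : a • t + b • u + s • tdir 1 = a • (t + s • tdir 1) + b • (u + s • tdir 1) := by
    have : s • tdir 1 = (a + b) • s • tdir 1 := by rw [hab, one_smul]
    conv_lhs => rw [this]
    module
  have hsum : ∀ x : ℝ, Summable fun k : ℕ+ => (a • (t + s • tdir 1) + b • (u + s • tdir 1)) k *
      x ^ (k : ℕ) :=
    fun x => (pot_combo (summable_shift (ht.1 x) 1 s) (summable_shift (hu.1 x) 1 s) a b).1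
  rw [e]
  refine ((h1.const_mul a).add (h2.const_mul b)).mono'
    (Real.continuous_exp.comp (continuous_pot hsum)).aestronglyMeasurable (.of_forall fun x => ?_)
  rw [Real.norm_eq_abs, Real.abs_exp,
    (pot_combo (summable_shift (ht.1 x) 1 s) (summable_shift (hu.1 x) 1 s) a b).2]
  exact convexOn_exp.2 (Set.mem_univ _) (Set.mem_univ _) ha hb hab

/-- The condition on `t_1` holds for all small `s`, hence also near each small `s`: the flow of
`t_1` is available at every time of the domain. -/
theorem isFlow_one {t : Times} (ht : t ∈ timeDomain) : IsFlow 1 t := by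
  filter_upwards [eventually_eventually_nhds.mpr ht.2] with s hs
  refine ⟨fun x => summable_shift (ht.1 x) 1 s, ?_⟩
  have hc : Tendsto (fun v : ℝ => s + v) (𝓝 0) (𝓝 s) := by
    have h : Continuous fun v : ℝ => s + v := by fun_prop
    simpa using h.tendsto 0
  filter_upwards [hc.eventually hs] with v hv
  rwa [add_assoc, ← add_smul]

/-- `t + s e_r + v e_q` is the midpoint of `t + 2s e_r` and `t + 2v e_q`, so convexity applies.
Mixed derivatives depend on this. -/
theorem IsFlow.shift {t : Times} {q r : ℕ+} (hq : IsFlow q t) (hr : IsFlow r t) :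
    ∀ᶠ s : ℝ in 𝓝 0, IsFlow q (t + s • tdir r) := by
  have hc : Tendsto (fun v : ℝ => 2 * v) (𝓝 0) (𝓝 0) := by
    have h : Continuous fun v : ℝ => 2 * v := by fun_prop
    simpa using h.tendsto 0
  filter_upwards [hc.eventually hr] with s hs
  filter_upwards [hc.eventually hq] with v hv
  have := convex_timeDomain hs hv (by norm_num : (0 : ℝ) ≤ 1 / 2) (by norm_num : (0 : ℝ) ≤ 1 / 2)
    (by norm_num)
  convert this using 1
  module

theorem abs_pow_le_exp (n : ℕ) {ε : ℝ} (hε : 0 < ε) (x : ℝ) :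
    |x| ^ n ≤ n.factorial / ε ^ n * (Real.exp (ε * x) + Real.exp (-ε * x)) := by
  have h := Real.pow_div_factorial_le_exp (ε * |x|) (by positivity) n
  have h2 : Real.exp (ε * |x|) ≤ Real.exp (ε * x) + Real.exp (-ε * x) := by
    rcases abs_cases x with ⟨h, _⟩ | ⟨h, _⟩ <;> rw [h]
    · linarith [Real.exp_pos (-ε * x)]
    · rw [mul_neg, ← neg_mul]; linarith [Real.exp_pos (ε * x)]
  have h3 : (ε * |x|) ^ n ≤ n.factorial * (Real.exp (ε * x) + Real.exp (-ε * x)) := by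
    rw [div_le_iff₀ (by positivity)] at h
    nlinarith [(by positivity : (0 : ℝ) < n.factorial)]
  rw [mul_pow] at h3
  rw [div_mul_eq_mul_div, le_div_iff₀ (by positivity), mul_comm]
  exact h3

theorem exists_pm {p : ℝ → Prop} (h : ∀ᶠ s in 𝓝 0, p s) : ∃ ε > 0, p ε ∧ p (-ε) := by
  obtain ⟨ε, hε, h⟩ := Metric.eventually_nhds_iff.mp h
  exact ⟨ε / 2, by positivity,
    h (by rw [Real.dist_eq, sub_zero, abs_of_pos (by positivity)]; linarith),
    h (by rw [Real.dist_eq, sub_zero, abs_neg, abs_of_pos (by positivity)]; linarith)⟩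

/-- A power of `|x|` is bounded by a multiple of `e^{εx} + e^{-εx}`, which shifts `t_1` by `±ε`.
This is why the domain asks for integrability at nearby values of `t_1`. -/
theorem integrable_abs_pow_mul_exp {t : Times} (ht : t ∈ timeDomain) (n : ℕ) :
    Integrable fun x : ℝ => |x| ^ n * Real.exp (pot t x) := by
  obtain ⟨ε, hε, h1, h2⟩ := exists_pm ht.2
  refine ((h1.add h2).const_mul (n.factorial / ε ^ n)).mono'
    ((continuous_abs.pow n).mul (Real.continuous_exp.comp
      (continuous_pot ht.1))).aestronglyMeasurable (.of_forall fun x => ?_)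
  rw [Real.norm_of_nonneg (by positivity), Pi.add_apply, pot_shift (ht.1 x), pot_shift (ht.1 x),
    Real.exp_add, Real.exp_add, ← mul_add, PNat.one_coe, pow_one]
  calc |x| ^ n * Real.exp (pot t x) ≤ (n.factorial / ε ^ n *
        (Real.exp (ε * x) + Real.exp (-ε * x))) * Real.exp (pot t x) := by
        gcongr; exact abs_pow_le_exp n hε x
    _ = _ := by ring

theorem integrable_pow_mul_exp {t : Times} (ht : t ∈ timeDomain) (n : ℕ) :
    Integrable fun x : ℝ => x ^ n * Real.exp (pot t x) := by
  refine (integrable_abs_pow_mul_exp ht n).mono'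
    ((continuous_pow n).mul (Real.continuous_exp.comp
      (continuous_pot ht.1))).aestronglyMeasurable (.of_forall fun x => ?_)
  rw [norm_mul, norm_pow, Real.norm_eq_abs, Real.norm_eq_abs, Real.abs_exp]

theorem integrable_eval_mul_exp {t : Times} (ht : t ∈ timeDomain) (Q : ℝ[X]) :
    Integrable fun x : ℝ => Q.eval x * Real.exp (pot t x) := by
  induction Q using Polynomial.induction_on' with
  | add p q hp hq =>
    simp only [eval_add, add_mul]
    exact hp.add hq
  | monomial n a =>
    simpa only [eval_monomial, mul_assoc] using (integrable_pow_mul_exp ht n).const_mul a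

/-- The linear functional `Q ↦ ∫ Q e^V`. -/
def intExp (t : Times) (Q : ℝ[X]) : ℝ := ∫ x, Q.eval x * Real.exp (pot t x)

/-- The moments of the weight `e^V`. -/
def moment (t : Times) (n : ℕ) : ℝ := ∫ x, x ^ n * Real.exp (pot t x)

theorem intExp_add {t : Times} (ht : t ∈ timeDomain) (P Q : ℝ[X]) :
    intExp t (P + Q) = intExp t P + intExp t Q := by
  simp_rw [intExp, eval_add, add_mul]
  exact integral_add (integrable_eval_mul_exp ht P) (integrable_eval_mul_exp ht Q)

theorem intExp_C_mul (t : Times) (a : ℝ) (Q : ℝ[X]) :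
    intExp t (C a * Q) = a * intExp t Q := by
  simp_rw [intExp, eval_mul, eval_C, mul_assoc]
  exact integral_const_mul a _

theorem intExp_X_pow (t : Times) (n : ℕ) : intExp t (X ^ n) = moment t n := by
  simp_rw [intExp, eval_pow, eval_X]; rfl

theorem intExp_mul_self_pos {t : Times} (ht : t ∈ timeDomain) {Q : ℝ[X]} (hQ : Q ≠ 0) :
    0 < intExp t (Q * Q) := by
  have hc : Continuous fun x => (Q * Q).eval x * Real.exp (pot t x) :=
    (Q * Q).continuous.mul (Real.continuous_exp.comp (continuous_pot ht.1))
  obtain ⟨x, hx⟩ : ∃ x, Q.eval x ≠ 0 := by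
    by_contra! h
    exact hQ (Polynomial.funext fun x => by rw [h, eval_zero])
  have hpos : 0 < (Q * Q).eval x * Real.exp (pot t x) := by
    rw [eval_mul]
    exact mul_pos (mul_self_pos.mpr hx) (Real.exp_pos _)
  refine (integral_pos_iff_support_of_nonneg_ae (.of_forall fun y => ?_)
    (integrable_eval_mul_exp ht _)).mpr
    (((hc.isOpen_support).measure_pos volume ⟨x, hpos.ne'⟩))
  simp only [eval_mul]
  exact mul_nonneg (mul_self_nonneg _) (Real.exp_nonneg _)

theorem hasTimeDeriv_moment {t : Times} (ht : t ∈ timeDomain) {r : ℕ+} (hr : IsFlow r t) (n : ℕ) :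
    HasTimeDeriv r (fun u => moment u n) (moment t (n + r)) t := by
  obtain ⟨ε, hε, h1, h2⟩ := exists_pm hr
  -- For `|s| < ε` the factor `e^{s x^r}` is at most `e^{ε x^r} + e^{-ε x^r}`, so the integrands at
  -- the two times `t ± ε e_r` of the domain dominate the derivative.
  have key := hasDerivAt_integral_of_dominated_loc_of_deriv_le (μ := volume) (𝕜 := ℝ)
    (F := fun s x => x ^ n * Real.exp (pot t x + s * x ^ (r : ℕ)))
    (F' := fun s x => x ^ (n + r) * Real.exp (pot t x + s * x ^ (r : ℕ))) (x₀ := 0)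
    (bound := fun x => |x| ^ (n + r) * Real.exp (pot (t + ε • tdir r) x) +
      |x| ^ (n + r) * Real.exp (pot (t + (-ε) • tdir r) x))
    (s := Metric.ball 0 ε) (Metric.ball_mem_nhds 0 hε) (.of_forall fun s => ?_) ?_ ?_ ?_
    ((integrable_abs_pow_mul_exp h1 _).add (integrable_abs_pow_mul_exp h2 _)) ?_
  · have := key.2
    simp only [zero_mul, add_zero] at this
    refine HasDerivAt.congr_of_eventuallyEq this ?_
    refine .of_forall fun s => ?_
    simp only [moment, pot_shift (ht.1 _)]
  · exact ((continuous_pow n).mul (Real.continuous_exp.comp ((continuous_pot ht.1).add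
      (continuous_const.mul (continuous_pow _))))).aestronglyMeasurable
  · simpa using integrable_pow_mul_exp ht n
  · exact ((continuous_pow _).mul (Real.continuous_exp.comp ((continuous_pot ht.1).add
      (continuous_const.mul (continuous_pow _))))).aestronglyMeasurable
  · refine .of_forall fun x s hs => ?_
    rw [norm_mul, norm_pow, Real.norm_eq_abs, Real.norm_eq_abs, Real.abs_exp, pot_shift (ht.1 x),
      pot_shift (ht.1 x), ← mul_add]
    gcongr
    have hs' : |s| < ε := by simpa using hs
    have h3 : s * x ^ (r : ℕ) ≤ ε * |x ^ (r : ℕ)| := by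
      refine (le_abs_self _).trans ?_
      rw [abs_mul]
      gcongr
    rcases abs_cases (x ^ (r : ℕ)) with ⟨h, _⟩ | ⟨h, _⟩ <;> rw [h] at h3
    · exact le_add_of_le_of_nonneg (Real.exp_le_exp.mpr (by linarith)) (Real.exp_nonneg _)
    · exact le_add_of_nonneg_of_le (Real.exp_nonneg _) (Real.exp_le_exp.mpr (by linarith))
  · refine .of_forall fun x s _ => ?_
    have h := (((hasDerivAt_id s).mul_const (x ^ (r : ℕ))).const_add (pot t x)).exp.const_mul (x ^ n)
    refine h.congr_deriv ?_
    simp only [id]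
    ring

/-- The Gaussian potential `-x²`, for which `s x - x² = s²/4 - (x - s/2)²`. A time of the domain is
needed as a default value. -/
theorem timeDomain_nonempty : timeDomain.Nonempty := by
  have h0 : ∀ x : ℝ, Summable fun k : ℕ+ => (0 : Times) k * x ^ (k : ℕ) := fun x => by simp
  refine ⟨0 + (-1 : ℝ) • tdir 2, fun x => summable_shift (h0 x) 2 _, .of_forall fun s => ?_⟩
  have : ∀ x, pot (0 + (-1 : ℝ) • tdir 2 + s • tdir 1) x = s ^ 2 / 4 + -1 * (x + -(s / 2)) ^ 2 := by
    intro x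
    rw [pot_shift (summable_shift (h0 x) 2 _), pot_shift (h0 x)]
    have : pot 0 x = 0 := by simp [pot]
    rw [this]
    norm_num
    ring
  simp_rw [this, Real.exp_add]
  exact ((integrable_exp_neg_mul_sq one_pos).comp_add_right (-(s / 2))).const_mul _

end

end OneMatrix

namespace OneMatrix

noncomputable section

open Polynomial PDO

/-! ### Derivations of localizations -/

/-- A derivation extends to every localization. -/
theorem exists_derivation_localization {A K : Type*} [CommRing A] [CommRing K] [Algebra A K]
    (M : Submonoid A) [IsLocalization M K] (δ : Derivation ℤ A A) :
    ∃ δ' : Derivation ℤ K K, ∀ a, δ' (algebraMap A K a) = algebraMap A K (δ a) := by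
  -- A derivation is a ring homomorphism `a ↦ a + ε δa` to the dual numbers. It sends denominators
  -- to units, because a dual number is a unit when its first component is, and so it factors
  -- through the localization.
  let f : A →+* TrivSqZeroExt K K :=
    { toFun := fun a => TrivSqZeroExt.inl (algebraMap A K a) +
        TrivSqZeroExt.inr (algebraMap A K (δ a))
      map_one' := by ext <;> simp
      map_zero' := by ext <;> simp
      map_add' := fun a b => by
        ext
        · simp
        · simp only [TrivSqZeroExt.snd_add, TrivSqZeroExt.snd_inl, TrivSqZeroExt.snd_inr, map_add,
            zero_add]
      map_mul' := fun a b => by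
        ext
        · simp
        · simp only [TrivSqZeroExt.snd_add, TrivSqZeroExt.snd_inl, TrivSqZeroExt.snd_inr,
            TrivSqZeroExt.snd_mul, TrivSqZeroExt.fst_add, TrivSqZeroExt.fst_inl,
            TrivSqZeroExt.fst_inr, Derivation.leibniz, smul_eq_mul, map_add, map_mul, zero_add,
            add_zero, MulOpposite.smul_eq_mul_unop, MulOpposite.unop_op]
          ring }
  have hf : ∀ s : M, IsUnit (f s) := fun s => by
    rw [TrivSqZeroExt.isUnit_iff_isUnit_fst]
    simpa [f] using IsLocalization.map_units K s
  let φ : K →+* TrivSqZeroExt K K := IsLocalization.lift hf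
  have hφ : ∀ a, φ (algebraMap A K a) = f a := IsLocalization.lift_eq hf
  have hfst : ∀ k, (φ k).fst = k := by
    intro k
    have : (TrivSqZeroExt.fstHom K K K : TrivSqZeroExt K K →+* K).comp φ = RingHom.id K := by
      apply IsLocalization.ringHom_ext M
      ext a
      simp [hφ, f]
    exact congrArg (fun g : K →+* K => g k) this
  refine ⟨Derivation.mk' ((TrivSqZeroExt.sndHom K K).toAddMonoidHom.comp
    φ.toAddMonoidHom).toIntLinearMap fun a b => ?_, fun a => ?_⟩
  · change (φ (a * b)).snd = a • (φ b).snd + b • (φ a).snd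
    rw [map_mul, TrivSqZeroExt.snd_mul, hfst, hfst, op_smul_eq_smul]
  · change (φ (algebraMap A K a)).snd = _
    rw [hφ]
    exact zero_add _

/-- A derivation of a localization that vanishes on the base vanishes. -/
theorem derivation_localization_eq_zero {A K : Type*} [CommRing A] [CommRing K] [Algebra A K]
    (M : Submonoid A) [IsLocalization M K] {δ : Derivation ℤ K K}
    (h : ∀ a, δ (algebraMap A K a) = 0) (k : K) : δ k = 0 := by
  obtain ⟨⟨a, s⟩, hk⟩ := IsLocalization.surj M k
  have h1 := congrArg δ hk
  rw [δ.leibniz, h, h, smul_zero, zero_add, smul_eq_mul] at h1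
  exact ((IsLocalization.map_units K s).mul_right_eq_zero).mp h1

/-! ### Rational functions of the moments -/

/-- Polynomials in formal moments. -/
abbrev Mom := MvPolynomial ℕ ℝ

/-- A time outside of the domain is replaced by a time of the domain. -/
def toDomain (t : Times) : Times :=
  haveI := Classical.propDecidable
  if t ∈ timeDomain then t else timeDomain_nonempty.some

theorem toDomain_mem (t : Times) : toDomain t ∈ timeDomain := by
  classical
  rw [toDomain]
  split_ifs with h
  · exact h
  · exact timeDomain_nonempty.some_mem

theorem toDomain_eq {t : Times} (ht : t ∈ timeDomain) : toDomain t = t := if_pos ht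

/-- Evaluation at the moments. -/
def evMom (t : Times) : Mom →+* ℝ := (MvPolynomial.aeval (moment (toDomain t))).toRingHom

theorem evMom_X {t : Times} (ht : t ∈ timeDomain) (n : ℕ) :
    evMom t (MvPolynomial.X n) = moment t n := by
  simp [evMom, toDomain_eq ht]

theorem evMom_C (t : Times) (a : ℝ) : evMom t (MvPolynomial.C a) = a := by
  simp [evMom]

/-- The polynomials without zeros on the domain. -/
def denoms : Submonoid Mom where
  carrier := {a | ∀ t, evMom t a ≠ 0}
  one_mem' t := by simp
  mul_mem' ha hb t := by rw [map_mul]; exact mul_ne_zero (ha t) (hb t)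

/-- Rational functions of formal moments that are regular on the domain. -/
def Rat : Type := Localization denoms

instance : CommRing Rat := inferInstanceAs (CommRing (Localization denoms))
instance : Algebra Mom Rat := inferInstanceAs (Algebra Mom (Localization denoms))
instance : IsLocalization denoms Rat :=
  inferInstanceAs (IsLocalization denoms (Localization denoms))

/-- The inclusion of polynomials. -/
abbrev toRat : Mom →+* Rat := algebraMap Mom Rat

theorem isUnit_evMom (t : Times) (s : denoms) : IsUnit (evMom t s) := (s.2 t).isUnit

/-- Evaluation at a time. -/
def ev (t : Times) : Rat →+* ℝ := IsLocalization.lift (isUnit_evMom t)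

theorem ev_toRat (t : Times) (a : Mom) : ev t (toRat a) = evMom t a := IsLocalization.lift_eq _ a

theorem exists_mem_ev_eq (t : Times) :
    ∃ u ∈ timeDomain, ∀ a, ev t a = ev u a := by
  refine ⟨toDomain t, toDomain_mem t, fun a => ?_⟩
  have h : evMom t = evMom (toDomain t) := by
    rw [evMom, evMom, toDomain_eq (toDomain_mem t)]
  have : ev t = ev (toDomain t) := by
    apply IsLocalization.ringHom_ext denoms
    ext a <;> simp [ev_toRat, h]
  rw [this]

/-- A numerator of `a` vanishes nowhere on the domain, hence is itself one of the inverted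
polynomials. Pointwise positivity of the norms thereby becomes invertibility in `Rat`. -/
theorem isUnit_of_ev {a : Rat} (h : ∀ t ∈ timeDomain, ev t a ≠ 0) : IsUnit a := by
  obtain ⟨⟨b, s⟩, hb⟩ := IsLocalization.surj denoms a
  have hb' : b ∈ denoms := by
    intro t
    have h1 := congrArg (ev t) hb
    rw [map_mul, ev_toRat, ev_toRat] at h1
    rw [← h1]
    refine mul_ne_zero ?_ (s.2 t)
    obtain ⟨u, hu, he⟩ := exists_mem_ev_eq t
    rw [he]
    exact h u hu
  have h2 := IsLocalization.map_units Rat (⟨b, hb'⟩ : denoms)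
  rw [← hb] at h2
  exact isUnit_of_mul_isUnit_left h2

/-- The flows on polynomials: `∂_r m_k = m_{k+r}`. -/
def momFlow (r : ℕ+) : Derivation ℤ Mom Mom :=
  (MvPolynomial.mkDerivation ℝ fun k : ℕ => (MvPolynomial.X (k + r) : Mom)).restrictScalars ℤ

theorem momFlow_X (r : ℕ+) (k : ℕ) :
    momFlow r (MvPolynomial.X k) = MvPolynomial.X (k + r) :=
  MvPolynomial.mkDerivation_X _ _ _

theorem momFlow_C (r : ℕ+) (a : ℝ) : momFlow r (MvPolynomial.C a) = 0 :=
  MvPolynomial.derivation_C _ _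

theorem momFlow_comm (q r : ℕ+) (a : Mom) : momFlow q (momFlow r a) = momFlow r (momFlow q a) := by
  induction a using MvPolynomial.induction_on with
  | C a => rw [momFlow_C, momFlow_C, map_zero, map_zero]
  | add a b ha hb => simp only [map_add, ha, hb]
  | mul_X a k ha =>
    simp only [Derivation.leibniz, map_add, momFlow_X, ha, smul_eq_mul]
    rw [add_right_comm k]
    ring

/-- The flows on rational functions. -/
def ratFlow (r : ℕ+) : Derivation ℤ Rat Rat :=
  (exists_derivation_localization denoms (momFlow r)).choose

theorem ratFlow_toRat (r : ℕ+) (a : Mom) : ratFlow r (toRat a) = toRat (momFlow r a) :=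
  (exists_derivation_localization denoms (momFlow r)).choose_spec a

theorem ratFlow_comm (q r : ℕ+) (a : Rat) : ratFlow q (ratFlow r a) = ratFlow r (ratFlow q a) := by
  rw [← sub_eq_zero, ← Derivation.commutator_apply]
  refine derivation_localization_eq_zero denoms (fun a => ?_) a
  rw [Derivation.commutator_apply]
  simp only [ratFlow_toRat]
  rw [momFlow_comm, sub_self]

/-- The function `f` is given on the domain by the rational function `a` of the moments. -/
def Rep (f : Times → ℝ) (a : Rat) : Prop := ∀ t ∈ timeDomain, f t = ev t a

theorem hasTimeDeriv_congr {r : ℕ+} {t : Times} (hr : IsFlow r t) {f g : Times → ℝ}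
    (h : ∀ t ∈ timeDomain, f t = g t) {v : ℝ} (hg : HasTimeDeriv r g v t) :
    HasTimeDeriv r f v t :=
  HasDerivAt.congr_of_eventuallyEq hg (by filter_upwards [hr] with s hs using h _ hs)

theorem hasTimeDeriv_evMom {t : Times} (ht : t ∈ timeDomain) {r : ℕ+} (hr : IsFlow r t) (a : Mom) :
    HasTimeDeriv r (fun u => evMom u a) (evMom t (momFlow r a)) t := by
  induction a using MvPolynomial.induction_on with
  | C a =>
    rw [momFlow_C, map_zero]
    simp only [HasTimeDeriv, evMom_C]
    exact hasDerivAt_const _ _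
  | add a b ha hb =>
    simp only [map_add]
    exact HasDerivAt.add ha hb
  | mul_X a k ha =>
    have h1 : HasTimeDeriv r (fun u => evMom u (MvPolynomial.X k)) (moment t (k + r)) t :=
      hasTimeDeriv_congr hr (fun u hu => evMom_X hu k) (hasTimeDeriv_moment ht hr k)
    simp only [map_mul, Derivation.leibniz, momFlow_X, smul_eq_mul, map_add, evMom_X ht]
    have h2 := HasDerivAt.mul ha h1
    simp only [zero_smul, add_zero, evMom_X ht] at h2
    refine h2.congr_deriv ?_
    ring

/-- Write `a s = b` with `b`, `s` polynomials in the moments, for which the claim is the formula for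
`∂_r m_k` and the product rule. The quotient rule in analysis and the Leibniz rule in `Rat` solve
the same equation for the derivative. -/
theorem hasTimeDeriv_ev {t : Times} (ht : t ∈ timeDomain) {r : ℕ+} (hr : IsFlow r t) (a : Rat) :
    HasTimeDeriv r (fun u => ev u a) (ev t (ratFlow r a)) t := by
  obtain ⟨⟨b, s⟩, hb⟩ := IsLocalization.surj denoms a
  have hb' : a * toRat s = toRat b := hb
  have h : ∀ u, ev u a = evMom u b / evMom u s := fun u => by
    rw [eq_div_iff (s.2 u), ← ev_toRat, ← ev_toRat, ← map_mul, hb']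
  have h1 := congrArg (fun x => ev t (ratFlow r x)) hb'
  simp only [Derivation.leibniz, ratFlow_toRat, smul_eq_mul, map_add, map_mul, ev_toRat] at h1
  have h2 := HasDerivAt.div (hasTimeDeriv_evMom ht hr b) (hasTimeDeriv_evMom ht hr s)
    (by simpa using s.2 t)
  simp only [zero_smul, add_zero] at h2
  simp only [HasTimeDeriv, h]
  refine h2.congr_deriv ?_
  have hs := s.2 t
  rw [div_eq_iff (pow_ne_zero 2 hs), ← h1, h t]
  field_simp
  ring

theorem Rep.hasTimeDeriv {f : Times → ℝ} {a : Rat} (h : Rep f a) {t : Times}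
    (ht : t ∈ timeDomain) {r : ℕ+} (hr : IsFlow r t) :
    HasTimeDeriv r f (ev t (ratFlow r a)) t :=
  hasTimeDeriv_congr hr h (hasTimeDeriv_ev ht hr a)

theorem Rep.timeDeriv {f : Times → ℝ} {a : Rat} (h : Rep f a) {t : Times}
    (ht : t ∈ timeDomain) {r : ℕ+} (hr : IsFlow r t) :
    timeDeriv r f t = ev t (ratFlow r a) :=
  (h.hasTimeDeriv ht hr).deriv

theorem Rep.dx {f : Times → ℝ} {a : Rat} (h : Rep f a) : Rep (dx f) (ratFlow 1 a) :=
  fun _ ht => h.timeDeriv ht (isFlow_one ht)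

theorem Rep.dx_iterate {f : Times → ℝ} {a : Rat} (h : Rep f a) (k : ℕ) :
    Rep (OneMatrix.dx^[k] f) ((PsiDO.zeroHom (ratFlow 1))^[k] a) := by
  induction k with
  | zero => exact h
  | succ k ih =>
    rw [Function.iterate_succ_apply', Function.iterate_succ_apply']
    exact ih.dx

theorem Rep.hasDerivAt_line {f : Times → ℝ} {a : Rat} (h : Rep f a) {t : Times} {s : ℝ}
    (hs : t + s • tdir 1 ∈ timeDomain) :
    HasDerivAt (fun s : ℝ => f (t + s • tdir 1)) (ev (t + s • tdir 1) (ratFlow 1 a)) s := by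
  have h1 : HasDerivAt (fun v : ℝ => f (t + s • tdir 1 + v • tdir 1))
      (ev (t + s • tdir 1) (ratFlow 1 a)) (s - s) := by
    rw [sub_self]
    exact h.hasTimeDeriv hs (isFlow_one hs)
  refine (h1.comp_sub_const s s).congr_of_eventuallyEq (.of_forall fun v => ?_)
  change f _ = f _
  congr 1
  module

/-- Derivatives in `t_1` of represented functions are again represented, so differentiability alone
gives all orders by induction on the open set of admissible `s`. -/
theorem Rep.contDiffAt {f : Times → ℝ} {a : Rat} (h : Rep f a) {t : Times}
    (ht : t ∈ timeDomain) : ContDiffAt ℝ (⊤ : ℕ∞) (fun s : ℝ => f (t + s • tdir 1)) 0 := by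
  have ho : IsOpen {s : ℝ | t + s • tdir 1 ∈ timeDomain} := by
    rw [isOpen_iff_mem_nhds]
    intro s hs
    have hc : Tendsto (fun v : ℝ => v - s) (𝓝 s) (𝓝 0) := by
      have h : Continuous fun v : ℝ => v - s := by fun_prop
      simpa using h.tendsto s
    filter_upwards [hc.eventually (isFlow_one hs)] with v hv
    convert hv using 1
    module
  have main : ∀ n : ℕ, ∀ (f : Times → ℝ) (a : Rat), Rep f a →
      ContDiffOn ℝ n (fun s : ℝ => f (t + s • tdir 1)) {s : ℝ | t + s • tdir 1 ∈ timeDomain} := by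
    intro n
    induction n with
    | zero =>
      intro f a h
      rw [Nat.cast_zero, contDiffOn_zero]
      exact fun s hs => (h.hasDerivAt_line hs).continuousAt.continuousWithinAt
    | succ n ih =>
      intro f a h
      rw [Nat.cast_succ, contDiffOn_succ_iff_deriv_of_isOpen ho]
      refine ⟨fun s hs => (h.hasDerivAt_line hs).differentiableAt.differentiableWithinAt,
        fun h => by simp at h, ?_⟩
      exact (ih (fun u => ev u (ratFlow 1 a)) _ fun _ _ => rfl).congr fun s hs =>
        (h.hasDerivAt_line hs).deriv
  rw [contDiffAt_infty]
  exact fun n => (main n f a h).contDiffAt (ho.mem_nhds (by simpa using ht))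

end

end OneMatrix

/-! ### The formal moment functional and its evaluation as an integral -/

namespace OneMatrix

noncomputable section

open Polynomial PDO

/-- The formal moments as rational functions. -/
def mom (n : ℕ) : Rat := toRat (MvPolynomial.X n)

theorem ev_mom {t : Times} (ht : t ∈ timeDomain) (n : ℕ) : ev t (mom n) = moment t n := by
  rw [mom, ev_toRat, evMom_X ht]

theorem ratFlow_mom (r : ℕ+) (n : ℕ) : ratFlow r (mom n) = mom (n + r) := by
  rw [mom, ratFlow_toRat, momFlow_X]
  rfl

/-- The formal moment functional. -/
def momL : Rat[X] →ₗ[Rat] Rat := (Polynomial.basisMonomials Rat).constr Rat mom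

theorem momL_monomial (n : ℕ) (a : Rat) : momL (monomial n a) = a * mom n := by
  have : monomial n a = a • Polynomial.basisMonomials Rat n := by
    rw [coe_basisMonomials, smul_monomial, smul_eq_mul, mul_one]
  rw [this, map_smul, momL, Module.Basis.constr_basis, smul_eq_mul]

theorem momL_X_pow (n : ℕ) : momL (X ^ n) = mom n := by
  rw [X_pow_eq_monomial, momL_monomial, one_mul]

theorem ratFlow_momL (r : ℕ+) (Q : Rat[X]) :
    ratFlow r (momL Q) = momL (flow (ratFlow r) r Q) := by
  induction Q using Polynomial.induction_on' with
  | add p q hp hq => simp only [map_add, hp, hq]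
  | monomial n a =>
    have h : polyDer (ratFlow r) (monomial n a) = monomial n (ratFlow r a) := by
      ext i
      rw [coeff_polyDer, coeff_monomial, coeff_monomial]
      split_ifs <;> simp
    rw [flow_apply, h, X_pow_mul_monomial, map_add, momL_monomial, momL_monomial, momL_monomial,
      Derivation.leibniz, ratFlow_mom, smul_eq_mul, smul_eq_mul]
    ring

theorem ev_momL {t : Times} (ht : t ∈ timeDomain) (Q : Rat[X]) :
    ev t (momL Q) = intExp t (Q.map (ev t)) := by
  induction Q using Polynomial.induction_on' with
  | add p q hp hq => rw [map_add, map_add, hp, hq, Polynomial.map_add, intExp_add ht]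
  | monomial n a =>
    rw [momL_monomial, map_mul, ev_mom ht, Polynomial.map_monomial, ← C_mul_X_pow_eq_monomial,
      intExp_C_mul, intExp_X_pow]

/-! ### Formal orthogonal polynomials -/

/-- The Hankel matrix of the moments. -/
def hankel (n : ℕ) : Matrix (Fin n) (Fin n) Rat := Matrix.of fun i j => mom (i + j)

/-- A kernel vector at a time `t` would be the coefficient vector of a non-zero `Q` orthogonal to
`1, …, λ^{n-1}`, hence to itself, against the positivity of `∫ Q² e^V`. -/
theorem isUnit_hankel_det (n : ℕ) : IsUnit (hankel n).det := by
  refine isUnit_of_ev fun t ht h0 => ?_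
  rw [RingHom.map_det] at h0
  obtain ⟨v, hv, hv0⟩ := Matrix.exists_mulVec_eq_zero_iff.mpr h0
  set Q : ℝ[X] := ∑ i : Fin n, C (v i) * X ^ (i : ℕ) with hQ
  have hcoeff : ∀ i : Fin n, Q.coeff i = v i := by
    intro i
    simp only [hQ, finsetSum_coeff, coeff_C_mul, coeff_X_pow, mul_ite, mul_one, mul_zero]
    rw [Finset.sum_eq_single i]
    · simp
    · intro j _ hj
      rw [if_neg fun h => hj (Fin.ext h.symm)]
    · simp
  have hQ0 : Q ≠ 0 := fun h => hv (funext fun i => by rw [← hcoeff i, h]; simp)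
  have hsum : ∀ (s : Finset (Fin n)) (f : Fin n → ℝ[X]),
      intExp t (∑ i ∈ s, f i) = ∑ i ∈ s, intExp t (f i) := by
    classical
    intro s f
    induction s using Finset.induction_on with
    | empty => simp [intExp]
    | insert a s ha ih => rw [Finset.sum_insert ha, Finset.sum_insert ha, intExp_add ht, ih]
  have h1 : ∀ i : Fin n, intExp t (X ^ (i : ℕ) * Q) = 0 := by
    intro i
    have := congrFun hv0 i
    simp only [Matrix.mulVec, dotProduct, RingHom.mapMatrix_apply, Matrix.map_apply, hankel,
      Matrix.of_apply, ev_mom ht, Pi.zero_apply] at this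
    rw [hQ, Finset.mul_sum, hsum, ← this]
    refine Finset.sum_congr rfl fun j _ => ?_
    rw [mul_left_comm, ← pow_add, intExp_C_mul, intExp_X_pow, mul_comm]
  have h2 : intExp t (Q * Q) = 0 := by
    conv_lhs => rw [hQ, Finset.sum_mul]
    rw [hsum]
    refine Finset.sum_eq_zero fun i _ => ?_
    rw [mul_assoc, intExp_C_mul, h1, mul_zero]
  exact (intExp_mul_self_pos ht hQ0).ne' h2

/-- The lower coefficients of the orthogonal polynomials. -/
def orthCoeff (n : ℕ) : Fin n → Rat := -((hankel n)⁻¹.mulVec fun i => mom (i + n))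

/-- The formal monic orthogonal polynomials. -/
def orthPoly (n : ℕ) : Rat[X] := X ^ n + ∑ i : Fin n, C (orthCoeff n i) * X ^ (i : ℕ)

theorem coeff_orthPoly_self (n : ℕ) : (orthPoly n).coeff n = 1 := by
  simp only [orthPoly, Polynomial.coeff_add, finsetSum_coeff, coeff_C_mul, coeff_X_pow, if_true]
  rw [Finset.sum_eq_zero, add_zero]
  intro i _
  rw [if_neg (by omega), mul_zero]

theorem coeff_orthPoly_gt (n i : ℕ) (hi : n < i) : (orthPoly n).coeff i = 0 := by
  simp only [orthPoly, Polynomial.coeff_add, finsetSum_coeff, coeff_C_mul, coeff_X_pow]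
  rw [if_neg (by omega), Finset.sum_eq_zero, add_zero]
  intro j _
  rw [if_neg (by omega), mul_zero]

theorem momL_orthPoly (n j : ℕ) (hj : j < n) : momL (X ^ j * orthPoly n) = 0 := by
  have h := congrFun (Matrix.mulVec_mulVec (fun i : Fin n => mom (i + n)) (hankel n) (hankel n)⁻¹)
    ⟨j, hj⟩
  rw [Matrix.mul_nonsing_inv _ (isUnit_hankel_det n), Matrix.one_mulVec] at h
  rw [orthPoly, mul_add, map_add, ← pow_add, momL_X_pow, Finset.mul_sum, map_sum]
  rw [← h, Matrix.mulVec, dotProduct, ← Finset.sum_add_distrib]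
  refine Finset.sum_eq_zero fun i _ => ?_
  rw [mul_left_comm, ← pow_add, ← smul_eq_C_mul, map_smul, momL_X_pow, smul_eq_mul, orthCoeff,
    Pi.neg_apply, hankel, Matrix.of_apply]
  ring

theorem momL_mul_orthPoly (n : ℕ) : momL (orthPoly n * orthPoly n) =
    momL (X ^ n * orthPoly n) := by
  conv_lhs => enter [2, 1]; rw [orthPoly]
  rw [add_mul, map_add, Finset.sum_mul, map_sum, Finset.sum_eq_zero, add_zero]
  intro i _
  rw [mul_assoc, ← smul_eq_C_mul, map_smul, momL_orthPoly n i i.2, smul_zero]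

theorem natDegree_map_orthPoly (t : Times) (n : ℕ) :
    ((orthPoly n).map (ev t)).natDegree = n ∧ ((orthPoly n).map (ev t)).Monic := by
  have h1 : ((orthPoly n).map (ev t)).coeff n = 1 := by
    rw [coeff_map, coeff_orthPoly_self, map_one]
  have h2 : ((orthPoly n).map (ev t)).natDegree = n := by
    refine natDegree_eq_of_le_of_coeff_ne_zero (natDegree_le_iff_coeff_eq_zero.mpr fun i hi => ?_)
      (by rw [h1]; exact one_ne_zero)
    rw [coeff_map, coeff_orthPoly_gt n i hi, map_zero]
  exact ⟨h2, by rw [Monic, leadingCoeff, h2, h1]⟩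

theorem ev_norm_pos {t : Times} (ht : t ∈ timeDomain) (n : ℕ) :
    0 < ev t (momL (X ^ n * orthPoly n)) := by
  rw [← momL_mul_orthPoly, ev_momL ht, Polynomial.map_mul]
  exact intExp_mul_self_pos ht (natDegree_map_orthPoly t n).2.ne_zero

/-- The formal orthogonal polynomials as a solution of the abstract deformation problem. -/
@[reducible]
def momData : OrthData Rat where
  δ := ratFlow
  comm r a := ratFlow_comm r 1 a
  L := momL
  der_L := ratFlow_momL
  p := orthPoly
  h n := (isUnit_of_ev fun _ ht => (ev_norm_pos ht n).ne').unit
  coeff_self := coeff_orthPoly_self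
  coeff_gt := coeff_orthPoly_gt
  orth := momL_orthPoly
  norm n := (isUnit_of_ev fun _ ht => (ev_norm_pos ht n).ne').unit_spec.symm

theorem ev_h_pos {t : Times} (ht : t ∈ timeDomain) (n : ℕ) : 0 < ev t (momData.h n : Rat) := by
  rw [← momData.norm]
  exact ev_norm_pos ht n

theorem momL_orthPoly_mul (n m : ℕ) :
    momL (orthPoly n * orthPoly m) = if n = m then (momData.h m : Rat) else 0 := by
  have key : ∀ n m, n < m → momL (orthPoly n * orthPoly m) = 0 := by
    intro n m h
    refine (momData.L_mul (orthPoly n) (orthPoly m) (n := n + 1) (coeff_orthPoly_gt n)).trans ?_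
    refine Finset.sum_eq_zero fun i hi => ?_
    have := momData.orth m i (by have := Finset.mem_range.mp hi; omega)
    exact (congrArg _ this).trans (mul_zero _)
  split_ifs with h
  · subst h
    rw [momL_mul_orthPoly]
    exact momData.norm n
  · rcases Nat.lt_or_gt_of_ne h with h | h
    · exact key n m h
    · rw [mul_comm, key m n h]

theorem exists_isOrthogonal : IsOrthogonal (fun t n => (orthPoly n).map (ev t))
    (fun n t => ev t (momData.h n)) where
  monic t _ n := (natDegree_map_orthPoly t n).2
  degree t _ n := (natDegree_map_orthPoly t n).1
  integrable t ht n m := by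
    simp only [← eval_mul]
    exact integrable_eval_mul_exp ht _
  orthogonal t ht n m := by
    simp only [← eval_mul, ← Polynomial.map_mul]
    refine (ev_momL ht _).symm.trans ?_
    rw [momL_orthPoly_mul]
    split_ifs <;> simp

theorem intExp_mul_orthPoly {t : Times} (ht : t ∈ timeDomain) {Q : ℝ[X]} {n : ℕ}
    (hQ : ∀ i, n < i → Q.coeff i = 0) :
    intExp t (Q * (orthPoly n).map (ev t)) = Q.coeff n * ev t (momData.h n) := by
  have hX : ∀ j, intExp t (X ^ j * (orthPoly n).map (ev t)) = ev t (momL (X ^ j * orthPoly n)) := by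
    intro j
    rw [ev_momL ht, Polynomial.map_mul, Polynomial.map_pow, map_X]
  have hQ' : Q = ∑ i ∈ Finset.range (n + 1), C (Q.coeff i) * X ^ i := by
    ext k
    simp only [finsetSum_coeff, coeff_C_mul, coeff_X_pow, mul_ite, mul_one, mul_zero,
      Finset.sum_ite_eq, Finset.mem_range]
    split_ifs with h
    · rfl
    · exact hQ k (by omega)
  have hsum : ∀ m ≤ n, intExp t ((∑ i ∈ Finset.range m, C (Q.coeff i) * X ^ i) *
      (orthPoly n).map (ev t)) = 0 := by
    intro m
    induction m with
    | zero => simp [intExp]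
    | succ m ih =>
      intro hm
      rw [Finset.sum_range_succ, add_mul, intExp_add ht, ih (by omega), zero_add, mul_assoc,
        intExp_C_mul, hX, momL_orthPoly n m (by omega), map_zero, mul_zero]
  conv_lhs => rw [hQ', Finset.sum_range_succ, add_mul, intExp_add ht, hsum n le_rfl, zero_add,
    mul_assoc, intExp_C_mul, hX]
  rfl

/-- The orthogonal polynomials and their norms are unique. -/
theorem IsOrthogonal.eq_orthPoly {P : Times → ℕ → ℝ[X]} {h : ℕ → Times → ℝ}
    (hP : IsOrthogonal P h) {t : Times} (ht : t ∈ timeDomain) (n : ℕ) :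
    P t n = (orthPoly n).map (ev t) := by
  induction n using Nat.strong_induction_on with
  | _ n ih =>
  by_contra hne
  set Q := P t n - (orthPoly n).map (ev t) with hQ
  have hQ0 : Q ≠ 0 := sub_ne_zero.mpr hne
  have hdeg : Q.natDegree < n := by
    have hn : n ≠ 0 := by
      rintro rfl
      apply hne
      rw [eq_one_of_monic_natDegree_zero (hP.monic t ht 0) (hP.degree t ht 0),
        eq_one_of_monic_natDegree_zero (natDegree_map_orthPoly t 0).2
        (natDegree_map_orthPoly t 0).1]
    have := Polynomial.degree_sub_lt_left (p := P t n) (q := (orthPoly n).map (ev t)) (by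
      rw [degree_eq_natDegree (hP.monic t ht n).ne_zero, hP.degree t ht n,
        degree_eq_natDegree (natDegree_map_orthPoly t n).2.ne_zero,
        (natDegree_map_orthPoly t n).1]) (hP.monic t ht n).ne_zero (by
      rw [(hP.monic t ht n).leadingCoeff, (natDegree_map_orthPoly t n).2.leadingCoeff])
    have h2 := natDegree_lt_natDegree hQ0 this
    rwa [hP.degree t ht n] at h2
  -- Paired with the orthogonal polynomial of degree `deg Q < n`, which by induction belongs to both
  -- families, the difference `Q` gives its leading coefficient times a positive norm. Orthogonality
  -- makes the same pairing zero.
  have h1 := intExp_mul_orthPoly ht (Q := Q) (n := Q.natDegree)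
    fun i hi => coeff_eq_zero_of_natDegree_lt hi
  have h2 : intExp t (Q * (orthPoly Q.natDegree).map (ev t)) = 0 := by
    have e : Q * (orthPoly Q.natDegree).map (ev t) = P t n * P t Q.natDegree +
        C (-1) * ((orthPoly n * orthPoly Q.natDegree).map (ev t)) := by
      rw [ih _ hdeg, Polynomial.map_mul, hQ]
      simp only [map_neg, map_one]
      ring
    rw [e, intExp_add ht, intExp_C_mul, ← ev_momL ht, momL_orthPoly_mul, if_neg (by omega)]
    have := hP.orthogonal t ht n Q.natDegree
    rw [if_neg (by omega)] at this
    simp only [intExp, eval_mul, this, map_zero, mul_zero, add_zero]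
  rw [h2] at h1
  exact mul_ne_zero (leadingCoeff_ne_zero.mpr hQ0) (ev_h_pos ht _).ne' h1.symm

theorem IsOrthogonal.rep {P : Times → ℕ → ℝ[X]} {h : ℕ → Times → ℝ}
    (hP : IsOrthogonal P h) (n : ℕ) : Rep (h n) (momData.h n) := by
  intro t ht
  have h1 := hP.orthogonal t ht n n
  have h2 := exists_isOrthogonal.orthogonal t ht n n
  rw [if_pos rfl] at h1 h2
  rw [hP.eq_orthPoly ht] at h1
  exact h1.symm.trans h2

end

end OneMatrix

/-! ### Transfer from formal operators to operators over functions of the times -/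

namespace OneMatrix

noncomputable section

open Polynomial PDO

local infixl:70 " ⬝ " => PsiDO.mul dx

/-- The derivation `∂` of rational functions of the moments. -/
abbrev ratD : Derivation ℤ Rat Rat := ratFlow 1

/-- The operator `P` is given on the domain by the formal operator `P'`. -/
def RepOp (P : Op) (P' : PDO ratD) : Prop := ∀ i, Rep (P.coeff i) (P'.coeff i)

theorem rep_zero : Rep 0 0 := fun t _ => (map_zero (ev t)).symm

theorem rep_one : Rep 1 1 := fun t _ => (map_one (ev t)).symm

theorem RepOp.opEq {P Q : Op} {P' : PDO ratD} (hP : RepOp P P') (hQ : RepOp Q P') : OpEq P Q :=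
  fun t ht i => (hP i t ht).trans (hQ i t ht).symm

/-- Since `dx` is no derivation on arbitrary functions, operators over functions need not obey the
ring laws. On represented coefficients `dx` agrees with `ratD`, and the two products are finite sums
over the same indices. -/
theorem RepOp.mul {P Q : Op} {P' Q' : PDO ratD} (hP : RepOp P P') (hQ : RepOp Q Q') :
    RepOp (P ⬝ Q) (P' * Q') := by
  intro n t ht
  obtain ⟨N₁, hN₁⟩ := P.bdd
  obtain ⟨N₂, hN₂⟩ := P'.bdd
  obtain ⟨M₁, hM₁⟩ := Q.bdd
  obtain ⟨M₂, hM₂⟩ := Q'.bdd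
  have h1 : (P ⬝ Q).coeff n = _ := PsiDO.coeff_mul dx (N := max N₁ N₂) (M := max M₁ M₂)
    (fun i hi => hN₁ i (lt_of_le_of_lt (le_max_left _ _) hi))
    (fun i hi => hM₁ i (lt_of_le_of_lt (le_max_left _ _) hi)) n subset_rfl
  rw [h1, coeff_mul_eq_sum (fun i hi => hN₂ i (lt_of_le_of_lt (le_max_right N₁ _) hi))
    (fun i hi => hM₂ i (lt_of_le_of_lt (le_max_right M₁ _) hi)), Finset.sum_apply, map_sum]
  refine Finset.sum_congr rfl fun p _ => ?_
  rw [Pi.smul_apply, Pi.mul_apply, map_zsmul, map_mul, hP _ t ht, (hQ _).dx_iterate _ t ht]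

theorem RepOp.add {P Q : Op} {P' Q' : PDO ratD} (hP : RepOp P P') (hQ : RepOp Q Q') :
    RepOp (P + Q) (P' + Q') := fun i t ht => by
  rw [PsiDO.coeff_add, Pi.add_apply, hP i t ht, hQ i t ht, PDO.coeff_add, map_add]

theorem RepOp.neg {P : Op} {P' : PDO ratD} (hP : RepOp P P') : RepOp (-P) (-P') := fun i t ht => by
  rw [PsiDO.coeff_neg, Pi.neg_apply, hP i t ht, PDO.coeff_neg, map_neg]

theorem repOp_fn {f : Times → ℝ} {a : Rat} (h : Rep f a) : RepOp (fn f) (fnHom ratD a) := by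
  intro i t ht
  rw [fn, PsiDO.coeff_monomial, coeff_fnHom]
  split_ifs
  · exact h t ht
  · exact rep_zero t ht

theorem repOp_Dpow (n : ℤ) : RepOp (Dpow n) (D n) := by
  intro i t ht
  rw [Dpow, PsiDO.coeff_monomial, coeff_D]
  split_ifs
  · exact rep_one t ht
  · exact rep_zero t ht

theorem repOp_one : RepOp 1 1 := repOp_Dpow 0

theorem RepOp.pow {P : Op} {P' : PDO ratD} (hP : RepOp P P') (k : ℕ) :
    RepOp (P.pow dx k) (P' ^ k) := by
  induction k with
  | zero =>
    rw [pow_zero]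
    exact repOp_one
  | succ k ih =>
    rw [pow_succ]
    exact ih.mul hP

theorem RepOp.plus {P : Op} {P' : PDO ratD} (hP : RepOp P P') : RepOp P.plus P'.plus := by
  intro i t ht
  rw [PsiDO.coeff_plus, coeff_plus]
  split_ifs
  · exact hP i t ht
  · exact rep_zero t ht

theorem RepOp.minus {P : Op} {P' : PDO ratD} (hP : RepOp P P') : RepOp P.minus P'.minus := by
  intro i t ht
  rw [PsiDO.coeff_minus, coeff_minus]
  split_ifs
  · exact hP i t ht
  · exact rep_zero t ht

/-- A common upper bound for the orders of two operators. -/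
theorem exists_bdd (P : Op) (P' : PDO ratD) :
    ∃ N : ℕ, (∀ i : ℤ, N < i → P.coeff i = 0) ∧ ∀ i : ℤ, N < i → P'.coeff i = 0 := by
  obtain ⟨N, hN⟩ := P.bdd
  obtain ⟨M, hM⟩ := P'.bdd
  exact ⟨(max N M).toNat, fun i hi => hN i (by omega), fun i hi => hM i (by omega)⟩

theorem op_act_eq_sum (P : Op) (f : Times → ℝ) {N : ℕ} (hN : ∀ i : ℤ, N < i → P.coeff i = 0) :
    P.act dx f = ∑ i ∈ Finset.range (N + 1), P.coeff i * dx^[i] f := by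
  refine finsum_eq_sum_of_support_subset _ fun i hi => ?_
  by_contra h
  apply hi
  simp only [Finset.coe_range, Set.mem_Iio, not_lt] at h
  change P.coeff i * dx^[i] f = 0
  rw [hN i (by omega), zero_mul]

theorem RepOp.act {P : Op} {P' : PDO ratD} (hP : RepOp P P') {f : Times → ℝ} {a : Rat}
    (h : Rep f a) : Rep (P.act dx f) (P'.act a) := by
  intro t ht
  obtain ⟨N, h1, h2⟩ := exists_bdd P P'
  rw [op_act_eq_sum P f h1, act_eq_sum P' a h2, Finset.sum_apply, map_sum]
  refine Finset.sum_congr rfl fun i _ => ?_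
  rw [Pi.mul_apply, map_mul, hP i t ht, h.dx_iterate i t ht]

theorem RepOp.adjAct {P : Op} {P' : PDO ratD} (hP : RepOp P P') {f : Times → ℝ} {a : Rat}
    (h : Rep f a) : Rep (P.adjAct dx f) (P'.adjAct a) := by
  intro t ht
  obtain ⟨N, h1, h2⟩ := exists_bdd P P'
  have e1 : P.adjAct dx f = ∑ i ∈ Finset.range (N + 1), (-1) ^ i * dx^[i] (P.coeff i * f) := by
    refine finsum_eq_sum_of_support_subset _ fun i hi => ?_
    by_contra h
    apply hi
    simp only [Finset.coe_range, Set.mem_Iio, not_lt] at h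
    change (-1) ^ i * dx^[i] (P.coeff i * f) = 0
    rw [h1 i (by omega), zero_mul, PsiDO.iterate_zeroHom_zero, mul_zero]
  have e2 : P'.adjAct a = ∑ i ∈ Finset.range (N + 1),
      (-1) ^ i * (PsiDO.zeroHom ratD)^[i] (P'.coeff i * a) := by
    refine finsum_eq_sum_of_support_subset _ fun i hi => ?_
    by_contra h
    apply hi
    simp only [Finset.coe_range, Set.mem_Iio, not_lt] at h
    change (-1) ^ i * (PsiDO.zeroHom ratD)^[i] (P'.coeff i * a) = 0
    rw [h2 i (by omega), zero_mul, PsiDO.iterate_zeroHom_zero, mul_zero]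
  rw [e1, e2, Finset.sum_apply, map_sum]
  refine Finset.sum_congr rfl fun i _ => ?_
  have h3 : Rep (P.coeff i * f) (P'.coeff i * a) := fun t ht => by
    rw [Pi.mul_apply, map_mul, hP i t ht, h t ht]
  rw [Pi.mul_apply, map_mul, h3.dx_iterate i t ht, map_pow, map_neg, map_one]
  rfl

/-! ### Orbits generated by multiples of the norms -/

theorem Rep.inv {f : Times → ℝ} {u : Ratˣ} (h : Rep f u) : Rep f⁻¹ ↑u⁻¹ := by
  intro t ht
  rw [Pi.inv_apply, h t ht, inv_eq_iff_eq_inv]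
  refine eq_inv_of_mul_eq_one_left ?_
  rw [← map_mul, Units.mul_inv, map_one]

/-- Non-zero constants as units. -/
def constUnit {c : ℝ} (hc : c ≠ 0) : Ratˣ :=
  Units.map (toRat.comp MvPolynomial.C).toMonoidHom (Units.mk0 c hc)

theorem ev_constUnit {c : ℝ} (hc : c ≠ 0) (t : Times) : ev t (constUnit hc : Rat) = c := by
  change ev t (toRat (MvPolynomial.C c)) = c
  rw [ev_toRat, evMom_C]

theorem ratFlow_constUnit {c : ℝ} (hc : c ≠ 0) (r : ℕ+) : ratFlow r (constUnit hc : Rat) = 0 := by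
  change ratFlow r (toRat (MvPolynomial.C c)) = 0
  rw [ratFlow_toRat, momFlow_C, map_zero]

/-- The orthogonal polynomials for the weight `c e^V`. -/
@[reducible]
def orbit {c : ℝ} (hc : c ≠ 0) : OrthData Rat := momData.scale (constUnit hc) (ratFlow_constUnit hc)

/-- `Φ_k = c h_k` on the domain. -/
def IsMultiple {c : ℝ} (hc : c ≠ 0) (Φ : ℕ → Times → ℝ) : Prop :=
  ∀ k, Rep (Φ k) ((orbit hc).h k)

variable {c : ℝ} {hc : c ≠ 0} {Φ : ℕ → Times → ℝ}

theorem IsMultiple.repOp_dbT (h : IsMultiple hc Φ) (n : ℕ) :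
    RepOp (dbT (Φ n)) ((orbit hc).T n) :=
  ((repOp_fn (h n)).mul (repOp_Dpow 1)).mul (repOp_fn (h n).inv)

theorem IsMultiple.repOp_dbTinv (h : IsMultiple hc Φ) (n : ℕ) :
    RepOp (dbTinv (Φ n)) ((orbit hc).Tinv n) :=
  ((repOp_fn (h n)).mul (repOp_Dpow (-1))).mul (repOp_fn (h n).inv)

theorem IsMultiple.repOp_dbLax (h : IsMultiple hc Φ) (n : ℕ) :
    RepOp (dbLax Φ n) ((orbit hc).lax n) := by
  induction n with
  | zero => exact repOp_Dpow 1
  | succ n ih => exact ((h.repOp_dbT n).mul ih).mul (h.repOp_dbTinv n)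

theorem IsMultiple.repOp_dbDress (h : IsMultiple hc Φ) (n : ℕ) :
    RepOp (dbDress Φ n) ((orbit hc).dress n) := by
  induction n with
  | zero => exact repOp_one
  | succ n ih => exact ((h.repOp_dbT n).mul ih).mul (repOp_Dpow (-1))

theorem IsMultiple.isCKP (h : IsMultiple hc Φ) (k : ℕ) :
    IsCKP (dbLax Φ k) (Φ k) (dbAdj Φ k) where
  form := by
    cases k with
    | zero =>
      have h1 := (repOp_Dpow 1).add (((repOp_fn (h 0)).mul (repOp_Dpow (-1))).mul
        (repOp_fn rep_zero))
      rw [map_zero, mul_zero, add_zero] at h1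
      exact (h.repOp_dbLax 0).opEq h1
    | succ k =>
      have h1 := (repOp_Dpow 1).add (((repOp_fn (h (k + 1))).mul (repOp_Dpow (-1))).mul
        (repOp_fn (h k).inv))
      have h2 := h.repOp_dbLax (k + 1)
      rw [OrthData.lax_succ_eq] at h2
      exact h2.opEq h1
  lax := fun t ht r hr i => by
    have h0 := h.repOp_dbLax k
    have h1 := (h0 i).hasTimeDeriv ht hr
    have h2 := congrArg (fun P : PDO ratD => P.coeff i) ((orbit hc).der_lax k r)
    have h3 := ((h0.pow r).plus.mul h0).add (h0.mul (h0.pow r).plus).neg i t ht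
    exact h1.congr_deriv ((congrArg (ev t) h2).trans h3.symm)
  eigen := fun t ht r hr => by
    have h1 := (h k).hasTimeDeriv ht hr
    have h2 := ((h.repOp_dbLax k).pow r).act (h k) t ht
    exact h1.congr_deriv ((congrArg (ev t) ((orbit hc).act_lax_pow k r).symm).trans h2.symm)
  adj := fun t ht r hr => by
    cases k with
    | zero =>
      have h1 := ((h.repOp_dbLax 0).pow r).adjAct rep_zero t ht
      have h3 : ((orbit hc).lax 0 ^ (r : ℕ)).adjAct 0 = 0 := by
        rw [← coeff_D_inv_mul, map_zero, zero_mul, mul_zero, PDO.coeff_zero]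
      have h2 := rep_zero.hasTimeDeriv ht hr
      refine h2.congr_deriv ?_
      rw [map_zero, map_zero, zero_eq_neg]
      refine h1.trans ?_
      rw [← map_zero (ev t)]
      exact congrArg (ev t) h3
    | succ k =>
      have h1 := (h k).inv.hasTimeDeriv ht hr
      have h2 := ((h.repOp_dbLax (k + 1)).pow r).adjAct (h k).inv t ht
      have h3 := congrArg (ev t) ((orbit hc).adjAct_lax_pow k r)
      rw [map_neg] at h3
      refine h1.congr_deriv ?_
      rw [eq_neg_iff_add_eq_zero, ← eq_neg_iff_add_eq_zero]
      exact (neg_eq_iff_eq_neg.mpr (h2.trans h3)).symm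

theorem Rep.ne_zero {f : Times → ℝ} {u : Ratˣ} (h : Rep f u) : ∀ t ∈ timeDomain, f t ≠ 0 :=
  fun t ht => by
    rw [h t ht]
    exact (u.isUnit.map (ev t)).ne_zero

/-- The logarithmic derivative of a function represented by a unit. -/
theorem Rep.hasTimeDeriv_log {f : Times → ℝ} {u : Ratˣ} (h : Rep f u) {t : Times}
    (ht : t ∈ timeDomain) {r : ℕ+} (hr : IsFlow r t) :
    HasTimeDeriv r (fun v => Real.log (f v)) (ev t (logDer (ratFlow r) u)) t := by
  have h0 : f (t + (0 : ℝ) • tdir r) ≠ 0 := by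
    rw [zero_smul, add_zero]
    exact h.ne_zero t ht
  refine ((h.hasTimeDeriv ht hr).log h0).congr_deriv ?_
  rw [zero_smul, add_zero, logDer, map_mul, div_eq_mul_inv, ← h.inv t ht, Pi.inv_apply]

theorem Rep.dx_log {f : Times → ℝ} {u : Ratˣ} (h : Rep f u) :
    Rep (OneMatrix.dx fun v => Real.log (f v)) (logDer ratD u) :=
  fun _ ht => (h.hasTimeDeriv_log ht (isFlow_one ht)).deriv

/-- The right side of the recursion for the eigenfunctions. -/
theorem IsMultiple.recursion {Φ : ℕ → Times → ℝ} (k : ℕ)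
    (h : ∀ j ≤ k, Rep (Φ j) ((orbit hc).h j)) {t : Times} (ht : t ∈ timeDomain) :
    Φ k t * dx^[2] (fun u => Real.log (Φ k u)) t + Φ k t ^ 2 * dbAdj Φ k t =
      ev t ((orbit hc).h (k + 1)) := by
  have h1 : dx^[2] (fun u => Real.log (Φ k u)) t = ev t (ratD ((orbit hc).b k)) :=
    (h k le_rfl).dx_log.dx t ht
  rw [h1, h k le_rfl t ht]
  cases k with
  | zero =>
    have h2 := congrArg (ev t) (orbit hc).toda_zero
    have h3 := congrArg (ev t) ((orbit hc).h 0).mul_inv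
    rw [map_mul] at h2 h3
    rw [map_one] at h3
    change _ * _ + _ * (0 : ℝ) = _
    rw [h2]
    linear_combination (ev t ((orbit hc).h (0 + 1) : Rat)) * h3
  | succ k =>
    -- The Toda equation reads `∂² ln h_{k+1} = h_{k+2}/h_{k+1} - h_{k+1}/h_k`. Multiplied by
    -- `h_{k+1}`, the subtracted term is compensated by `Φ² Ψ` with `Ψ = 1/h_k`.
    have h2 := congrArg (ev t) ((orbit hc).toda_succ k)
    have h3 := congrArg (ev t) ((orbit hc).h (k + 1)).mul_inv
    rw [map_mul] at h3
    rw [map_sub, map_mul, map_mul] at h2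
    rw [map_one] at h3
    have h4 : dbAdj Φ (k + 1) t = ev t (↑((orbit hc).h k)⁻¹ : Rat) := (h k (by omega)).inv t ht
    rw [h2, h4]
    linear_combination (ev t ((orbit hc).h (k + 1 + 1) : Rat)) * h3

/-- Multiples of the norms form an orbit. -/
theorem IsMultiple.isBHOrbit (h : IsMultiple hc Φ) : IsBHOrbit Φ where
  ne_zero k := (h k).ne_zero
  smooth k _ ht := (h k).contDiffAt ht
  ckp := h.isCKP
  recursion k t ht := by
    rw [IsMultiple.recursion k (fun j _ => h j) ht]
    exact h (k + 1) t ht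

/-- An orbit is determined by its first eigenfunction. -/
theorem IsBHOrbit.isMultiple (h : IsBHOrbit Φ) (h0 : Rep (Φ 0) ((orbit hc).h 0)) :
    IsMultiple hc Φ := by
  intro k
  induction k using Nat.strong_induction_on with
  | _ k ih =>
    cases k with
    | zero => exact h0
    | succ k =>
      intro t ht
      rw [h.recursion k t ht, IsMultiple.recursion k (fun j hj => ih j (by omega)) ht]

theorem momData_h_zero : (momData.h 0 : Rat) = mom 0 := by
  rw [← momData.norm, momData.p_zero, pow_zero, one_mul, ← pow_zero X]
  exact momL_X_pow 0

theorem ev_orbit_h {t : Times} (n : ℕ) :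
    ev t ((orbit hc).h n : Rat) = c * ev t (momData.h n : Rat) := by
  rw [Units.val_mul, map_mul, ev_constUnit]

theorem hasDensity_iff (hc : c ≠ 0) (φ : Times → ℝ) :
    HasDensity (fun _ => c) φ ↔ Rep φ ((orbit hc).h 0) := by
  have key : ∀ t ∈ timeDomain, ∫ x, c * Real.exp (pot t x) = ev t ((orbit hc).h 0) := by
    intro t ht
    rw [ev_orbit_h, momData_h_zero, ev_mom ht, integral_const_mul, moment]
    simp
  refine ⟨fun h t ht => (h t ht).2.trans (key t ht), fun h t ht =>
    ⟨(integrable_of_mem ht).const_mul c, (h t ht).trans (key t ht).symm⟩⟩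

theorem IsOrthogonal.isMultiple_iff {P : Times → ℕ → ℝ[X]} {h : ℕ → Times → ℝ}
    (hP : IsOrthogonal P h) (hc : c ≠ 0) :
    IsMultiple hc Φ ↔ ∀ n, ∀ t ∈ timeDomain, Φ n t = c * h n t := by
  refine forall_congr' fun n => forall_congr' fun t => forall_congr' fun ht => ?_
  rw [ev_orbit_h, hP.rep n t ht]

theorem isBHOrbit_iff (hc : c ≠ 0) :
    IsBHOrbit Φ ∧ HasDensity (fun _ => c) (Φ 0) ↔ IsMultiple hc Φ := by
  rw [hasDensity_iff hc]
  exact ⟨fun h => h.1.isMultiple h.2, fun h => ⟨h.isBHOrbit, h 0⟩⟩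

end

end OneMatrix

/-! ### The fully degenerate truncated KP hierarchy -/

namespace OneMatrix

noncomputable section

open Polynomial PDO

local infixl:70 " ⬝ " => PsiDO.mul dx

variable {c : ℝ} {hc : c ≠ 0} {φ : Times → ℝ} {n : ℕ} {W L : Op}

theorem orbit_h_zero : ((orbit hc).h 0 : Rat) = constUnit hc * mom 0 := by
  rw [← momData_h_zero, Units.val_mul]

theorem ratD_iterate_orbit_h_zero (j : ℕ) :
    (PsiDO.zeroHom ratD)^[j] ((orbit hc).h 0 : Rat) = constUnit hc * mom j := by
  induction j with
  | zero => exact orbit_h_zero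
  | succ j ih =>
    rw [Function.iterate_succ_apply', ih]
    change ratFlow 1 _ = _
    rw [Derivation.leibniz, ratFlow_constUnit, smul_zero, add_zero, ratFlow_mom, smul_eq_mul]
    rfl

theorem ratFlow_orbit_h_zero (r : ℕ+) :
    ratFlow r ((orbit hc).h 0 : Rat) = (PsiDO.zeroHom ratD)^[(r : ℕ)] ((orbit hc).h 0 : Rat) := by
  rw [ratD_iterate_orbit_h_zero, orbit_h_zero, Derivation.leibniz, ratFlow_constUnit, smul_zero,
    add_zero, ratFlow_mom, smul_eq_mul, zero_add]

theorem dx_iterate_density (hφ : Rep φ ((orbit hc).h 0)) {t : Times} (ht : t ∈ timeDomain)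
    (j : ℕ) : dx^[j] φ t = c * moment t j := by
  rw [hφ.dx_iterate j t ht, ratD_iterate_orbit_h_zero, map_mul, ev_constUnit, ev_mom ht]

theorem dx_iterate_one (k : ℕ) : dx^[k + 1] (1 : Times → ℝ) = 0 := by
  have h : dx (1 : Times → ℝ) = 0 := by
    funext t
    exact deriv_const _ _
  rw [Function.iterate_succ_apply, h, PsiDO.iterate_zeroHom_zero]

theorem coeff_mul_Dpow (W : Op) (j i : ℤ) : (W ⬝ Dpow j).coeff i = W.coeff (i - j) :=
  PsiDO.coeff_mul_monomial_one dx dx_iterate_one W j i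

/-- The symbol of `W D^n` at time `t`. -/
def symbolAt (W : Op) (n : ℕ) (t : Times) : ℝ[X] :=
  ∑ i ∈ Finset.range (n + 1), C (W.coeff (i - n) t) * X ^ i

theorem coeff_symbolAt (W : Op) (n : ℕ) (t : Times) (i : ℕ) :
    (symbolAt W n t).coeff i = if i ≤ n then W.coeff (i - n) t else 0 := by
  simp only [symbolAt, finsetSum_coeff, coeff_C_mul, coeff_X_pow, mul_ite, mul_one, mul_zero,
    Finset.sum_ite_eq, Finset.mem_range, Nat.lt_succ_iff]

theorem intExp_sum {t : Times} (ht : t ∈ timeDomain) {ι : Type*} (s : Finset ι) (f : ι → ℝ[X]) :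
    intExp t (∑ i ∈ s, f i) = ∑ i ∈ s, intExp t (f i) := by
  classical
  induction s using Finset.induction_on with
  | empty => simp [intExp]
  | insert a s ha ih => rw [Finset.sum_insert ha, Finset.sum_insert ha, intExp_add ht, ih]

/-- Because `∂^i φ = c m_i`, a differential operator with symbol `Q` sends `∂^j φ` to `c ∫ λ^j Q
e^V`. The annihilation conditions are thus orthogonality relations. -/
theorem act_dx_iterate (hφ : Rep φ ((orbit hc).h 0)) {t : Times} (ht : t ∈ timeDomain)
    (hW : ∀ i : ℤ, 0 < i → W.coeff i t = 0) (j : ℕ) :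
    (W ⬝ Dpow n).act dx (dx^[j] φ) t = c * intExp t (X ^ j * symbolAt W n t) := by
  obtain ⟨N, hN⟩ := (W ⬝ Dpow n).bdd
  have hN' : ∀ i : ℤ, ((n + N.toNat : ℕ) : ℤ) < i → (W ⬝ Dpow n).coeff i = 0 :=
    fun i hi => hN i (by omega)
  rw [op_act_eq_sum _ _ hN', Finset.sum_apply, symbolAt, Finset.mul_sum, intExp_sum ht,
    Finset.mul_sum, ← Finset.sum_subset (Finset.range_mono (by omega : n + 1 ≤ n + N.toNat + 1))]
  · refine Finset.sum_congr rfl fun i _ => ?_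
    rw [Pi.mul_apply, coeff_mul_Dpow, ← Function.iterate_add_apply, dx_iterate_density hφ ht,
      mul_left_comm (X ^ j), ← pow_add, intExp_C_mul, intExp_X_pow, add_comm j]
    ring
  · intro i _ hi
    rw [Finset.mem_range, not_lt] at hi
    rw [Pi.mul_apply, coeff_mul_Dpow, hW _ (by omega), zero_mul]

/-- Monic orthogonal polynomials are unique. -/
theorem eq_map_orthPoly {t : Times} (ht : t ∈ timeDomain) {Q : ℝ[X]}
    (h1 : Q.coeff n = 1) (h2 : ∀ i, n < i → Q.coeff i = 0)
    (ho : ∀ j < n, intExp t (X ^ j * Q) = 0) : Q = (orthPoly n).map (ev t) := by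
  rw [← sub_eq_zero]
  by_contra hne
  set R := Q - (orthPoly n).map (ev t) with hR
  have hcoeff : ∀ i, n ≤ i → R.coeff i = 0 := by
    intro i hi
    rw [hR, Polynomial.coeff_sub, coeff_map]
    rcases hi.eq_or_lt with rfl | hi
    · rw [h1, coeff_orthPoly_self, map_one, sub_self]
    · rw [h2 i hi, coeff_orthPoly_gt n i hi, map_zero, sub_self]
  have hdeg : R.natDegree < n := by
    by_contra h
    exact leadingCoeff_ne_zero.mpr hne (hcoeff _ (not_lt.mp h))
  have hX : ∀ j < n, intExp t (X ^ j * R) = 0 := by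
    intro j hj
    have e : X ^ j * R = X ^ j * Q + C (-1) * ((X ^ j * orthPoly n).map (ev t)) := by
      rw [hR, Polynomial.map_mul, Polynomial.map_pow, map_X]
      simp only [map_neg, map_one]
      ring
    rw [e, intExp_add ht, ho j hj, intExp_C_mul, ← ev_momL ht, momL_orthPoly n j hj, map_zero,
      mul_zero, add_zero]
  have h3 := intExp_mul_orthPoly ht (Q := R) (n := R.natDegree)
    fun i hi => coeff_eq_zero_of_natDegree_lt hi
  have h4 : intExp t (R * (orthPoly R.natDegree).map (ev t)) = 0 := by
    rw [((orthPoly R.natDegree).map (ev t)).as_sum_range_C_mul_X_pow, Finset.mul_sum,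
      intExp_sum ht]
    refine Finset.sum_eq_zero fun i hi => ?_
    rw [(natDegree_map_orthPoly t _).1, Finset.mem_range] at hi
    rw [mul_left_comm, intExp_C_mul, mul_comm R, hX i (by omega), mul_zero]
  rw [h4] at h3
  exact mul_ne_zero (leadingCoeff_ne_zero.mpr hne) (ev_h_pos ht _).ne' h3.symm

theorem IsOrthogonal.hasPolynomialSymbol_iff {P : Times → ℕ → ℝ[X]} {h : ℕ → Times → ℝ}
    (hP : IsOrthogonal P h) : HasPolynomialSymbol n P W ↔ RepOp W (momData.dress n) := by
  refine ⟨fun h i t ht => ?_, fun h t ht i => ?_⟩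
  · rw [h t ht i, OrthData.coeff_dress, hP.eq_orthPoly ht]
    split_ifs
    · exact coeff_map _ _
    · exact (map_zero _).symm
  · rw [h i t ht, OrthData.coeff_dress, hP.eq_orthPoly ht]
    split_ifs
    · exact (coeff_map _ _).symm
    · exact map_zero _

theorem lax_mul_dress (n : ℕ) : momData.lax n * momData.dress n = momData.dress n * D 1 := by
  rw [momData.dress_eq, ← mul_assoc, momData.lax_mul_sym, mul_assoc, mul_assoc, D_mul_D, D_mul_D,
    add_comm]

theorem coeff_dress_zero (n : ℕ) : (momData.dress n).coeff 0 = 1 := by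
  rw [momData.coeff_dress, if_pos (by omega), add_zero, Int.toNat_natCast]
  exact momData.coeff_self n

theorem coeff_dress_pos (n : ℕ) (i : ℤ) (hi : 0 < i) : (momData.dress n).coeff i = 0 := by
  rw [momData.coeff_dress, if_pos (by omega)]
  exact momData.coeff_gt n _ (by omega)

theorem coeff_dress_neg (n : ℕ) (i : ℤ) (hi : i < -n) : (momData.dress n).coeff i = 0 := by
  rw [momData.coeff_dress, if_neg (by omega)]

/-- At each time, truncation, monicity and annihilation make the symbol of `W D^n` a monic
polynomial of degree `n` orthogonal to all lower powers, which is unique. -/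
theorem IsGenBH.repOp_dress (hφ : Rep φ ((orbit hc).h 0)) (h : IsGenBH n φ W L) :
    RepOp W (momData.dress n) := by
  intro i t ht
  have hpos : ∀ i : ℤ, 0 < i → W.coeff i t = 0 := fun i hi => h.trunc t ht i (Or.inr hi)
  have hQ := eq_map_orthPoly (n := n) (Q := symbolAt W n t) ht
    (by rw [coeff_symbolAt, if_pos le_rfl, sub_self, h.monic t ht])
    (fun i hi => by rw [coeff_symbolAt, if_neg (by omega)]) fun j hj => by
      have h1 := h.annih t ht j hj
      rw [act_dx_iterate hφ ht hpos] at h1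
      exact (mul_eq_zero.mp h1).resolve_left hc
  rcases lt_or_ge 0 i with hi | hi
  · rw [hpos i hi, coeff_dress_pos n i hi, map_zero]
  rcases lt_or_ge i (-n) with hi' | hi'
  · rw [h.trunc t ht i (Or.inl hi'), coeff_dress_neg n i hi', map_zero]
  have h1 := congrArg (fun Q => Q.coeff ((n : ℤ) + i).toNat) hQ
  simp only [coeff_symbolAt, coeff_map] at h1
  rw [if_pos (by omega), show (((n : ℤ) + i).toNat : ℤ) - n = i by omega] at h1
  rw [h1, momData.coeff_dress, if_pos (by omega)]

/-- `(L - L₀) W` vanishes on the domain, and `W` is monic of order zero, so right division gives `L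
= L₀`. The division is done after evaluation at a time, since off the domain nothing is known about
the coefficients. -/
theorem opEq_of_dress {L₀ : Op} (hW : RepOp W (momData.dress n)) (hL₀ : RepOp L₀ (momData.lax n))
    (h : OpEq (L ⬝ W) (W ⬝ Dpow 1)) : OpEq L L₀ := by
  intro t ht i
  have h1 := PsiDO.coeff_eq_zero_of_mul (Pi.evalRingHom (fun _ : Times => ℝ) t) dx
    (X := L + -L₀) (W := W) (n := 0) ?_ ?_ i fun j _ => ?_
  · have h2 : L.coeff i t + -L₀.coeff i t = 0 := h1
    linarith
  · change W.coeff 0 t = 1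
    rw [hW 0 t ht, coeff_dress_zero, map_one]
  · intro k j hj
    change dx^[k] (W.coeff j) t = 0
    rw [(hW j).dx_iterate k t ht, coeff_dress_pos n j hj, PsiDO.iterate_zeroHom_zero, map_zero]
  · rw [PsiDO.add_mul']
    change (L ⬝ W).coeff j t + (-L₀ ⬝ W).coeff j t = 0
    have e1 := (hW.mul (repOp_Dpow 1)) j t ht
    have e2 := (hL₀.neg.mul hW) j t ht
    rw [h t ht j]
    refine (congrArg₂ (· + ·) e1 e2).trans ?_
    rw [← map_add, ← PDO.coeff_add, neg_mul, lax_mul_dress, add_neg_cancel]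
    exact map_zero _

theorem isGenBH_of_rep (hφ : Rep φ ((orbit hc).h 0)) (hW : RepOp W (momData.dress n))
    (hL : RepOp L (momData.lax n)) : IsGenBH n φ W L where
  free t ht r hr := by
    rw [hφ.dx_iterate _ t ht, ← ratFlow_orbit_h_zero]
    exact hφ.hasTimeDeriv ht hr
  trunc t ht i hi := by
    rw [hW i t ht]
    rcases hi with hi | hi
    · rw [coeff_dress_neg n i hi, map_zero]
    · rw [coeff_dress_pos n i hi, map_zero]
  monic t ht := by rw [hW 0 t ht, coeff_dress_zero, map_one]
  annih t ht j hj := by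
    have hpos : ∀ i : ℤ, 0 < i → W.coeff i t = 0 := fun i hi => by
      rw [hW i t ht, coeff_dress_pos n i hi, map_zero]
    have hQ : symbolAt W n t = (orthPoly n).map (ev t) := by
      ext i
      rw [coeff_symbolAt, coeff_map]
      split_ifs with h
      · rw [hW _ t ht, momData.coeff_dress, if_pos (by omega)]
        congr 2
        omega
      · rw [coeff_orthPoly_gt n i (by omega), map_zero]
    rw [act_dx_iterate hφ ht hpos, hQ, ← map_X (ev t), ← Polynomial.map_pow, ← Polynomial.map_mul,
      ← ev_momL ht, momL_orthPoly n j hj, map_zero, mul_zero]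
  dress := by
    have h1 := hL.mul hW
    rw [lax_mul_dress] at h1
    exact h1.opEq (hW.mul (repOp_Dpow 1))
  sato t ht r hr i := by
    have h1 := (hW i).hasTimeDeriv ht hr
    have h2 := congrArg (fun P : PDO ratD => P.coeff i) (momData.der_dress n r)
    have h3 := ((hL.pow r).minus.mul hW).neg i t ht
    exact h1.congr_deriv ((congrArg (ev t) h2).trans h3.symm)

theorem IsOrthogonal.isGenBH_iff {P : Times → ℕ → ℝ[X]} {h : ℕ → Times → ℝ}
    (hP : IsOrthogonal P h) (hc : c ≠ 0) (hφ : HasDensity (fun _ => c) φ) :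
    IsGenBH n φ W L ↔ HasPolynomialSymbol n P W ∧ OpEq L (dbLax h n) := by
  have hφ' := (hasDensity_iff hc φ).mp hφ
  have hm : IsMultiple one_ne_zero h := (hP.isMultiple_iff one_ne_zero).mpr fun n t _ =>
    (one_mul _).symm
  have hlax : RepOp (dbLax h n) (momData.lax n) := by
    have h1 := hm.repOp_dbLax n
    have h2 : (orbit one_ne_zero).lax n = momData.lax n :=
      momData.cancel n (((orbit one_ne_zero).lax_mul_sym n).trans (momData.lax_mul_sym n).symm)
    rwa [h2] at h1
  rw [hP.hasPolynomialSymbol_iff]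
  refine ⟨fun hB => ?_, fun ⟨hW, hL⟩ => ?_⟩
  · have hW := hB.repOp_dress hφ'
    exact ⟨hW, opEq_of_dress hW hlax hB.dress⟩
  · exact isGenBH_of_rep hφ' hW fun i t ht => (hL t ht i).trans (hlax i t ht)

end

end OneMatrix

/-! ### Wave functions and logarithmic derivatives of the partition function -/

namespace OneMatrix

noncomputable section

open Polynomial PDO

variable {Φ : ℕ → Times → ℝ} {n : ℕ} {W L : Op}

theorem orbit_one_lax (n : ℕ) : (orbit one_ne_zero).lax n = momData.lax n :=
  momData.cancel n (((orbit one_ne_zero).lax_mul_sym n).trans (momData.lax_mul_sym n).symm)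

theorem IsMultiple.repOp_lax (h : IsMultiple one_ne_zero Φ) (n : ℕ) :
    RepOp (dbLax Φ n) (momData.lax n) := by
  have h1 := h.repOp_dbLax n
  rwa [orbit_one_lax] at h1

theorem IsMultiple.repOp_dress (h : IsMultiple one_ne_zero Φ) (n : ℕ) :
    RepOp (dbDress Φ n) (momData.dress n) := by
  have h1 := h.repOp_dbDress n
  have h2 : (orbit one_ne_zero).dress n = momData.dress n :=
    ((orbit one_ne_zero).dress_eq n).trans (momData.dress_eq n).symm
  rwa [h2] at h1

theorem IsMultiple.rep_h (h : IsMultiple one_ne_zero Φ) (n : ℕ) : Rep (Φ n) (momData.h n) :=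
  fun t ht => by rw [h n t ht, ev_orbit_h, one_mul]

theorem IsMultiple.isGenBH (h : IsMultiple one_ne_zero Φ) (n : ℕ) :
    IsGenBH n (Φ 0) (dbDress Φ n) (dbLax Φ n) :=
  isGenBH_of_rep (h 0) (h.repOp_dress n) (h.repOp_lax n)

/-! ### Wave functions -/

theorem IsOrthogonal.wave_eq {P : Times → ℕ → ℝ[X]} {h : ℕ → Times → ℝ} (hP : IsOrthogonal P h)
    {t : Times} (ht : t ∈ timeDomain) (n : ℕ) (x : ℝ) :
    wave P n t x = ((orthPoly n).map (ev t)).eval x * Real.exp (pot t x) := by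
  rw [wave, hP.eq_orthPoly ht]

theorem eval_map_orthPoly (hW : RepOp W (momData.dress n)) {t : Times} (ht : t ∈ timeDomain)
    (x : ℝ) : ((orthPoly n).map (ev t)).eval x =
      ∑ j ∈ Finset.range (n + 1), W.coeff (-(j : ℤ)) t * x ^ (n - j) := by
  rw [eval_eq_sum_range, (natDegree_map_orthPoly t n).1, ← Finset.sum_range_reflect]
  refine Finset.sum_congr rfl fun j hj => ?_
  have hj := Finset.mem_range.mp hj
  rw [hW _ t ht, momData.coeff_dress, if_pos (by omega), coeff_map]
  rw [show n + 1 - 1 - j = n - j by omega, show ((n : ℤ) + -(j : ℤ)).toNat = n - j by omega]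

theorem pow_mul_baFun (hW : RepOp W (momData.dress n)) {t : Times} (ht : t ∈ timeDomain)
    {x : ℝ} (hx : x ≠ 0) : x ^ n * baFun W t x =
      ((orthPoly n).map (ev t)).eval x * Real.exp (pot t x) := by
  rw [eval_map_orthPoly hW ht, baFun, ← mul_assoc]
  congr 1
  have hinj : Set.InjOn (fun j : ℕ => -(j : ℤ)) (Finset.range (n + 1) : Finset ℕ) :=
    fun a _ b _ h => by simpa using h
  rw [finsum_eq_sum_of_support_subset (s := (Finset.range (n + 1)).image fun j : ℕ => -(j : ℤ)),
    Finset.sum_image hinj, Finset.mul_sum]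
  · refine Finset.sum_congr rfl fun j hj => ?_
    have hj := Finset.mem_range.mp hj
    rw [zpow_neg, zpow_natCast, pow_sub₀ x hx (by omega)]
    ring
  · intro i hi
    by_contra h
    apply hi
    rw [Finset.coe_image, Set.mem_image] at h
    push Not at h
    have h2 : W.coeff i t = 0 := by
      rw [hW i t ht]
      rcases lt_or_ge 0 i with h0 | h0
      · rw [coeff_dress_pos n i h0, map_zero]
      · rw [coeff_dress_neg n i, map_zero]
        by_contra h1
        exact h (-i).toNat (by simp; omega) (by omega)
    change W.coeff i t * x ^ i = 0
    rw [h2, zero_mul]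

/-- `f = Q e^V` on the domain. -/
def RepWave (x : ℝ) (f : Times → ℝ) (Q : Rat[X]) : Prop :=
  ∀ t ∈ timeDomain, f t = (Q.map (ev t)).eval x * Real.exp (pot t x)

theorem RepWave.hasTimeDeriv {x : ℝ} {f : Times → ℝ} {Q : Rat[X]} (h : RepWave x f Q) {t : Times}
    (ht : t ∈ timeDomain) {r : ℕ+} (hr : IsFlow r t) : HasTimeDeriv r f
      (((flow (ratFlow r) r Q).map (ev t)).eval x * Real.exp (pot t x)) t := by
  refine hasTimeDeriv_congr hr h ?_
  have h1 : HasTimeDeriv r (fun u => (Q.map (ev u)).eval x)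
      (((polyDer (ratFlow r) Q).map (ev t)).eval x) t := by
    induction Q using Polynomial.induction_on' generalizing f with
    | add p q hp hq =>
      simp only [Polynomial.map_add, eval_add, map_add]
      exact HasDerivAt.add (hp fun _ _ => rfl) (hq fun _ _ => rfl)
    | monomial n a =>
      have h : polyDer (ratFlow r) (monomial n a) = monomial n (ratFlow r a) := by
        ext i
        rw [coeff_polyDer, coeff_monomial, coeff_monomial]
        split_ifs <;> simp
      simp only [h, Polynomial.map_monomial, eval_monomial]
      exact (hasTimeDeriv_ev ht hr a).mul_const (x ^ n)
  have h2 : HasTimeDeriv r (fun u => Real.exp (pot u x)) (Real.exp (pot t x) * x ^ (r : ℕ)) t := by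
    simp only [HasTimeDeriv, pot_shift (ht.1 x)]
    have := (((hasDerivAt_id (0 : ℝ)).mul_const (x ^ (r : ℕ))).const_add (pot t x)).exp
    simpa using this
  refine (HasDerivAt.mul h1 h2).congr_deriv ?_
  simp only [zero_smul, add_zero, flow_apply, Polynomial.map_add, Polynomial.map_mul,
    Polynomial.map_pow, map_X, eval_add, eval_mul, eval_pow, eval_X]
  ring

theorem RepWave.dx_iterate {x : ℝ} {f : Times → ℝ} {Q : Rat[X]} (h : RepWave x f Q) (k : ℕ) :
    RepWave x (dx^[k] f) ((flow ratD 1)^[k] Q) := by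
  induction k with
  | zero => exact h
  | succ k ih =>
    rw [Function.iterate_succ_apply', Function.iterate_succ_apply']
    exact fun t ht => (ih.hasTimeDeriv ht (isFlow_one ht)).deriv

theorem RepWave.act {x : ℝ} {f : Times → ℝ} {Q : Rat[X]} (h : RepWave x f Q) {P : Op}
    {P' : PDO ratD} (hP : RepOp P P') : RepWave x (P.act dx f) (actPoly P' Q) := by
  intro t ht
  obtain ⟨N, h1, h2⟩ := exists_bdd P P'
  rw [op_act_eq_sum P f h1, actPoly_eq_sum P' Q h2, Finset.sum_apply, Polynomial.map_sum,
    eval_finsetSum, Finset.sum_mul]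
  refine Finset.sum_congr rfl fun i _ => ?_
  rw [Pi.mul_apply, hP i t ht, h.dx_iterate i t ht, Polynomial.map_mul, map_C, eval_mul, eval_C,
    mul_assoc]

theorem IsOrthogonal.hasTimeDeriv_wave {P : Times → ℕ → ℝ[X]} {h : ℕ → Times → ℝ}
    (hP : IsOrthogonal P h) (hL : RepOp L (momData.lax n)) {t : Times} (ht : t ∈ timeDomain)
    {r : ℕ+} (hr : IsFlow r t) (x : ℝ) : HasTimeDeriv r (fun u => wave P n u x)
      ((L.pow dx r).act dx (fun u => wave P n u x) t) t := by
  have h0 : RepWave x (fun u => wave P n u x) (orthPoly n) := fun t ht => hP.wave_eq ht n x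
  refine (h0.hasTimeDeriv ht hr).congr_deriv ?_
  rw [h0.act (hL.pow r) t ht]
  congr 3
  exact (momData.actPoly_lax_pow n r).symm

/-! ### The partition function as a `τ`-function -/

theorem hasTimeDeriv_timeDeriv_log {τ : Times → ℝ} {u : Ratˣ} (hτ : Rep τ u)
    (hu : u = ∏ k ∈ Finset.range n, momData.h k) (hL : RepOp L (momData.lax n)) {t : Times}
    (ht : t ∈ timeDomain) {r : ℕ+} (hr : IsFlow r t) :
    HasTimeDeriv 1 (timeDeriv r fun v => Real.log (τ v)) ((L.pow dx r).coeff (-1) t) t := by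
  have h1 := hasTimeDeriv_ev ht (isFlow_one ht) (logDer (ratFlow r) u)
  have h2 := (hL.pow r) (-1) t ht
  have h3 := momData.coeff_lax_pow n r
  rw [← hu] at h3
  rw [h2]
  refine HasDerivAt.congr_of_eventuallyEq (h1.congr_deriv (congrArg (ev t) h3.symm)) ?_
  -- The inner derivative in `t_r` is needed at all nearby values of `t_1`, where the flow of `t_r`
  -- persists by `IsFlow.shift`.
  filter_upwards [isFlow_one ht, hr.shift (isFlow_one ht)] with s hs hs'
  exact (hτ.hasTimeDeriv_log hs hs').deriv

/-- `p_j(-[∂])` on polynomials in the moments. -/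
def schurMom (a : Mom) : ℕ → Mom
  | 0 => a
  | j + 1 => MvPolynomial.C (-((j : ℝ) + 1)⁻¹) *
      ∑ i : Fin (j + 1), momFlow (Nat.succPNat i) (schurMom a (j - i))

theorem schur_eq {τ : Times → ℝ} {a : Mom} (hτ : ∀ t ∈ timeDomain, τ t = evMom t a) (j : ℕ) :
    ∀ t ∈ timeDomain, (∀ r : ℕ+, (r : ℕ) ≤ j → IsFlow r t) →
      schur τ j t = evMom t (schurMom a j) := by
  induction j using Nat.strong_induction_on with
  | _ j ih =>
  intro t ht hr
  cases j with
  | zero =>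
    rw [schur, schurMom]
    exact hτ t ht
  | succ j =>
    rw [schur, schurMom, map_mul, evMom_C, map_sum]
    have h1 : ∀ i : Fin (j + 1), timeDeriv (Nat.succPNat i) (schur τ (j - i)) t =
        evMom t (momFlow (Nat.succPNat i) (schurMom a (j - i))) := by
      intro i
      have hi := hr (Nat.succPNat i) (by simp; omega)
      refine HasDerivAt.deriv (HasDerivAt.congr_of_eventuallyEq
        (hasTimeDeriv_evMom ht hi (schurMom a (j - i))) ?_)
      -- The induction hypothesis is going to be differentiated, so all the lower flows must exist
      -- at the neighbouring times as well.
      have h2 : ∀ᶠ s : ℝ in 𝓝 0, ∀ q : Fin (j + 1), IsFlow (Nat.succPNat q)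
          (t + s • tdir (Nat.succPNat i)) :=
        eventually_all.mpr fun q => (hr (Nat.succPNat q) (by simp; omega)).shift hi
      filter_upwards [hi, h2] with s hs hs2
      refine ih (j - i) (by omega) _ hs fun q hq => ?_
      have h3 := hs2 ⟨q.natPred, by have := q.natPred_add_one; omega⟩
      rwa [PNat.succPNat_natPred] at h3
    change -(∑ i : Fin (j + 1), timeDeriv (Nat.succPNat i) (schur τ (j - i)) t) / ((j : ℝ) + 1) = _
    rw [Finset.sum_congr rfl fun i _ => h1 i]
    field_simp

end

end OneMatrix

/-! ### The Miwa shift of Hankel determinants -/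

namespace OneMatrix

noncomputable section

open Polynomial PDO

variable {Φ : ℕ → Times → ℝ} {n : ℕ} {W L : Op}

/-- The Miwa shift `t ↦ t - [X]` on polynomials in the moments: `m_k ↦ m_k - X m_{k+1}`. -/
def miwa : Mom →+* Mom[X] :=
  MvPolynomial.eval₂Hom (Polynomial.C.comp MvPolynomial.C)
    fun k => C (MvPolynomial.X k) - X * C (MvPolynomial.X (k + 1))

theorem coeff_miwa_mul_X_zero (a : Mom) (k : ℕ) :
    (miwa (a * MvPolynomial.X k)).coeff 0 = (miwa a).coeff 0 * MvPolynomial.X k := by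
  simp [miwa, mul_coeff_zero]

theorem coeff_miwa_mul_X_succ (a : Mom) (k j : ℕ) :
    (miwa (a * MvPolynomial.X k)).coeff (j + 1) =
      (miwa a).coeff (j + 1) * MvPolynomial.X k - (miwa a).coeff j * MvPolynomial.X (k + 1) := by
  have : miwa (a * MvPolynomial.X k) = miwa a * C (MvPolynomial.X k) -
      miwa a * C (MvPolynomial.X (k + 1)) * X := by
    simp only [miwa, map_mul, MvPolynomial.coe_eval₂Hom, MvPolynomial.eval₂_X]
    ring
  rw [this, Polynomial.coeff_sub, coeff_mul_X, coeff_mul_C, coeff_mul_C]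

theorem coeff_miwa_zero (a : Mom) : (miwa a).coeff 0 = a := by
  induction a using MvPolynomial.induction_on with
  | C a => simp [miwa]
  | add a b ha hb => rw [map_add, Polynomial.coeff_add, ha, hb]
  | mul_X a k ha => rw [coeff_miwa_mul_X_zero, ha]

/-- This is the recursion defining `schurMom`: on `e^ξ` the operator `exp(-∑ z^l ∂_l / l)` is
multiplication by `exp(-∑ (zλ)^l / l) = 1 - zλ`. In the induction on monomials, a new factor `m_k`
produces sums of `c_{j-i} m_{k+i+1}` that telescope (`htel`). -/
theorem coeff_miwa_rec (a : Mom) (j : ℕ) : ((j : Mom) + 1) * (miwa a).coeff (j + 1) =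
    -∑ i ∈ Finset.range (j + 1), momFlow (Nat.succPNat i) ((miwa a).coeff (j - i)) := by
  induction a using MvPolynomial.induction_on generalizing j with
  | C a =>
    have h : ∀ i, momFlow (Nat.succPNat i) ((miwa (MvPolynomial.C a)).coeff (j - i)) = 0 := by
      intro i
      simp only [miwa, MvPolynomial.coe_eval₂Hom, MvPolynomial.eval₂_C, RingHom.comp_apply,
        coeff_C]
      split_ifs
      · exact momFlow_C _ _
      · exact map_zero _
    simp only [h, Finset.sum_const_zero, neg_zero]
    simp [miwa]
  | add a b ha hb =>
    simp only [map_add, Polynomial.coeff_add, Finset.sum_add_distrib, mul_add, ha, hb, neg_add]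
  | mul_X a k ha =>
    have hX : ∀ i l, momFlow (Nat.succPNat i) (MvPolynomial.X l) = MvPolynomial.X (l + i + 1) :=
      fun i l => momFlow_X _ _
    have htel : ∀ j : ℕ, ∑ i ∈ Finset.range (j + 1),
        (miwa a).coeff (j - i) * MvPolynomial.X (k + i + 1) =
        (miwa a).coeff j * MvPolynomial.X (k + 1) + ∑ i ∈ Finset.range j,
          (miwa a).coeff (j - 1 - i) * MvPolynomial.X (k + 1 + i + 1) := by
      intro j
      rw [Finset.sum_range_succ', add_comm]
      congr 1
      refine Finset.sum_congr rfl fun i _ => ?_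
      rw [show j - (i + 1) = j - 1 - i by omega, show k + (i + 1) + 1 = k + 1 + i + 1 by omega]
    cases j with
    | zero =>
      have h0 := ha 0
      simp only [zero_add, Finset.range_one, Finset.sum_singleton, Nat.sub_zero] at h0 ⊢
      rw [coeff_miwa_mul_X_zero, ← zero_add 1, coeff_miwa_mul_X_succ, Derivation.leibniz, hX,
        smul_eq_mul, smul_eq_mul]
      linear_combination MvPolynomial.X k * h0
    | succ j =>
      rw [coeff_miwa_mul_X_succ, Finset.sum_range_succ, Nat.sub_self, coeff_miwa_mul_X_zero]
      have h1 := ha (j + 1)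
      have h2 := ha j
      have h3 := htel (j + 1)
      rw [Finset.sum_range_succ, Nat.sub_self] at h1 h3
      have h4 : ∀ i ∈ Finset.range (j + 1),
          momFlow (Nat.succPNat i) ((miwa (a * MvPolynomial.X k)).coeff (j + 1 - i)) =
          MvPolynomial.X k * momFlow (Nat.succPNat i) ((miwa a).coeff (j + 1 - i))
          + (miwa a).coeff (j + 1 - i) * MvPolynomial.X (k + i + 1)
          - MvPolynomial.X (k + 1) * momFlow (Nat.succPNat i) ((miwa a).coeff (j - i))
          - (miwa a).coeff (j - i) * MvPolynomial.X (k + 1 + i + 1) := by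
        intro i hi
        have hi := Finset.mem_range.mp hi
        rw [show j + 1 - i = j - i + 1 by omega, coeff_miwa_mul_X_succ, map_sub,
          Derivation.leibniz, Derivation.leibniz, hX, hX]
        simp only [smul_eq_mul]
        ring
      rw [Finset.sum_congr rfl h4]
      simp only [Finset.sum_sub_distrib, Finset.sum_add_distrib, ← Finset.mul_sum,
        Derivation.leibniz, hX, smul_eq_mul, Nat.add_sub_cancel] at h3 ⊢
      push_cast at h1 ⊢
      linear_combination MvPolynomial.X k * h1 - MvPolynomial.X (k + 1) * h2 + h3

theorem schurMom_eq (a : Mom) (j : ℕ) : schurMom a j = (miwa a).coeff j := by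
  induction j using Nat.strong_induction_on with
  | _ j ih =>
  cases j with
  | zero => rw [schurMom, coeff_miwa_zero]
  | succ j =>
    rw [schurMom, Finset.sum_congr rfl fun (i : Fin (j + 1)) _ => by rw [ih (j - i) (by omega)],
      Fin.sum_univ_eq_sum_range fun i => momFlow (Nat.succPNat i) ((miwa a).coeff (j - i))]
    have h := coeff_miwa_rec a j
    have h1 : (MvPolynomial.C (-((j : ℝ) + 1)⁻¹) : Mom) * ((j : Mom) + 1) = -1 := by
      rw [← map_natCast (MvPolynomial.C : ℝ →+* Mom), ← map_one (MvPolynomial.C : ℝ →+* Mom),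
        ← map_add, ← map_mul, ← map_neg]
      congr 1
      field_simp
    linear_combination (-(miwa a).coeff (j + 1)) * h1 + MvPolynomial.C (-((j : ℝ) + 1)⁻¹) * h

/-! ### Hankel determinants -/

/-- The companion matrix of a polynomial of degree `n`. -/
def companion (p : ℝ[X]) (n : ℕ) : Matrix (Fin n) (Fin n) ℝ :=
  Matrix.of fun i j => if (j : ℕ) + 1 = n then -p.coeff i else if (i : ℕ) = j + 1 then 1 else 0

/-- The companion matrix represents multiplication by the root in the power basis of the quotient by
`p`, and the minimal polynomial of the root is `p`. -/
theorem charpoly_companion {p : ℝ[X]} (hp : p.Monic) : (companion p p.natDegree).charpoly = p := by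
  have hm := AdjoinRoot.minpoly_powerBasis_gen_of_monic hp
  have h1 := charpoly_leftMulMatrix (AdjoinRoot.powerBasis hp.ne_zero)
  rw [hm, PowerBasis.leftMulMatrix, PowerBasis.minpolyGen_eq, hm] at h1
  exact h1

/-- The Hankel matrix of the moments as polynomials. -/
def hankelMom (n : ℕ) : Matrix (Fin n) (Fin n) Mom :=
  Matrix.of fun i j => MvPolynomial.X (i + j : ℕ)

theorem toRat_hankelMom_det (n : ℕ) : toRat (hankelMom n).det = (hankel n).det := by
  rw [RingHom.map_det]
  rfl

theorem momL_orthPoly_mul_X_pow (n j : ℕ) : momL (orthPoly n * X ^ j) =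
    ∑ i ∈ Finset.range (n + 1), (orthPoly n).coeff i * mom (i + j) := by
  refine (momData.L_mul (orthPoly n) (X ^ j) (n := n + 1) (coeff_orthPoly_gt n)).trans ?_
  refine Finset.sum_congr rfl fun i _ => ?_
  refine congrArg _ ?_
  rw [← pow_add]
  exact momL_X_pow _

/-- The companion matrix is multiplication by `λ` modulo `P_n`, which raises the index of the
moments by one. In the last column, reduction modulo `P_n` is harmless because `P_n` is orthogonal
to the rows' powers `λ^i`, `i < n`. -/
theorem hankel_mul_companion {t : Times} (ht : t ∈ timeDomain) (n : ℕ) :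
    (hankel n).map (ev t) * companion ((orthPoly n).map (ev t)) n =
      Matrix.of fun i j : Fin n => moment t (i + j + 1) := by
  ext i j
  simp only [Matrix.mul_apply, Matrix.map_apply, hankel, Matrix.of_apply, companion, ev_mom ht]
  split_ifs with h
  · have h1 := momL_orthPoly n i i.2
    rw [mul_comm, momL_orthPoly_mul_X_pow, Finset.sum_range_succ, coeff_orthPoly_self] at h1
    have h2 := congrArg (ev t) h1
    rw [map_add, map_sum, one_mul, ev_mom ht, map_zero,
      ← Fin.sum_univ_eq_sum_range fun k => ev t ((orthPoly n).coeff k * mom (k + i))] at h2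
    simp only [map_mul, ev_mom ht] at h2
    simp only [coeff_map, mul_neg, Finset.sum_neg_distrib]
    rw [show (i : ℕ) + j + 1 = n + i by omega, eq_neg_iff_add_eq_zero.mpr
      ((add_comm _ _).trans h2)]
    refine congrArg _ (Finset.sum_congr rfl fun k _ => ?_)
    rw [mul_comm, add_comm (i : ℕ)]
  · have hj : (j : ℕ) + 1 < n := by omega
    rw [Finset.sum_eq_single ⟨j + 1, hj⟩]
    · simp [add_assoc]
    · intro k _ hk
      rw [if_neg fun h => hk (Fin.ext h), mul_zero]
    · simp

/-- The shifted matrix is `H - X H'` with `H' = H C`, so its determinant is `det H · det(1 - X C)`,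
and `det(1 - X C)` is the reversed characteristic polynomial of `C`, that is, the reversed `P_n`. -/
theorem map_miwa_hankelMom_det {t : Times} (ht : t ∈ timeDomain) (n : ℕ) :
    (miwa (hankelMom n).det).map (evMom t) =
      C (ev t (hankel n).det) * ((orthPoly n).map (ev t)).reverse := by
  have hc := charpoly_companion (natDegree_map_orthPoly t n).2
  rw [(natDegree_map_orthPoly t n).1] at hc
  conv_rhs => rw [← hc, Matrix.reverse_charpoly, Matrix.charpolyRev, RingHom.map_det,
    RingHom.map_det, ← Matrix.det_mul]
  rw [RingHom.map_det, ← coe_mapRingHom, RingHom.map_det]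
  congr 1
  have h := congrArg (fun M : Matrix (Fin n) (Fin n) ℝ => M.map C) (hankel_mul_companion ht n)
  simp only [Matrix.map_mul] at h
  simp only [RingHom.mapMatrix_apply]
  rw [mul_sub, mul_one, Matrix.mul_smul, h]
  ext1 i j
  simp [hankelMom, hankel, miwa, evMom_X ht, ev_mom ht]

/-- Passing from powers to orthogonal polynomials is a unitriangular change of basis `U`, and `U H
Uᵀ` is the diagonal matrix of the norms. -/
theorem hankel_det (n : ℕ) : (hankel n).det = ∏ k ∈ Finset.range n, (momData.h k : Rat) := by
  let U : Matrix (Fin n) (Fin n) Rat := Matrix.of fun i k => (orthPoly i).coeff k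
  have hU : U.det = 1 := by
    rw [Matrix.det_of_isLowerTriangular U fun i j h => coeff_orthPoly_gt _ _ h]
    exact Finset.prod_eq_one fun i _ => coeff_orthPoly_self i
  have hsum : ∀ (i : Fin n) (f : ℕ → Rat), ∑ k : Fin n, (orthPoly i).coeff k * f k =
      ∑ k ∈ Finset.range (i + 1), (orthPoly i).coeff k * f k := by
    intro i f
    rw [Fin.sum_univ_eq_sum_range fun k => (orthPoly i).coeff k * f k]
    refine (Finset.sum_subset (Finset.range_mono i.2) fun k _ hk => ?_).symm
    rw [coeff_orthPoly_gt i k (by simpa using hk), zero_mul]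
  have h1 : U * hankel n * U.transpose = Matrix.diagonal fun k : Fin n => (momData.h k : Rat) := by
    ext i j
    rw [Matrix.mul_apply, Matrix.diagonal_apply]
    have h2 : ∀ l : Fin n, (U * hankel n) i l = momL (orthPoly i * X ^ (l : ℕ)) := by
      intro l
      rw [momL_orthPoly_mul_X_pow, ← hsum i fun k => mom (k + l)]
      rfl
    have h3 := momL_orthPoly_mul i j
    rw [mul_comm, momData.L_mul (orthPoly j) (orthPoly i) (n := j + 1) (coeff_orthPoly_gt j),
      ← hsum j fun k => momL (X ^ k * orthPoly i)] at h3
    simp only [Fin.ext_iff]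
    convert h3 using 1
    · refine Finset.sum_congr rfl fun l _ => ?_
      rw [h2, mul_comm (orthPoly i : Rat[X]), mul_comm (momL _)]
      rfl
    · split_ifs with h
      · rw [h]
      · rfl
  have h4 := congrArg Matrix.det h1
  rw [Matrix.det_mul, Matrix.det_mul, Matrix.det_transpose, hU, one_mul, mul_one,
    Matrix.det_diagonal] at h4
  rw [h4, Fin.prod_univ_eq_prod_range fun k => (momData.h k : Rat)]

theorem isTau_of_rep {τ : Times → ℝ} (hτ : Rep τ (hankel n).det) (hW : RepOp W (momData.dress n))
    (hL : RepOp L (momData.lax n)) : IsTau W L τ where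
  ne_zero t ht := by
    rw [hτ t ht]
    exact ((isUnit_hankel_det n).map (ev t)).ne_zero
  dress t ht j hj := by
    have h0 : τ t ≠ 0 := by
      rw [hτ t ht]
      exact ((isUnit_hankel_det n).map (ev t)).ne_zero
    have h1 : ∀ t ∈ timeDomain, τ t = evMom t (hankelMom n).det := fun t ht => by
      rw [hτ t ht, ← toRat_hankelMom_det, ev_toRat]
    have h2 := congrArg (fun p => p.coeff j) (map_miwa_hankelMom_det ht n)
    rw [coeff_map, coeff_C_mul, coeff_reverse, (natDegree_map_orthPoly t n).1, coeff_map] at h2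
    rw [eq_div_iff h0, schur_eq h1 j t ht hj, schurMom_eq, h2, hτ t ht, mul_comm, hW _ t ht,
      momData.coeff_dress]
    congr 1
    split_ifs with h
    · rw [revAt_le (by omega), show ((n : ℤ) + -(j : ℤ)).toNat = n - j by omega]
    · rw [revAt_eq_self_of_lt (by omega), coeff_orthPoly_gt n j (by omega)]
  res t ht r hr := by
    refine hasTimeDeriv_timeDeriv_log (u := ∏ k ∈ Finset.range n, momData.h k) ?_ rfl hL ht hr
    rwa [Units.coe_prod, ← hankel_det]

end

end OneMatrix

/-! ### The eigenvalue integral and the Wronskian as Hankel determinants -/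

namespace OneMatrix

noncomputable section

open Polynomial PDO

/-- The squared Vandermonde determinant as a sum over pairs of permutations. -/
theorem vandermonde_sq {N : ℕ} (x : Fin N → ℝ) :
    ∏ i, ∏ j ∈ Finset.univ.filter (· < i), (x i - x j) ^ 2 =
      ∑ σ : Equiv.Perm (Fin N), ∑ τ : Equiv.Perm (Fin N),
        ((Equiv.Perm.sign σ : ℤ) : ℝ) * ((Equiv.Perm.sign τ : ℤ) : ℝ) *
          ∏ i, x i ^ ((σ i : ℕ) + (τ i : ℕ)) := by
  have h1 : ∏ i, ∏ j ∈ Finset.univ.filter (· < i), (x i - x j) ^ 2 =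
      (Matrix.vandermonde x).det * (Matrix.vandermonde x).det := by
    rw [Matrix.det_vandermonde, ← pow_two, ← Finset.prod_pow]
    simp only [← Finset.prod_pow]
    refine Finset.prod_comm' fun i j => ?_
    simp
  rw [h1, ← Matrix.det_transpose, Matrix.det_apply', Finset.sum_mul_sum]
  refine Finset.sum_congr rfl fun σ _ => Finset.sum_congr rfl fun τ _ => ?_
  simp only [Matrix.transpose_apply, Matrix.vandermonde_apply, pow_add, Finset.prod_mul_distrib]
  ring

/-- After the substitution `τ ↦ τσ` and a reordering of the factors, the inner sum is the Leibniz
expansion of the determinant for every `σ`, whence the factor `N!`. -/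
theorem sum_perm_hankel {N : ℕ} (m : ℕ → ℝ) :
    ∑ σ : Equiv.Perm (Fin N), ∑ τ : Equiv.Perm (Fin N),
      ((Equiv.Perm.sign σ : ℤ) : ℝ) * ((Equiv.Perm.sign τ : ℤ) : ℝ) *
        ∏ i, m ((σ i : ℕ) + (τ i : ℕ)) =
      N.factorial * (Matrix.of fun i j : Fin N => m (i + j)).det := by
  have h : ∀ σ : Equiv.Perm (Fin N), ∑ τ : Equiv.Perm (Fin N),
      ((Equiv.Perm.sign σ : ℤ) : ℝ) * ((Equiv.Perm.sign τ : ℤ) : ℝ) *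
        ∏ i, m ((σ i : ℕ) + (τ i : ℕ)) = (Matrix.of fun i j : Fin N => m (i + j)).det := by
    intro σ
    rw [← Matrix.det_transpose, Matrix.det_apply', ← Equiv.sum_comp (Equiv.mulRight σ)]
    refine Finset.sum_congr rfl fun τ _ => ?_
    have h1 : ((Equiv.Perm.sign σ : ℤ) : ℝ) * ((Equiv.Perm.sign σ : ℤ) : ℝ) = 1 := by
      rw [← Int.cast_mul, ← Units.val_mul, Int.units_mul_self]
      simp
    have h2 := Equiv.prod_comp σ fun i => m ((i : ℕ) + (τ i : ℕ))
    rw [Equiv.coe_mulRight, Equiv.Perm.sign_mul]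
    simp only [Matrix.transpose_apply, Matrix.of_apply, Equiv.Perm.coe_mul, Function.comp_apply]
    push_cast
    linear_combination (((Equiv.Perm.sign τ : ℤ) : ℝ) *
      ∏ i, m ((σ i : ℕ) + (τ (σ i) : ℕ))) * h1 +
        ((Equiv.Perm.sign τ : ℤ) : ℝ) * h2
  rw [Finset.sum_congr rfl fun σ _ => h σ, Finset.sum_const, Finset.card_univ, Fintype.card_perm,
    Fintype.card_fin, nsmul_eq_mul]

theorem eigenvalueWeight_eq {N : ℕ} (t : Times) (x : Fin N → ℝ) :
    eigenvalueWeight t x = ∑ σ : Equiv.Perm (Fin N), ∑ τ : Equiv.Perm (Fin N),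
      ((Equiv.Perm.sign σ : ℤ) : ℝ) * ((Equiv.Perm.sign τ : ℤ) : ℝ) *
        ∏ i, (x i ^ ((σ i : ℕ) + (τ i : ℕ)) * Real.exp (pot t (x i))) := by
  simp only [eigenvalueWeight, vandermonde_sq, Real.exp_sum, Finset.mul_sum,
    Finset.prod_mul_distrib]
  refine Finset.sum_congr rfl fun σ _ => Finset.sum_congr rfl fun τ _ => ?_
  ring

theorem integrable_eigenvalueWeight {t : Times} (ht : t ∈ timeDomain) (N : ℕ) :
    Integrable (eigenvalueWeight t : (Fin N → ℝ) → ℝ) := by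
  have h : (eigenvalueWeight t : (Fin N → ℝ) → ℝ) = _ := funext (eigenvalueWeight_eq t)
  rw [h]
  refine integrable_finsetSum _ fun σ _ => integrable_finsetSum _ fun τ _ => ?_
  exact (Integrable.fintype_prod
    (f := fun i x => x ^ ((σ i : ℕ) + (τ i : ℕ)) * Real.exp (pot t x))
    fun i => integrable_pow_mul_exp ht _).const_mul _

/-- Expanding the squared Vandermonde determinant over pairs of permutations factors the integral
into moments; the `N!` of `sum_perm_hankel` cancels the normalization of `Z`. -/
theorem rep_Z (N : ℕ) : Rep (Z N) (hankel N).det := by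
  intro t ht
  have h0 : (N.factorial : ℝ) ≠ 0 := by positivity
  have hint : ∀ σ τ : Equiv.Perm (Fin N), Integrable fun x : Fin N → ℝ =>
      ((Equiv.Perm.sign σ : ℤ) : ℝ) * ((Equiv.Perm.sign τ : ℤ) : ℝ) *
        ∏ i, (x i ^ ((σ i : ℕ) + (τ i : ℕ)) * Real.exp (pot t (x i))) := fun σ τ =>
    (Integrable.fintype_prod
      (f := fun i x => x ^ ((σ i : ℕ) + (τ i : ℕ)) * Real.exp (pot t x))
      fun i => integrable_pow_mul_exp ht _).const_mul _
  have h1 : ∫ x : Fin N → ℝ, eigenvalueWeight t x =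
      N.factorial * (Matrix.of fun i j : Fin N => moment t (i + j)).det := by
    simp only [eigenvalueWeight_eq]
    rw [integral_finsetSum _ fun σ _ => integrable_finsetSum _ fun τ _ => hint σ τ,
      ← sum_perm_hankel]
    refine Finset.sum_congr rfl fun σ _ => ?_
    rw [integral_finsetSum _ fun τ _ => hint σ τ]
    refine Finset.sum_congr rfl fun τ _ => ?_
    rw [integral_const_mul, integral_fintype_prod_volume_eq_prod
      (f := fun i x => x ^ ((σ i : ℕ) + (τ i : ℕ)) * Real.exp (pot t x))]
    rfl
  rw [Z, h1, RingHom.map_det]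
  field_simp
  congr 1
  ext i j
  simp [hankel, ev_mom ht]

theorem wronskian_eq {f : Times → ℝ} (hf : Rep f (mom 0)) (N : ℕ) {t : Times}
    (ht : t ∈ timeDomain) :
    wronskian (fun j : Fin N => dx^[(j : ℕ)] f) t = ev t (hankel N).det := by
  have h : ∀ k, (PsiDO.zeroHom (ratFlow 1))^[k] (mom 0) = mom k := by
    intro k
    induction k with
    | zero => rfl
    | succ k ih =>
      rw [Function.iterate_succ_apply', ih]
      exact ratFlow_mom 1 k
  rw [wronskian, RingHom.map_det]
  congr 1
  ext i j
  rw [Matrix.of_apply, ← Function.iterate_add_apply, hf.dx_iterate _ t ht, h]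
  rfl

end

end OneMatrix

namespace OneMatrix

noncomputable section

/-! ### Gaussian integrals of polynomials -/

/-- The moments of the Gaussian weight `exp(-c x²)`. -/
def gaussMoment (c : ℝ) (n : ℕ) : ℝ := ∫ x : ℝ, x ^ n * Real.exp (-c * x ^ 2)

theorem integrable_pow_mul_gauss {c : ℝ} (hc : 0 < c) (n : ℕ) :
    Integrable fun x : ℝ => x ^ n * Real.exp (-c * x ^ 2) := by
  simpa using integrable_rpow_mul_exp_neg_mul_sq hc (s := n)
    (by have : (0 : ℝ) ≤ n := n.cast_nonneg; linarith)

/-- The derivative of `x^n e^{-cx²}` integrates to zero. For `n = 0` the truncated index `n - 1` is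
harmless, being multiplied by `n`. -/
theorem gaussMoment_succ {c : ℝ} (hc : 0 < c) (n : ℕ) :
    2 * c * gaussMoment c (n + 1) = n * gaussMoment c (n - 1) := by
  have h1 : ∀ x : ℝ, HasDerivAt (fun x : ℝ => x ^ n * Real.exp (-c * x ^ 2))
      (n * (x ^ (n - 1) * Real.exp (-c * x ^ 2)) -
        2 * c * (x ^ (n + 1) * Real.exp (-c * x ^ 2))) x := by
    intro x
    refine ((hasDerivAt_pow n x).mul (((hasDerivAt_pow 2 x).const_mul (-c)).exp)).congr_deriv ?_
    push_cast
    ring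
  have h2 := (integrable_pow_mul_gauss hc (n - 1)).const_mul (n : ℝ)
  have h3 := (integrable_pow_mul_gauss hc (n + 1)).const_mul (2 * c)
  have h4 := integral_eq_zero_of_hasDerivAt_of_integrable h1 (h2.sub h3)
    (integrable_pow_mul_gauss hc n)
  rw [integral_sub h2 h3, integral_const_mul, integral_const_mul] at h4
  unfold gaussMoment
  linarith

variable {ι : Type*} [Fintype ι]

/-- The Gaussian weight `exp(-∑ c_i x_i²)`. -/
def gauss (c : ι → ℝ) (x : ι → ℝ) : ℝ := ∏ i, Real.exp (-c i * x i ^ 2)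

theorem gauss_eq (c : ι → ℝ) (x : ι → ℝ) : gauss c x = Real.exp (-∑ i, c i * x i ^ 2) := by
  rw [gauss, ← Real.exp_sum, ← Finset.sum_neg_distrib]
  simp only [neg_mul]

theorem gauss_pos (c : ι → ℝ) (x : ι → ℝ) : 0 < gauss c x :=
  Finset.prod_pos fun _ _ => Real.exp_pos _

theorem continuous_gauss (c : ι → ℝ) : Continuous (gauss c) := by
  unfold gauss
  fun_prop

theorem prod_pow_mul_gauss (c : ι → ℝ) (s : ι → ℕ) (x : ι → ℝ) :
    (∏ i, x i ^ s i) * gauss c x = ∏ i, (x i ^ s i * Real.exp (-c i * x i ^ 2)) := by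
  rw [gauss, Finset.prod_mul_distrib]

theorem integrable_prod_pow_mul_gauss {c : ι → ℝ} (hc : ∀ i, 0 < c i) (s : ι → ℕ) :
    Integrable fun x : ι → ℝ => (∏ i, x i ^ s i) * gauss c x := by
  simp only [prod_pow_mul_gauss]
  exact Integrable.fintype_prod (f := fun i x => x ^ s i * Real.exp (-c i * x ^ 2))
    fun i => integrable_pow_mul_gauss (hc i) _

theorem integral_prod_pow_mul_gauss (c : ι → ℝ) (s : ι → ℕ) :
    ∫ x : ι → ℝ, (∏ i, x i ^ s i) * gauss c x = ∏ i, gaussMoment (c i) (s i) := by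
  simp only [prod_pow_mul_gauss]
  exact integral_fintype_prod_volume_eq_prod (f := fun i x => x ^ s i * Real.exp (-c i * x ^ 2))

/-- Evaluation of a complex polynomial at a real point. -/
abbrev evalReal (x : ι → ℝ) : MvPolynomial ι ℂ →+* ℂ := MvPolynomial.eval fun i => (x i : ℂ)

theorem evalReal_monomial_mul_gauss (c : ι → ℝ) (s : ι →₀ ℕ) (a : ℂ) (x : ι → ℝ) :
    evalReal x (MvPolynomial.monomial s a) * (gauss c x : ℂ) =
      a * (((∏ i, x i ^ s i) * gauss c x : ℝ) : ℂ) := by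
  rw [MvPolynomial.eval_monomial, Finsupp.prod_fintype _ _ fun i => pow_zero _]
  push_cast
  ring

theorem integrable_evalReal_mul_gauss {c : ι → ℝ} (hc : ∀ i, 0 < c i) (q : MvPolynomial ι ℂ) :
    Integrable fun x : ι → ℝ => evalReal x q * (gauss c x : ℂ) := by
  induction q using MvPolynomial.induction_on' with
  | monomial s a =>
    simp only [evalReal_monomial_mul_gauss]
    exact (integrable_prod_pow_mul_gauss hc s).ofReal.const_mul a
  | add p q hp hq =>
    simp only [map_add, add_mul]
    exact hp.add hq

/-- The integral of a polynomial against a Gaussian weight. -/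
def gaussInt {c : ι → ℝ} (hc : ∀ i, 0 < c i) : MvPolynomial ι ℂ →ₗ[ℂ] ℂ where
  toFun q := ∫ x : ι → ℝ, evalReal x q * (gauss c x : ℂ)
  map_add' p q := by
    simp only [map_add, add_mul]
    exact integral_add (integrable_evalReal_mul_gauss hc p) (integrable_evalReal_mul_gauss hc q)
  map_smul' a q := by
    simp only [MvPolynomial.smul_eval, mul_assoc, RingHom.id_apply, smul_eq_mul]
    exact integral_const_mul a _

theorem gaussInt_apply {c : ι → ℝ} (hc : ∀ i, 0 < c i) (q : MvPolynomial ι ℂ) :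
    gaussInt hc q = ∫ x : ι → ℝ, evalReal x q * (gauss c x : ℂ) := rfl

theorem gaussInt_monomial {c : ι → ℝ} (hc : ∀ i, 0 < c i) (s : ι →₀ ℕ) (a : ℂ) :
    gaussInt hc (MvPolynomial.monomial s a) = a * ((∏ i, gaussMoment (c i) (s i) : ℝ) : ℂ) := by
  rw [gaussInt_apply]
  simp only [evalReal_monomial_mul_gauss]
  rw [integral_const_mul, integral_complex_ofReal, integral_prod_pow_mul_gauss]

/-- Integration by parts. -/
theorem gaussInt_pderiv [DecidableEq ι] {c : ι → ℝ} (hc : ∀ i, 0 < c i) (i : ι)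
    (q : MvPolynomial ι ℂ) : gaussInt hc (MvPolynomial.pderiv i q) =
      2 * c i * gaussInt hc (MvPolynomial.X i * q) := by
  induction q using MvPolynomial.induction_on' with
  | add p q hp hq => simp only [map_add, mul_add, hp, hq]
  | monomial s a =>
    rw [MvPolynomial.pderiv_monomial, MvPolynomial.X, MvPolynomial.monomial_mul, one_mul,
      gaussInt_monomial, gaussInt_monomial,
      ← Finset.mul_prod_erase Finset.univ _ (Finset.mem_univ i),
      ← Finset.mul_prod_erase Finset.univ (fun j => gaussMoment (c j)
        ((Finsupp.single i 1 + s : ι →₀ ℕ) j)) (Finset.mem_univ i)]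
    have h1 : ∀ j ∈ Finset.univ.erase i,
        gaussMoment (c j) ((s - Finsupp.single i 1 : ι →₀ ℕ) j) = gaussMoment (c j) (s j) ∧
        gaussMoment (c j) ((Finsupp.single i 1 + s : ι →₀ ℕ) j) = gaussMoment (c j) (s j) := by
      intro j hj
      have hj : i ≠ j := (Finset.ne_of_mem_erase hj).symm
      simp [Finsupp.single_eq_of_ne' hj]
    rw [Finset.prod_congr rfl fun j hj => (h1 j hj).1, Finset.prod_congr rfl fun j hj => (h1 j hj).2]
    have h2 := congrArg (fun r : ℝ => (r : ℂ)) (gaussMoment_succ (hc i) (s i))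
    simp only [Finsupp.tsub_apply, Finsupp.add_apply, Finsupp.single_eq_same, add_comm 1 (s i)]
    push_cast at h2 ⊢
    linear_combination (-a * ∏ j ∈ Finset.univ.erase i, (gaussMoment (c j) (s j) : ℂ)) * h2

end

end OneMatrix

namespace OneMatrix

noncomputable section

/-! ### Loop equations -/

/-- The loop equations for the expectation values `Λ` of products of the power sums `p`. -/
structure LoopEq (N : ℂ) {R : Type*} [CommRing R] [Algebra ℂ R] (Λ : R →ₗ[ℂ] ℂ) (p : ℕ → R)
    (𝒟 : ℕ → Derivation ℂ R R) : Prop where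
  zero : p 0 = algebraMap ℂ R N
  der : ∀ k l, 𝒟 k (p l) = (l : R) * p (k + l - 1)
  loop : ∀ k f, Λ (p (k + 1) * f) =
    Λ ((∑ a ∈ Finset.range k, p a * p (k - 1 - a)) * f + 𝒟 k f)

namespace LoopEq

variable {N : ℂ} {R S : Type*} [CommRing R] [Algebra ℂ R] [CommRing S] [Algebra ℂ S]
  {Λ : R →ₗ[ℂ] ℂ} {p : ℕ → R} {𝒟 : ℕ → Derivation ℂ R R}
  {Λ' : S →ₗ[ℂ] ℂ} {p' : ℕ → S} {𝒟' : ℕ → Derivation ℂ S S}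

/-- By the Leibniz rule both sides expand in the same way into products of power sums of total
degree `q.sum + l.sum + k - 1`, where proportionality is assumed. The list `q` holds the factors
already passed. -/
theorem apply_der_eq (h : LoopEq N Λ p 𝒟) (h' : LoopEq N Λ' p' 𝒟') {u v : ℂ} (k : ℕ)
    (l q : List ℕ)
    (hl : ∀ m : List ℕ, m.sum + 1 = q.sum + l.sum + k →
      u * Λ (m.map p).prod = v * Λ' (m.map p').prod) :
    u * Λ ((q.map p).prod * 𝒟 k (l.map p).prod) =
      v * Λ' ((q.map p').prod * 𝒟' k (l.map p').prod) := by
  induction l generalizing q with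
  | nil => simp
  | cons a l ih =>
    have h1 := ih (a :: q) fun m hm => hl m (by simp only [List.sum_cons] at hm ⊢; omega)
    have h2 : u * Λ ((q.map p).prod * ((a : R) * p (k + a - 1) * (l.map p).prod)) =
        v * Λ' ((q.map p').prod * ((a : S) * p' (k + a - 1) * (l.map p').prod)) := by
      rcases Nat.eq_zero_or_pos a with rfl | ha
      · simp
      · have h3 := hl ((k + a - 1) :: (q ++ l)) (by
          simp only [List.sum_cons, List.sum_append]
          omega)
        have e1 : (q.map p).prod * ((a : R) * p (k + a - 1) * (l.map p).prod) =
            (a : ℂ) • (((k + a - 1) :: (q ++ l)).map p).prod := by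
          rw [Algebra.smul_def, map_natCast, List.map_cons, List.prod_cons, List.map_append,
            List.prod_append]
          ring
        have e2 : (q.map p').prod * ((a : S) * p' (k + a - 1) * (l.map p').prod) =
            (a : ℂ) • (((k + a - 1) :: (q ++ l)).map p').prod := by
          rw [Algebra.smul_def, map_natCast, List.map_cons, List.prod_cons, List.map_append,
            List.prod_append]
          ring
        rw [e1, e2, map_smul, map_smul, smul_eq_mul, smul_eq_mul]
        linear_combination (a : ℂ) * h3
    have e1 : (q.map p).prod * 𝒟 k ((a :: l).map p).prod =
        ((a :: q).map p).prod * 𝒟 k (l.map p).prod +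
        (q.map p).prod * ((a : R) * p (k + a - 1) * (l.map p).prod) := by
      rw [List.map_cons, List.prod_cons, Derivation.leibniz, h.der, List.map_cons, List.prod_cons,
        smul_eq_mul, smul_eq_mul]
      ring
    have e2 : (q.map p').prod * 𝒟' k ((a :: l).map p').prod =
        ((a :: q).map p').prod * 𝒟' k (l.map p').prod +
        (q.map p').prod * ((a : S) * p' (k + a - 1) * (l.map p').prod) := by
      rw [List.map_cons, List.prod_cons, Derivation.leibniz, h'.der, List.map_cons, List.prod_cons,
        smul_eq_mul, smul_eq_mul]
      ring
    rw [e1, e2, map_add, map_add, mul_add, mul_add, h1, h2]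

/-- The loop equations determine all expectation values up to a common factor. -/
theorem apply_prod_eq (h : LoopEq N Λ p 𝒟) (h' : LoopEq N Λ' p' 𝒟') (l : List ℕ) :
    Λ' 1 * Λ (l.map p).prod = Λ 1 * Λ' (l.map p').prod := by
  -- Strong induction on the total degree: the loop equation replaces `p_{k+1} f` by products of
  -- degree lower by two. Entries `0` contribute a factor `N` without lowering the degree, which
  -- requires an inner induction on the list.
  suffices H : ∀ n, ∀ l : List ℕ, l.sum = n →
      Λ' 1 * Λ (l.map p).prod = Λ 1 * Λ' (l.map p').prod from H _ l rfl
  intro n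
  induction n using Nat.strong_induction_on with
  | _ n ih =>
  intro l
  induction l with
  | nil =>
    intro _
    simp [mul_comm]
  | cons a l ihl =>
    intro hl
    rw [List.sum_cons] at hl
    rw [List.map_cons, List.prod_cons, List.map_cons, List.prod_cons]
    cases a with
    | zero =>
      have h1 := ihl (by omega)
      rw [h.zero, h'.zero, ← Algebra.smul_def, ← Algebra.smul_def, map_smul, map_smul,
        smul_eq_mul, smul_eq_mul]
      linear_combination N * h1
    | succ k =>
      rw [h.loop, h'.loop, map_add, map_add, mul_add, mul_add]
      congr 1
      · rw [Finset.sum_mul, Finset.sum_mul, map_sum, map_sum, Finset.mul_sum, Finset.mul_sum]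
        refine Finset.sum_congr rfl fun a ha => ?_
        have ha := Finset.mem_range.mp ha
        have h1 := ih (a + (k - 1 - a + l.sum)) (by omega) (a :: (k - 1 - a) :: l) (by simp)
        simpa only [List.map_cons, List.prod_cons, mul_assoc] using h1
      · have h1 := apply_der_eq h h' (u := Λ' 1) (v := Λ 1) k l [] fun m hm =>
          ih m.sum (by simp only [List.sum_nil] at hm; omega) m rfl
        simpa using h1

end LoopEq

end

end OneMatrix

namespace OneMatrix

noncomputable section

/-! ### The Gaussian eigenvalue ensemble -/

theorem derivation_prod_eq {R ι : Type*} [CommRing R] [Algebra ℂ R] (δ : Derivation ℂ R R)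
    (s : Finset ι) (f g : ι → R) (h : ∀ i ∈ s, δ (f i) = f i * g i) :
    δ (∏ i ∈ s, f i) = (∏ i ∈ s, f i) * ∑ i ∈ s, g i := by
  classical
  induction s using Finset.induction_on with
  | empty => simp
  | insert a s ha ih =>
    rw [Finset.prod_insert ha, Finset.sum_insert ha, Derivation.leibniz,
      ih fun i hi => h i (Finset.mem_insert_of_mem hi), h a (Finset.mem_insert_self a s),
      smul_eq_mul, smul_eq_mul]
    ring

section

variable (N : ℕ)

/-- The power sums of the eigenvalues. -/
def powerSum (k : ℕ) : MvPolynomial (Fin N) ℂ := ∑ i, MvPolynomial.X i ^ k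

/-- The Vandermonde determinant. -/
def vdm : MvPolynomial (Fin N) ℂ :=
  ∏ i, ∏ j ∈ Finset.univ.filter (· < i), (MvPolynomial.X i - MvPolynomial.X j)

/-- The derivations `∑ x_i^k ∂_i`. -/
def eigenDer (k : ℕ) : Derivation ℂ (MvPolynomial (Fin N) ℂ) (MvPolynomial (Fin N) ℂ) :=
  ∑ i, (MvPolynomial.X i ^ k : MvPolynomial (Fin N) ℂ) • MvPolynomial.pderiv i

/-- The Gaussian eigenvalue integral. -/
def eigenInt : MvPolynomial (Fin N) ℂ →ₗ[ℂ] ℂ :=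
  (gaussInt fun _ : Fin N => one_half_pos (α := ℝ)).comp (LinearMap.mulLeft ℂ (vdm N ^ 2))

variable {N}

theorem eigenDer_apply (k : ℕ) (f : MvPolynomial (Fin N) ℂ) :
    eigenDer N k f = ∑ i, MvPolynomial.X i ^ k * MvPolynomial.pderiv i f := by
  rw [eigenDer]
  change (Derivation.coeFnAddMonoidHom _) f = _
  rw [map_sum, Finset.sum_apply]
  rfl

theorem eigenDer_X (k : ℕ) (i : Fin N) :
    eigenDer N k (MvPolynomial.X i) = MvPolynomial.X i ^ k := by
  rw [eigenDer_apply, Finset.sum_eq_single i]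
  · rw [MvPolynomial.pderiv_X_self, mul_one]
  · intro j _ hj
    rw [MvPolynomial.pderiv_X_of_ne hj.symm, mul_zero]
  · simp

theorem eigenDer_powerSum (k l : ℕ) :
    eigenDer N k (powerSum N l) = (l : MvPolynomial (Fin N) ℂ) * powerSum N (k + l - 1) := by
  rcases Nat.eq_zero_or_pos l with rfl | hl
  · simp [powerSum]
  · rw [powerSum, powerSum, map_sum, Finset.mul_sum]
    refine Finset.sum_congr rfl fun i _ => ?_
    rw [Derivation.leibniz_pow, eigenDer_X, show k + l - 1 = (l - 1) + k by omega, pow_add,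
      nsmul_eq_mul, smul_eq_mul]

/-- The divided difference of `x^k`. -/
def divDiff (k : ℕ) (i j : Fin N) : MvPolynomial (Fin N) ℂ :=
  ∑ a ∈ Finset.range k, MvPolynomial.X i ^ a * MvPolynomial.X j ^ (k - 1 - a)

theorem divDiff_comm (k : ℕ) (i j : Fin N) : divDiff k i j = divDiff k j i := by
  rw [divDiff, ← Finset.sum_range_reflect, divDiff]
  refine Finset.sum_congr rfl fun a ha => ?_
  have ha := Finset.mem_range.mp ha
  rw [show k - 1 - (k - 1 - a) = a by omega, mul_comm]

/-- Each factor `x_i - x_j` is sent to `x_i^k - x_j^k`, a multiple of itself by the divided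
difference. -/
theorem eigenDer_vdm (k : ℕ) : eigenDer N k (vdm N) =
    vdm N * ∑ i, ∑ j ∈ Finset.univ.filter (· < i), divDiff k i j := by
  refine derivation_prod_eq _ _ _ _ fun i _ => derivation_prod_eq _ _ _ _ fun j _ => ?_
  rw [map_sub, eigenDer_X, eigenDer_X, divDiff, mul_comm]
  exact ((Commute.all _ _).geom_sum₂_mul k).symm

/-- The right side is the sum of the divided differences over all pairs `(i, j)`: the diagonal gives
`k x_i^{k-1}`, and symmetry doubles the part `j < i`. -/
theorem sum_divDiff (k : ℕ) :
    (k : MvPolynomial (Fin N) ℂ) * powerSum N (k - 1) +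
      2 * ∑ i, ∑ j ∈ Finset.univ.filter (· < i), divDiff k i j =
      ∑ a ∈ Finset.range k, powerSum N a * powerSum N (k - 1 - a) := by
  have h1 : ∑ a ∈ Finset.range k, powerSum N a * powerSum N (k - 1 - a) =
      ∑ i, ∑ j, divDiff k i j := by
    simp only [powerSum, Finset.sum_mul_sum, divDiff]
    rw [Finset.sum_comm]
    exact Finset.sum_congr rfl fun i _ => Finset.sum_comm
  have h2 : ∀ i : Fin N, divDiff k i i =
      (k : MvPolynomial (Fin N) ℂ) * MvPolynomial.X i ^ (k - 1) := by
    intro i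
    rw [divDiff, Finset.sum_congr rfl fun a ha => by
      rw [← pow_add, show a + (k - 1 - a) = k - 1 by have := Finset.mem_range.mp ha; omega],
      Finset.sum_const, Finset.card_range, nsmul_eq_mul]
  have h3 : ∀ i : Fin N, ∑ j, divDiff k i j = divDiff k i i +
      (∑ j ∈ Finset.univ.filter (· < i), divDiff k i j +
        ∑ j ∈ Finset.univ.filter (i < ·), divDiff k i j) := by
    intro i
    rw [← Finset.sum_filter_add_sum_filter_not Finset.univ (· < i), add_left_comm]
    congr 1
    rw [← Finset.sum_filter_add_sum_filter_not (Finset.univ.filter fun j => ¬ j < i) (· = i),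
      Finset.filter_filter, Finset.filter_filter]
    congr 1
    · rw [show (Finset.univ.filter fun a : Fin N => ¬ a < i ∧ a = i) = {i} by
        ext j; simp only [Finset.mem_filter, Finset.mem_univ, true_and, Finset.mem_singleton]; omega,
        Finset.sum_singleton]
    · refine Finset.sum_congr ?_ fun _ _ => rfl
      ext j
      simp only [Finset.mem_filter, Finset.mem_univ, true_and]
      omega
  have h4 : ∑ i : Fin N, ∑ j ∈ Finset.univ.filter (i < ·), divDiff k i j =
      ∑ i : Fin N, ∑ j ∈ Finset.univ.filter (· < i), divDiff k i j := by
    rw [Finset.sum_comm' (s' := fun j => Finset.univ.filter (· < j)) (t' := Finset.univ)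
      (by simp)]
    exact Finset.sum_congr rfl fun i _ => Finset.sum_congr rfl fun j _ => divDiff_comm _ _ _
  rw [h1, Finset.sum_congr rfl fun i _ => h3 i, Finset.sum_add_distrib, Finset.sum_add_distrib, h4,
    Finset.sum_congr rfl fun i _ => h2 i, ← Finset.mul_sum, ← powerSum]
  ring

theorem gaussInt_half_X_mul {c : Fin N → ℝ} (hc : ∀ i, 0 < c i) (i : Fin N) (hi : c i = 1 / 2)
    (k : ℕ) (q : MvPolynomial (Fin N) ℂ) :
    gaussInt hc (MvPolynomial.X i ^ (k + 1) * q) =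
      gaussInt hc ((k : MvPolynomial (Fin N) ℂ) * MvPolynomial.X i ^ (k - 1) * q +
        MvPolynomial.X i ^ k * MvPolynomial.pderiv i q) := by
  have h := gaussInt_pderiv hc i (MvPolynomial.X i ^ k * q)
  have h1 : (2 : ℂ) * (c i : ℝ) = 1 := by rw [hi]; norm_num
  rw [h1, one_mul, ← mul_assoc, ← pow_succ'] at h
  rw [← h, Derivation.leibniz, Derivation.leibniz_pow, MvPolynomial.pderiv_X_self]
  congr 1
  simp only [smul_eq_mul, nsmul_eq_mul]
  ring

theorem gaussInt_half_powerSum_mul {c : Fin N → ℝ} (hc : ∀ i, 0 < c i) (h : ∀ i, c i = 1 / 2)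
    (k : ℕ) (q : MvPolynomial (Fin N) ℂ) :
    gaussInt hc (powerSum N (k + 1) * q) =
      gaussInt hc ((k : MvPolynomial (Fin N) ℂ) * powerSum N (k - 1) * q + eigenDer N k q) := by
  rw [powerSum, powerSum, eigenDer_apply, Finset.sum_mul, Finset.mul_sum, Finset.sum_mul,
    ← Finset.sum_add_distrib, map_sum, map_sum]
  exact Finset.sum_congr rfl fun i _ => gaussInt_half_X_mul hc i (h i) k q

/-- Integrate `x_i^k Δ² f` by parts against the Gaussian and sum over `i`. The derivatives of
`x_i^k` and of `Δ²` combine by `sum_divDiff` into the products of power sums. -/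
theorem loopEq_eigenInt : LoopEq (N : ℂ) (eigenInt N) (powerSum N) (eigenDer N) where
  zero := by simp [powerSum]
  der := eigenDer_powerSum
  loop k f := by
    have h := gaussInt_half_powerSum_mul (fun _ : Fin N => one_half_pos (α := ℝ)) (fun _ => rfl) k
      (vdm N ^ 2 * f)
    rw [mul_left_comm] at h
    refine h.trans ?_
    refine congrArg (gaussInt fun _ : Fin N => one_half_pos (α := ℝ)) ?_
    rw [Derivation.leibniz, Derivation.leibniz_pow, eigenDer_vdm, ← sum_divDiff]
    simp only [smul_eq_mul, nsmul_eq_mul, LinearMap.mulLeft_apply]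
    push_cast
    ring

end

end

end OneMatrix

namespace OneMatrix

noncomputable section

/-! ### The Gaussian matrix ensemble -/

theorem trace_mul_eq_sum {N : ℕ} {R : Type*} [CommRing R]
    (A B : Matrix (Fin N) (Fin N) R) :
    (A * B).trace = ∑ i, ∑ j, A i j * B j i := by
  simp only [Matrix.trace, Matrix.diag_apply, Matrix.mul_apply]

section Abstract

variable {N : ℕ} {R : Type*} [CommRing R] [Algebra ℂ R] {M : Matrix (Fin N) (Fin N) R}
  {δ : Fin N → Fin N → Derivation ℂ R R} {Λ : R →ₗ[ℂ] ℂ}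

theorem matrixDer_pow (hδ : ∀ i j k l, δ i j (M k l) = if i = k ∧ j = l then 1 else 0)
    (l : ℕ) (i j r s : Fin N) : δ i j ((M ^ l) r s) =
      ∑ a ∈ Finset.range l, (M ^ a) r i * (M ^ (l - 1 - a)) j s := by
  induction l generalizing s with
  | zero =>
    rw [pow_zero, Matrix.one_apply, Finset.range_zero, Finset.sum_empty]
    split_ifs
    · exact (δ i j).map_one_eq_zero
    · exact map_zero _
  | succ l ih =>
    rw [pow_succ, Matrix.mul_apply, map_sum, Finset.sum_range_succ]
    simp only [Derivation.leibniz, ih, hδ, smul_eq_mul, Finset.sum_add_distrib]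
    rw [add_comm]
    congr 1
    · simp only [Finset.mul_sum]
      rw [Finset.sum_comm]
      refine Finset.sum_congr rfl fun a ha => ?_
      have ha := Finset.mem_range.mp ha
      rw [show l + 1 - 1 - a = l - 1 - a + 1 by omega, pow_succ, Matrix.mul_apply, Finset.mul_sum]
      refine Finset.sum_congr rfl fun m _ => ?_
      ring
    · rw [show l + 1 - 1 - l = 0 by omega, pow_zero, Matrix.one_apply, Finset.sum_eq_single i]
      · simp
      · intro m _ hm
        rw [if_neg fun h => hm h.1.symm, mul_zero]
      · simp

/-- The derivation `∑ (M^k)_{ij} ∂/∂M_{ij}`. -/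
def matrixDer (M : Matrix (Fin N) (Fin N) R) (δ : Fin N → Fin N → Derivation ℂ R R) (k : ℕ) :
    Derivation ℂ R R := ∑ i, ∑ j, (M ^ k) i j • δ i j

theorem matrixDer_apply (k : ℕ) (f : R) :
    matrixDer M δ k f = ∑ i, ∑ j, (M ^ k) i j * δ i j f := by
  rw [matrixDer]
  change (Derivation.coeFnAddMonoidHom _) f = _
  rw [map_sum, Finset.sum_apply]
  refine Finset.sum_congr rfl fun i _ => ?_
  rw [map_sum, Finset.sum_apply]
  rfl

theorem matrixDer_trace_pow (hδ : ∀ i j k l, δ i j (M k l) = if i = k ∧ j = l then 1 else 0)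
    (k l : ℕ) : matrixDer M δ k (M ^ l).trace = (l : R) * (M ^ (k + l - 1)).trace := by
  have h1 : ∀ i j, δ i j (M ^ l).trace = (l : R) * (M ^ (l - 1)) j i := by
    intro i j
    simp only [Matrix.trace, Matrix.diag_apply, map_sum, matrixDer_pow hδ]
    rw [Finset.sum_comm]
    have h2 : ∀ a ∈ Finset.range l, ∑ r, (M ^ a) r i * (M ^ (l - 1 - a)) j r =
        (M ^ (l - 1)) j i := by
      intro a ha
      have ha := Finset.mem_range.mp ha
      conv_rhs => rw [show l - 1 = l - 1 - a + a by omega, pow_add, Matrix.mul_apply]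
      exact Finset.sum_congr rfl fun r _ => mul_comm _ _
    rw [Finset.sum_congr rfl h2, Finset.sum_const, Finset.card_range, nsmul_eq_mul]
  rw [matrixDer_apply]
  rcases Nat.eq_zero_or_pos l with rfl | hl
  · simp
  · rw [show k + l - 1 = k + (l - 1) by omega, pow_add, trace_mul_eq_sum, Finset.mul_sum]
    refine Finset.sum_congr rfl fun i _ => ?_
    rw [Finset.mul_sum]
    refine Finset.sum_congr rfl fun j _ => ?_
    rw [h1]
    ring

/-- Write `Tr M^{k+1} f = ∑ M_ji (M^k)_ij f` and integrate by parts in `M_ij`. Differentiating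
`(M^k)_ij` gives `∑_a (M^a)_ii (M^{k-1-a})_jj`, a sum of products of two traces after summation. -/
theorem loopEq_matrix (hδ : ∀ i j k l, δ i j (M k l) = if i = k ∧ j = l then 1 else 0)
    (hΛ : ∀ i j q, Λ (δ i j q) = Λ (M j i * q)) :
    LoopEq (N : ℂ) Λ (fun k => (M ^ k).trace) (matrixDer M δ) where
  zero := by simp
  der := matrixDer_trace_pow hδ
  loop k f := by
    have h1 : (M ^ (k + 1)).trace * f = ∑ i, ∑ j, M j i * ((M ^ k) i j * f) := by
      rw [pow_succ, trace_mul_eq_sum, Finset.sum_mul]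
      refine Finset.sum_congr rfl fun i _ => ?_
      rw [Finset.sum_mul]
      refine Finset.sum_congr rfl fun j _ => ?_
      ring
    have h2 : ∑ a ∈ Finset.range k, (M ^ a).trace * (M ^ (k - 1 - a)).trace =
        ∑ i, ∑ j, ∑ a ∈ Finset.range k, (M ^ a) i i * (M ^ (k - 1 - a)) j j := by
      simp only [Matrix.trace, Matrix.diag_apply, Finset.sum_mul_sum]
      rw [Finset.sum_comm]
      exact Finset.sum_congr rfl fun i _ => Finset.sum_comm
    rw [h1, h2, matrixDer_apply, Finset.sum_mul, ← Finset.sum_add_distrib, map_sum, map_sum]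
    refine Finset.sum_congr rfl fun i _ => ?_
    rw [Finset.sum_mul, ← Finset.sum_add_distrib, map_sum, map_sum]
    refine Finset.sum_congr rfl fun j _ => ?_
    rw [← hΛ, Derivation.leibniz, matrixDer_pow hδ, smul_eq_mul, smul_eq_mul]
    congr 1
    ring

end Abstract

variable {N : ℕ}

/-- The Hermitian matrix with indeterminate coordinates. -/
def genMatrix (N : ℕ) : Matrix (Fin N) (Fin N) (MvPolynomial (Fin N × Fin N) ℂ) :=
  Matrix.of fun i j =>
    if i = j then MvPolynomial.X (i, i)
    else if i < j then MvPolynomial.X (i, j) + Complex.I • MvPolynomial.X (j, i)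
    else MvPolynomial.X (j, i) - Complex.I • MvPolynomial.X (i, j)

/-- The derivation `∂/∂M_{ij}`. -/
def entryDer (i j : Fin N) :
    Derivation ℂ (MvPolynomial (Fin N × Fin N) ℂ) (MvPolynomial (Fin N × Fin N) ℂ) :=
  if i = j then MvPolynomial.pderiv (i, i)
  else if i < j then
    (1 / 2 : ℂ) • (MvPolynomial.pderiv (i, j) - Complex.I • MvPolynomial.pderiv (j, i))
  else (1 / 2 : ℂ) • (MvPolynomial.pderiv (j, i) + Complex.I • MvPolynomial.pderiv (i, j))

/-- The coefficients of `Tr M² / 2`. -/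
def traceCoeff (N : ℕ) (q : Fin N × Fin N) : ℝ := if q.1 = q.2 then 1 / 2 else 1

theorem traceCoeff_pos (q : Fin N × Fin N) : 0 < traceCoeff N q := by
  rw [traceCoeff]
  split_ifs <;> norm_num

theorem entryDer_genMatrix (i j k l : Fin N) :
    entryDer i j (genMatrix N k l) = if i = k ∧ j = l then 1 else 0 := by
  have hp : ∀ a b c d : Fin N, MvPolynomial.pderiv (a, b)
      (MvPolynomial.X (c, d) : MvPolynomial (Fin N × Fin N) ℂ) =
      (if a = c ∧ b = d then 1 else 0 : ℂ) • 1 := by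
    intro a b c d
    split_ifs with h
    · rw [h.1, h.2, MvPolynomial.pderiv_X_self, one_smul]
    · rw [MvPolynomial.pderiv_X_of_ne fun h' => h (by simpa [eq_comm] using h'), zero_smul]
  have hr : (if i = k ∧ j = l then 1 else 0 : MvPolynomial (Fin N × Fin N) ℂ) =
      (if i = k ∧ j = l then 1 else 0 : ℂ) • 1 := by
    split_ifs <;> simp
  rw [hr, entryDer, genMatrix, Matrix.of_apply]
  split_ifs <;>
    simp only [Derivation.smul_apply, Derivation.add_apply, Derivation.sub_apply, map_add, map_sub,
      Derivation.map_smul, hp, smul_smul, ← add_smul, ← sub_smul] <;>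
    congr 1 <;>
    split_ifs <;>
    first
    | (exfalso; omega)
    | (ring_nf; try simp only [Complex.I_sq]; norm_num)

/-- The weight is `e^{-Tr M²/2}`. For `i < j`, `∂/∂M_ij` is half of `∂_{X_ij} - √-1 ∂_{X_ji}`, and
integration by parts with coefficient `1` yields `X_ij - √-1 X_ji = M_ji`. -/
theorem gaussInt_entryDer (i j : Fin N) (q : MvPolynomial (Fin N × Fin N) ℂ) :
    gaussInt traceCoeff_pos (entryDer i j q) =
      gaussInt traceCoeff_pos (genMatrix N j i * q) := by
  have h := gaussInt_pderiv (traceCoeff_pos (N := N))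
  rw [entryDer, genMatrix, Matrix.of_apply]
  rcases lt_trichotomy i j with hij | hij | hij
  · have h1 : (traceCoeff N (i, j) : ℂ) = 1 := by simp [traceCoeff, hij.ne]
    have h2 : (traceCoeff N (j, i) : ℂ) = 1 := by simp [traceCoeff, hij.ne']
    rw [if_neg hij.ne, if_pos hij, if_neg hij.ne', if_neg hij.asymm]
    rw [Derivation.smul_apply, Derivation.sub_apply, Derivation.smul_apply, sub_mul, smul_mul_assoc]
    simp only [map_smul, map_sub, h, h1, h2, smul_eq_mul]
    ring
  · subst hij
    have h1 : (traceCoeff N (i, i) : ℂ) = 1 / 2 := by simp [traceCoeff]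
    rw [if_pos rfl, if_pos rfl, h, h1]
    ring
  · have h1 : (traceCoeff N (i, j) : ℂ) = 1 := by simp [traceCoeff, hij.ne']
    have h2 : (traceCoeff N (j, i) : ℂ) = 1 := by simp [traceCoeff, hij.ne]
    rw [if_neg hij.ne', if_neg hij.asymm, if_neg hij.ne, if_pos hij]
    rw [Derivation.smul_apply, Derivation.add_apply, Derivation.smul_apply, add_mul, smul_mul_assoc]
    simp only [map_smul, map_add, h, h1, h2, smul_eq_mul]
    ring

theorem loopEq_genMatrix : LoopEq (N : ℂ) (gaussInt traceCoeff_pos)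
    (fun k => (genMatrix N ^ k).trace) (matrixDer (genMatrix N) entryDer) :=
  loopEq_matrix entryDer_genMatrix gaussInt_entryDer

end

end OneMatrix

namespace OneMatrix

noncomputable section

/-! ### Symmetric measures with Gaussian tails are determined by moments of power sums -/

variable {N k : ℕ}

theorem sq_norm_le_sum_sq (x : Fin N → ℝ) : ‖x‖ ^ 2 ≤ ∑ i, x i ^ 2 := by
  have h0 : 0 ≤ ∑ i, x i ^ 2 := Finset.sum_nonneg fun i _ => sq_nonneg _
  have h : ‖x‖ ≤ Real.sqrt (∑ i, x i ^ 2) := by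
    refine (pi_norm_le_iff_of_nonneg (Real.sqrt_nonneg _)).mpr fun i => ?_
    rw [Real.norm_eq_abs]
    exact Real.abs_le_sqrt (Finset.single_le_sum (f := fun i => x i ^ 2)
      (fun i _ => sq_nonneg _) (Finset.mem_univ i))
  calc ‖x‖ ^ 2 ≤ Real.sqrt (∑ i, x i ^ 2) ^ 2 := by gcongr
    _ = _ := Real.sq_sqrt h0

/-- From `a‖x‖ ≤ a² + ‖x‖²/4`: integrability of `exp(∑ x_i²/4)` thus controls every exponential of
the norm and all moments. -/
theorem exp_mul_norm_le (a : ℝ) (x : Fin N → ℝ) :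
    Real.exp (a * ‖x‖) ≤ Real.exp (a ^ 2) * Real.exp ((∑ i, x i ^ 2) / 4) := by
  rw [← Real.exp_add, Real.exp_le_exp]
  nlinarith [sq_norm_le_sum_sq x, sq_nonneg (a - ‖x‖ / 2)]

/-- The composition of a point with a tuple of indices. -/
def tuple (s : Fin k → Fin N) (x : Fin N → ℝ) : Fin k → ℝ := fun j => x (s j)

theorem continuous_tuple (s : Fin k → Fin N) : Continuous (tuple s) :=
  continuous_pi fun j => continuous_apply (s j)

theorem norm_tuple_le (s : Fin k → Fin N) (x : Fin N → ℝ) : ‖tuple s x‖ ≤ ‖x‖ :=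
  (pi_norm_le_iff_of_nonneg (norm_nonneg x)).mpr fun j => norm_le_pi_norm x (s j)

theorem sum_prod_tuple {R : Type*} [CommSemiring R] (f : Fin k → ℝ → R) (x : Fin N → ℝ) :
    ∑ s : Fin k → Fin N, ∏ j, f j (tuple s x j) = ∏ j, ∑ i, f j (x i) := by
  rw [Finset.prod_univ_sum, Fintype.piFinset_univ]
  rfl

variable {μ μ' : Measure (Fin N → ℝ)}

theorem integrable_exp_mul_norm (hμ : Integrable (fun x => Real.exp ((∑ i, x i ^ 2) / 4)) μ)
    (a : ℝ) : Integrable (fun x => Real.exp (a * ‖x‖)) μ := by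
  refine (hμ.const_mul (Real.exp (a ^ 2))).mono' ?_ (.of_forall fun x => ?_)
  · exact Continuous.aestronglyMeasurable (by fun_prop)
  · rw [Real.norm_of_nonneg (Real.exp_pos _).le]
    exact exp_mul_norm_le a x

theorem integrable_norm_pow (hμ : Integrable (fun x => Real.exp ((∑ i, x i ^ 2) / 4)) μ) (n : ℕ) :
    Integrable (fun x => ‖x‖ ^ n) μ := by
  refine ((integrable_exp_mul_norm hμ 1).const_mul (n.factorial : ℝ)).mono' ?_
    (.of_forall fun x => ?_)
  · exact Continuous.aestronglyMeasurable (by fun_prop)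
  · rw [Real.norm_of_nonneg (by positivity), one_mul]
    have h := Real.pow_div_factorial_le_exp ‖x‖ (norm_nonneg x) n
    rwa [div_le_iff₀ (by positivity), mul_comm] at h

theorem integrable_eval_tuple (hμ : Integrable (fun x => Real.exp ((∑ i, x i ^ 2) / 4)) μ)
    (q : MvPolynomial (Fin k) ℝ) (s : Fin k → Fin N) :
    Integrable (fun x => MvPolynomial.eval (tuple s x) q) μ := by
  induction q using MvPolynomial.induction_on' with
  | add p q hp hq =>
    simp only [map_add]
    exact hp.add hq
  | monomial m a =>
    simp only [MvPolynomial.eval_monomial]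
    refine Integrable.const_mul ?_ a
    refine (integrable_norm_pow hμ (∑ j, m j)).mono' ?_ (.of_forall fun x => ?_)
    · refine Continuous.aestronglyMeasurable ?_
      simp only [Finsupp.prod_fintype _ _ fun i => pow_zero _]
      exact continuous_finsetProd _ fun j _ => (continuous_apply (s j)).pow _
    · rw [Finsupp.prod_fintype _ _ fun i => pow_zero _, norm_prod, ← Finset.prod_pow_eq_pow_sum]
      refine Finset.prod_le_prod (fun j _ => norm_nonneg _) fun j _ => ?_
      rw [norm_pow]
      exact pow_le_pow_left₀ (norm_nonneg _) (norm_le_pi_norm x (s j)) _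

/-- Summed over all tuples of indices, a monomial in `k` variables becomes a product of `k` power
sums. So the moments of power sums are exactly the moments of `tupleMeasure`. -/
theorem sum_integral_eval_tuple (hμ : Integrable (fun x => Real.exp ((∑ i, x i ^ 2) / 4)) μ)
    (hμ' : Integrable (fun x => Real.exp ((∑ i, x i ^ 2) / 4)) μ')
    (h : ∀ l : List ℕ, ∫ x, (l.map fun a => ∑ i, x i ^ a).prod ∂μ =
      ∫ x, (l.map fun a => ∑ i, x i ^ a).prod ∂μ') (q : MvPolynomial (Fin k) ℝ) :
    ∑ s : Fin k → Fin N, ∫ x, MvPolynomial.eval (tuple s x) q ∂μ =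
      ∑ s : Fin k → Fin N, ∫ x, MvPolynomial.eval (tuple s x) q ∂μ' := by
  induction q using MvPolynomial.induction_on' with
  | add p q hp hq =>
    simp only [map_add, integral_add (integrable_eval_tuple hμ p _) (integrable_eval_tuple hμ q _),
      integral_add (integrable_eval_tuple hμ' p _) (integrable_eval_tuple hμ' q _),
      Finset.sum_add_distrib, hp, hq]
  | monomial m a =>
    rw [← integral_finsetSum _ fun s _ => integrable_eval_tuple hμ _ s,
      ← integral_finsetSum _ fun s _ => integrable_eval_tuple hμ' _ s]
    have h1 : ∀ x : Fin N → ℝ, ∑ s : Fin k → Fin N,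
        MvPolynomial.eval (tuple s x) (MvPolynomial.monomial m a) =
        a * ((List.ofFn m).map fun a => ∑ i, x i ^ a).prod := by
      intro x
      simp only [MvPolynomial.eval_monomial, Finsupp.prod_fintype _ _ fun i => pow_zero _]
      rw [← Finset.mul_sum, sum_prod_tuple fun j y => y ^ m j, List.map_ofFn, List.prod_ofFn]
      rfl
    simp only [h1, integral_const_mul, h]

theorem hasSum_integral_exp (hμ : Integrable (fun x => Real.exp ((∑ i, x i ^ 2) / 4)) μ)
    (L : (Fin k → ℝ) →L[ℝ] ℝ) (s : Fin k → Fin N) :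
    HasSum (fun n : ℕ => (Complex.I ^ n / n.factorial) * ((∫ x, L (tuple s x) ^ n ∂μ : ℝ) : ℂ))
      (∫ x, Complex.exp (L (tuple s x) * Complex.I) ∂μ) := by
  have hc : Continuous fun x => L (tuple s x) := L.continuous.comp (continuous_tuple s)
  have hL : ∀ x, |L (tuple s x)| ≤ ‖L‖ * ‖x‖ := fun x =>
    (L.le_opNorm _).trans (mul_le_mul_of_nonneg_left (norm_tuple_le s x) (norm_nonneg L))
  have hterm : ∀ n : ℕ, (Complex.I ^ n / n.factorial) * ((∫ x, L (tuple s x) ^ n ∂μ : ℝ) : ℂ) =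
      ∫ x, ((L (tuple s x) : ℂ) * Complex.I) ^ n / n.factorial ∂μ := by
    intro n
    rw [← integral_complex_ofReal, ← integral_const_mul]
    refine integral_congr_ae (.of_forall fun x => ?_)
    simp only [Complex.ofReal_pow]
    rw [mul_pow]
    ring
  have hsum : ∀ x : Fin N → ℝ, ∑' n : ℕ, (‖L‖ * ‖x‖) ^ n / n.factorial = Real.exp (‖L‖ * ‖x‖) := by
    intro x
    rw [Real.exp_eq_exp_ℝ, NormedSpace.exp_eq_tsum_div]
  have hint : Integrable (fun x : Fin N → ℝ => ∑' n : ℕ, (‖L‖ * ‖x‖) ^ n / n.factorial) μ := by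
    simp only [hsum]
    exact integrable_exp_mul_norm hμ _
  have hbound : ∀ (n : ℕ) (x : Fin N → ℝ), ‖((L (tuple s x) : ℂ) * Complex.I) ^ n / n.factorial‖ ≤
      (‖L‖ * ‖x‖) ^ n / n.factorial := by
    intro n x
    rw [norm_div, norm_pow, norm_mul, Complex.norm_I, mul_one, Complex.norm_natCast,
      Complex.norm_real, Real.norm_eq_abs]
    gcongr
    exact hL x
  have hlim : ∀ x : Fin N → ℝ, HasSum (fun n : ℕ => ((L (tuple s x) : ℂ) * Complex.I) ^ n /
      n.factorial) (Complex.exp (L (tuple s x) * Complex.I)) := by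
    intro x
    rw [Complex.exp_eq_exp_ℂ]
    exact NormedSpace.expSeries_div_hasSum_exp _
  have hmeas : ∀ n : ℕ, AEStronglyMeasurable
      (fun x : Fin N → ℝ => ((L (tuple s x) : ℂ) * Complex.I) ^ n / n.factorial) μ := fun n =>
    Continuous.aestronglyMeasurable
      (((Complex.continuous_ofReal.comp hc).mul continuous_const).pow n |>.div_const _)
  simp only [hterm]
  exact hasSum_integral_of_dominated_convergence (fun (n : ℕ) x => (‖L‖ * ‖x‖) ^ n / n.factorial)
    hmeas (fun n => .of_forall (hbound n))
    (.of_forall fun x => Real.summable_pow_div_factorial _) hint (.of_forall hlim)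

/-- The sum of the laws of all `k`-tuples of coordinates. -/
def tupleMeasure (k : ℕ) (μ : Measure (Fin N → ℝ)) : Measure (Fin k → ℝ) :=
  ∑ s : Fin k → Fin N, μ.map (tuple s)

instance [IsFiniteMeasure μ] : IsFiniteMeasure (tupleMeasure k μ) := by
  unfold tupleMeasure
  infer_instance

theorem charFunDual_tupleMeasure [IsFiniteMeasure μ] (L : StrongDual ℝ (Fin k → ℝ)) :
    charFunDual (tupleMeasure k μ) L =
      ∑ s : Fin k → Fin N, ∫ x, Complex.exp (L (tuple s x) * Complex.I) ∂μ := by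
  rw [charFunDual_apply, tupleMeasure, integral_finsetSum_measure]
  · refine Finset.sum_congr rfl fun s _ => ?_
    rw [integral_map (continuous_tuple s).aemeasurable]
    exact Continuous.aestronglyMeasurable (by fun_prop)
  · intro s _
    refine (integrable_const (1 : ℝ)).mono' (Continuous.aestronglyMeasurable (by fun_prop))
      (.of_forall fun x => ?_)
    rw [Complex.norm_exp_ofReal_mul_I]

/-- Exponential integrability allows the characteristic function to be expanded in moments at every
`L`, and the moments agree. -/
theorem tupleMeasure_eq [IsFiniteMeasure μ] [IsFiniteMeasure μ']
    (hμ : Integrable (fun x => Real.exp ((∑ i, x i ^ 2) / 4)) μ)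
    (hμ' : Integrable (fun x => Real.exp ((∑ i, x i ^ 2) / 4)) μ')
    (h : ∀ l : List ℕ, ∫ x, (l.map fun a => ∑ i, x i ^ a).prod ∂μ =
      ∫ x, (l.map fun a => ∑ i, x i ^ a).prod ∂μ') (k : ℕ) :
    tupleMeasure k μ = tupleMeasure k μ' := by
  refine Measure.ext_of_charFunDual (funext fun L => ?_)
  rw [charFunDual_tupleMeasure, charFunDual_tupleMeasure]
  have h1 := hasSum_sum (s := Finset.univ) fun s (_ : s ∈ Finset.univ) =>
    hasSum_integral_exp hμ L (s : Fin k → Fin N)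
  have h2 := hasSum_sum (s := Finset.univ) fun s (_ : s ∈ Finset.univ) =>
    hasSum_integral_exp hμ' L (s : Fin k → Fin N)
  have h3 : ∀ n : ℕ, ∑ s : Fin k → Fin N, ∫ x, L (tuple s x) ^ n ∂μ =
      ∑ s : Fin k → Fin N, ∫ x, L (tuple s x) ^ n ∂μ' := by
    intro n
    have h4 : ∀ y : Fin k → ℝ, L y ^ n = MvPolynomial.eval y
        ((∑ j, MvPolynomial.C (L (Pi.single j 1)) * MvPolynomial.X j) ^ n) := by
      intro y
      simp only [map_pow, map_sum, map_mul, MvPolynomial.eval_C, MvPolynomial.eval_X]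
      congr 1
      conv_lhs => rw [pi_eq_sum_univ' y, map_sum]
      refine Finset.sum_congr rfl fun j _ => ?_
      rw [map_smul, smul_eq_mul, mul_comm]
    simp only [h4]
    exact sum_integral_eval_tuple hμ hμ' h _
  refine h1.unique ?_
  convert h2 using 2 with n
  rw [← Finset.mul_sum, ← Finset.mul_sum, ← Complex.ofReal_sum, ← Complex.ofReal_sum, h3]

theorem lintegral_pow_sum (U : ℝ → ENNReal) (hU : Measurable U) (μ : Measure (Fin N → ℝ)) (k : ℕ) :
    ∫⁻ x, (∑ i, U (x i)) ^ k ∂μ = ∫⁻ y, ∏ j, U (y j) ∂(tupleMeasure k μ) := by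
  have hm : Measurable fun y : Fin k → ℝ => ∏ j, U (y j) :=
    Finset.measurable_prod _ fun j _ => hU.comp (measurable_pi_apply j)
  rw [tupleMeasure, lintegral_finsetSum_measure,
    Finset.sum_congr rfl fun s _ => lintegral_map hm (continuous_tuple s).measurable,
    ← lintegral_finsetSum Finset.univ (f := fun (s : Fin k → Fin N) x => ∏ j, U (tuple s x j))
      fun s _ => hm.comp (continuous_tuple s).measurable]
  refine lintegral_congr fun x => ?_
  rw [sum_prod_tuple fun _ y => U y, Finset.prod_const, Finset.card_univ, Fintype.card_fin]

/-- The `k`-th power of `∑ U(x_i)` is a sum over `k`-tuples, so the exponential series integrates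
against the tuple measures. Non-negativity of `U` lets sum and integral be exchanged freely. -/
theorem lintegral_exp_sum (U : ℝ → ℝ) (hU : Measurable U) (h0 : ∀ x, 0 ≤ U x)
    (μ : Measure (Fin N → ℝ)) :
    ∫⁻ x, ENNReal.ofReal (Real.exp (∑ i, U (x i))) ∂μ =
      ∑' k : ℕ, ENNReal.ofReal (k.factorial : ℝ)⁻¹ *
        ∫⁻ y, ∏ j, ENNReal.ofReal (U (y j)) ∂(tupleMeasure k μ) := by
  have hU' : Measurable fun x => ENNReal.ofReal (U x) := hU.ennreal_ofReal
  have hm : ∀ k : ℕ, Measurable fun x : Fin N → ℝ => (∑ i, ENNReal.ofReal (U (x i))) ^ k :=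
    fun k => (Finset.measurable_sum _ fun i _ => hU'.comp (measurable_pi_apply i)).pow_const k
  have h1 : ∀ x : Fin N → ℝ, ENNReal.ofReal (Real.exp (∑ i, U (x i))) =
      ∑' k : ℕ, ENNReal.ofReal (k.factorial : ℝ)⁻¹ * (∑ i, ENNReal.ofReal (U (x i))) ^ k := by
    intro x
    have hs : 0 ≤ ∑ i, U (x i) := Finset.sum_nonneg fun i _ => h0 _
    rw [Real.exp_eq_exp_ℝ, NormedSpace.exp_eq_tsum_div,
      ENNReal.ofReal_tsum_of_nonneg (fun n => by positivity) (Real.summable_pow_div_factorial _)]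
    refine tsum_congr fun k => ?_
    rw [div_eq_inv_mul, ENNReal.ofReal_mul (by positivity), ENNReal.ofReal_pow hs,
      ENNReal.ofReal_sum_of_nonneg fun i _ => h0 _]
  simp only [h1]
  rw [lintegral_tsum fun k => ((hm k).const_mul _).aemeasurable]
  refine tsum_congr fun k => ?_
  rw [lintegral_const_mul _ (hm k), lintegral_pow_sum _ hU']

/-- Write `∏ (w + ε) = ε^N exp ∑ log((w + ε)/ε)`, where the logarithms are non-negative, and let `ε
→ 0` by dominated convergence. -/
theorem lintegral_prod_eq_of_bound [IsFiniteMeasure μ] [IsFiniteMeasure μ']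
    (h : ∀ k, tupleMeasure k μ = tupleMeasure k μ') {w : ℝ → ℝ} (hw : Measurable w)
    (h0 : ∀ x, 0 ≤ w x) {B : ℝ} (hB : ∀ x, w x ≤ B) :
    ∫⁻ x, ENNReal.ofReal (∏ i, w (x i)) ∂μ = ∫⁻ x, ENNReal.ofReal (∏ i, w (x i)) ∂μ' := by
  have h1 : ∀ ε : ℝ, 0 < ε → ∫⁻ x, ENNReal.ofReal (∏ i, (w (x i) + ε)) ∂μ =
      ∫⁻ x, ENNReal.ofReal (∏ i, (w (x i) + ε)) ∂μ' := by
    intro ε hε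
    have hp : ∀ x, 0 < (w x + ε) / ε := fun x => div_pos (by have := h0 x; linarith) hε
    have hm : Measurable fun x => Real.log ((w x + ε) / ε) :=
      ((hw.add_const ε).div_const ε).log
    have hl : ∀ x, 0 ≤ Real.log ((w x + ε) / ε) := fun x => by
      refine Real.log_nonneg ?_
      rw [le_div_iff₀ hε]
      linarith [h0 x]
    have he : ∀ x : Fin N → ℝ, ENNReal.ofReal (∏ i, (w (x i) + ε)) = ENNReal.ofReal (ε ^ N) *
        ENNReal.ofReal (Real.exp (∑ i, Real.log ((w (x i) + ε) / ε))) := by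
      intro x
      rw [← ENNReal.ofReal_mul (by positivity), Real.exp_sum]
      simp only [Real.exp_log (hp _)]
      congr 1
      rw [Finset.prod_div_distrib, Finset.prod_const, Finset.card_univ, Fintype.card_fin]
      field_simp
    simp only [he]
    rw [lintegral_const_mul' _ _ ENNReal.ofReal_ne_top,
      lintegral_const_mul' _ _ ENNReal.ofReal_ne_top, lintegral_exp_sum _ hm hl,
      lintegral_exp_sum _ hm hl]
    simp only [h]
  have h2 : ∀ ν : Measure (Fin N → ℝ), IsFiniteMeasure ν → Tendsto (fun n : ℕ =>
      ∫⁻ x, ENNReal.ofReal (∏ i, (w (x i) + 1 / ((n : ℝ) + 1))) ∂ν) atTop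
      (𝓝 (∫⁻ x, ENNReal.ofReal (∏ i, w (x i)) ∂ν)) := by
    intro ν _
    refine tendsto_lintegral_of_dominated_convergence
      (fun _ => ENNReal.ofReal ((B + 1) ^ N)) (fun n => ?_) (fun n => .of_forall fun x => ?_)
      ?_ (.of_forall fun x => ?_)
    · exact (Finset.measurable_prod _ fun i _ =>
        (hw.comp (measurable_pi_apply i)).add_const _).ennreal_ofReal
    · refine ENNReal.ofReal_le_ofReal ?_
      have hn : (1 : ℝ) / ((n : ℝ) + 1) ≤ 1 := by
        rw [div_le_one (by positivity)]
        linarith [n.cast_nonneg (α := ℝ)]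
      have hn0 : (0 : ℝ) < 1 / ((n : ℝ) + 1) := by positivity
      calc ∏ i, (w (x i) + 1 / ((n : ℝ) + 1)) ≤ ∏ _i : Fin N, (B + 1) :=
            Finset.prod_le_prod (fun i _ => by linarith [h0 (x i)])
              fun i _ => add_le_add (hB _) hn
        _ = _ := by rw [Finset.prod_const, Finset.card_univ, Fintype.card_fin]
    · rw [lintegral_const]
      exact ENNReal.mul_ne_top ENNReal.ofReal_ne_top (measure_ne_top ν _)
    · refine (ENNReal.continuous_ofReal.tendsto _).comp (tendsto_finsetProd _ fun i _ => ?_)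
      simpa using tendsto_one_div_add_atTop_nhds_zero_nat.const_add (w (x i))
  refine tendsto_nhds_unique (h2 μ inferInstance) ((h2 μ' inferInstance).congr fun n => ?_)
  exact (h1 _ (by positivity)).symm

theorem lintegral_prod_eq [IsFiniteMeasure μ] [IsFiniteMeasure μ']
    (h : ∀ k, tupleMeasure k μ = tupleMeasure k μ') {w : ℝ → ℝ} (hw : Measurable w)
    (h0 : ∀ x, 0 ≤ w x) :
    ∫⁻ x, ENNReal.ofReal (∏ i, w (x i)) ∂μ = ∫⁻ x, ENNReal.ofReal (∏ i, w (x i)) ∂μ' := by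
  have hn : ∀ (n : ℕ) x, 0 ≤ min (w x) n := fun n x => le_min (h0 x) n.cast_nonneg
  have h1 : ∀ ν : Measure (Fin N → ℝ), Tendsto (fun n : ℕ =>
      ∫⁻ x, ENNReal.ofReal (∏ i, min (w (x i)) n) ∂ν) atTop
      (𝓝 (∫⁻ x, ENNReal.ofReal (∏ i, w (x i)) ∂ν)) := by
    intro ν
    refine lintegral_tendsto_of_tendsto_of_monotone (fun n => ?_) (.of_forall fun x m n hmn => ?_)
      (.of_forall fun x => ?_)
    · exact (Finset.measurable_prod _ fun i _ =>
        (hw.comp (measurable_pi_apply i)).min measurable_const).ennreal_ofReal.aemeasurable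
    · exact ENNReal.ofReal_le_ofReal (Finset.prod_le_prod (fun i _ => hn m _)
        fun i _ => min_le_min_left _ (Nat.cast_le.mpr hmn))
    · refine (ENNReal.continuous_ofReal.tendsto _).comp (tendsto_finsetProd _ fun i _ => ?_)
      refine tendsto_const_nhds.congr' ?_
      filter_upwards [eventually_ge_atTop ⌈w (x i)⌉₊] with n hn
      exact (min_eq_left ((Nat.le_ceil _).trans (Nat.cast_le.mpr hn))).symm
  refine tendsto_nhds_unique (h1 μ) ((h1 μ').congr fun n => ?_)
  exact (lintegral_prod_eq_of_bound h (hw.min measurable_const) (hn n)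
    fun x => min_le_right _ _).symm

end

end OneMatrix

namespace OneMatrix

noncomputable section

/-! ### Eigenvalues of Hermitian matrices -/

variable {N : ℕ}

theorem isHermitian_hermitian (X : Fin N → Fin N → ℝ) : (hermitian X).IsHermitian := by
  ext i j
  rw [Matrix.conjTranspose_apply, hermitian, Matrix.of_apply, Matrix.of_apply]
  rcases lt_trichotomy i j with h | h | h
  · simp [h.ne, h.ne', h, h.asymm, sub_eq_add_neg]
  · simp [h]
  · simp [h.ne, h.ne', h, h.asymm, sub_eq_add_neg]

/-- The eigenvalues of the Hermitian matrix with the coordinates `X`. -/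
def eig (X : Fin N → Fin N → ℝ) : Fin N → ℝ := (isHermitian_hermitian X).eigenvalues

theorem trace_hermitian_pow (X : Fin N → Fin N → ℝ) (k : ℕ) :
    (hermitian X ^ k).trace = ((∑ i, eig X i ^ k : ℝ) : ℂ) := by
  have h := (isHermitian_hermitian X).spectral_theorem
  conv_lhs => rw [h]
  rw [← map_pow, Unitary.conjStarAlgAut_apply, Matrix.trace_mul_cycle, Unitary.coe_star_mul_self,
    one_mul, Matrix.diagonal_pow, Matrix.trace_diagonal]
  push_cast
  rfl

theorem continuous_hermitian :
    Continuous fun X : Fin N → Fin N → ℝ => hermitian X := by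
  refine continuous_matrix fun i j => ?_
  simp only [hermitian, Matrix.of_apply]
  split_ifs <;> fun_prop

theorem continuous_sum_eig_pow (k : ℕ) :
    Continuous fun X : Fin N → Fin N → ℝ => ∑ i, eig X i ^ k := by
  have h : (fun X : Fin N → Fin N → ℝ => ∑ i, eig X i ^ k) =
      fun X => ((hermitian X ^ k).trace).re := by
    funext X
    rw [trace_hermitian_pow, Complex.ofReal_re]
  rw [h]
  exact Complex.continuous_re.comp ((continuous_hermitian.pow k).matrix_trace)

theorem exists_polynomial_tendsto {g : ℝ → ℝ} (hg : Continuous g) :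
    ∃ p : ℕ → Polynomial ℝ, ∀ x, Tendsto (fun n => (p n).eval x) atTop (𝓝 (g x)) := by
  choose p hp using fun n : ℕ => exists_polynomial_near_of_continuousOn (-n) n g hg.continuousOn
    (1 / ((n : ℝ) + 1)) (by positivity)
  refine ⟨p, fun x => ?_⟩
  rw [tendsto_iff_dist_tendsto_zero]
  refine squeeze_zero' (.of_forall fun n => dist_nonneg) ?_ tendsto_one_div_add_atTop_nhds_zero_nat
  filter_upwards [eventually_ge_atTop ⌈|x|⌉₊] with n hn
  have h := (Nat.le_ceil |x|).trans (Nat.cast_le.mpr hn)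
  exact (hp n x (abs_le.mp h)).le

/-- For polynomial `g` this is a combination of traces of powers, continuous in the matrix;
Weierstrass approximation on growing intervals gives the rest as a pointwise limit. -/
theorem measurable_sum_eig {g : ℝ → ℝ} (hg : Continuous g) :
    Measurable fun X : Fin N → Fin N → ℝ => ∑ i, g (eig X i) := by
  obtain ⟨p, hp⟩ := exists_polynomial_tendsto hg
  refine measurable_of_tendsto_metrizable
    (f := fun (n : ℕ) (X : Fin N → Fin N → ℝ) => ∑ i, (p n).eval (eig X i)) (fun n => ?_)
    (tendsto_pi_nhds.mpr fun X => tendsto_finsetSum _ fun i _ => hp _)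
  simp only [Polynomial.eval_eq_sum_range]
  have h : (fun X : Fin N → Fin N → ℝ => ∑ i, ∑ k ∈ Finset.range ((p n).natDegree + 1),
      (p n).coeff k * eig X i ^ k) = fun X => ∑ k ∈ Finset.range ((p n).natDegree + 1),
      (p n).coeff k * ∑ i, eig X i ^ k := by
    funext X
    rw [Finset.sum_comm]
    simp only [Finset.mul_sum]
  rw [h]
  exact Finset.measurable_sum _ fun k _ => ((continuous_sum_eig_pow k).measurable.const_mul _)

theorem measurable_card_eig (c : ℝ) : Measurable fun X : Fin N → Fin N → ℝ =>
    ((Finset.univ.filter fun i => c < eig X i).card : ℝ) := by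
  have h : ∀ x : ℝ, Tendsto (fun n : ℕ => min 1 (n * max 0 (x - c))) atTop
      (𝓝 (if c < x then 1 else 0)) := by
    intro x
    split_ifs with hx
    · refine tendsto_const_nhds.congr' ?_
      filter_upwards [eventually_ge_atTop ⌈(x - c)⁻¹⌉₊] with n hn
      have h1 : (x - c)⁻¹ ≤ n := (Nat.le_ceil _).trans (Nat.cast_le.mpr hn)
      have hxc : 0 < x - c := sub_pos.mpr hx
      rw [max_eq_right hxc.le, min_eq_left]
      rwa [inv_le_iff_one_le_mul₀ hxc] at h1
    · refine tendsto_const_nhds.congr fun n => ?_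
      rw [max_eq_left (by linarith), mul_zero, min_eq_right zero_le_one]
  refine measurable_of_tendsto_metrizable
    (f := fun (n : ℕ) (X : Fin N → Fin N → ℝ) => ∑ i, min 1 (n * max 0 (eig X i - c)))
    (fun n => measurable_sum_eig (g := fun x => min 1 (n * max 0 (x - c))) (by fun_prop))
    (tendsto_pi_nhds.mpr fun X => ?_)
  rw [Finset.card_filter]
  push_cast
  exact tendsto_finsetSum _ fun i _ => h _

theorem lt_apply_iff_of_antitone {n : ℕ} {f : Fin n → ℝ} (hf : Antitone f) (c : ℝ) (k : Fin n) :
    c < f k ↔ (k : ℕ) < (Finset.univ.filter fun i => c < f i).card := by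
  constructor
  · intro h
    have hs : Finset.Iic k ⊆ Finset.univ.filter fun i => c < f i := fun i hi =>
      Finset.mem_filter.mpr ⟨Finset.mem_univ i, h.trans_le (hf (Finset.mem_Iic.mp hi))⟩
    have := Finset.card_le_card hs
    rw [Fin.card_Iic] at this
    omega
  · intro h
    by_contra hc
    have hs : (Finset.univ.filter fun i => c < f i) ⊆ Finset.Iio k := fun i hi => by
      rw [Finset.mem_Iio]
      by_contra hik
      exact hc ((Finset.mem_filter.mp hi).2.trans_le (hf (not_lt.mp hik)))
    have := Finset.card_le_card hs
    rw [Fin.card_Iio] at this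
    omega

theorem measurable_eig : Measurable (eig : (Fin N → Fin N → ℝ) → Fin N → ℝ) := by
  refine measurable_pi_iff.mpr fun i => measurable_of_Ioi fun c => ?_
  let e := Fintype.equivOfCardEq (Fintype.card_fin (Fintype.card (Fin N)))
  have h : (fun X : Fin N → Fin N → ℝ => eig X i) ⁻¹' Set.Ioi c = {X | ((e.symm i : ℕ) : ℝ) <
      ((Finset.univ.filter fun i => c < eig X i).card : ℝ)} := by
    ext X
    rw [Set.mem_preimage, Set.mem_Ioi, Set.mem_ofPred_eq, Nat.cast_lt]
    have h1 := lt_apply_iff_of_antitone (isHermitian_hermitian X).eigenvalues₀_antitone c (e.symm i)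
    have h2 : (Finset.univ.filter fun i => c < eig X i).card = (Finset.univ.filter fun j =>
        c < (isHermitian_hermitian X).eigenvalues₀ j).card :=
      Finset.card_equiv e.symm fun j => by
        simp only [Finset.mem_filter, Finset.mem_univ, true_and]
        rfl
    rw [h2]
    exact h1
  rw [h]
  exact measurableSet_lt measurable_const (measurable_card_eig c)

/-! ### Weyl's integration formula -/

theorem measurePreserving_uncurry : MeasurePreserving
    (fun X : Fin N → Fin N → ℝ => Function.uncurry X) volume volume := by
  have hm : Measurable fun X : Fin N → Fin N → ℝ => Function.uncurry X :=
    (MeasurableEquiv.curry (Fin N) (Fin N) ℝ).symm.measurable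
  refine ⟨hm, (Measure.pi_eq fun s hs => ?_).symm⟩
  rw [Measure.map_apply hm (MeasurableSet.univ_pi hs)]
  have h : (fun X : Fin N → Fin N → ℝ => Function.uncurry X) ⁻¹' Set.univ.pi s =
      Set.univ.pi fun i => Set.univ.pi fun j => s (i, j) := by
    ext X
    simp [Set.mem_pi]
  rw [h, volume_pi_pi]
  simp only [volume_pi_pi]
  rw [Fintype.prod_prod_type]

/-- Both sides are `Tr M² / 2`, so the Gaussian density in the matrix coordinates is a function of
the eigenvalues. -/
theorem sum_traceCoeff (X : Fin N → Fin N → ℝ) :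
    ∑ q, traceCoeff N q * Function.uncurry X q ^ 2 = (∑ i, eig X i ^ 2) / 2 := by
  have h1 := trace_hermitian_pow X 2
  rw [pow_two, trace_mul_eq_sum] at h1
  have h2 : ∀ i j, hermitian X i j * hermitian X j i =
      ((traceCoeff N (i, j) * X i j ^ 2 + traceCoeff N (j, i) * X j i ^ 2 : ℝ) : ℂ) := by
    intro i j
    simp only [hermitian, Matrix.of_apply, traceCoeff]
    rcases lt_trichotomy i j with h | h | h
    · simp only [h.ne, h.ne', h, h.asymm, if_true, if_false]
      push_cast
      linear_combination (-(X j i : ℂ) ^ 2) * Complex.I_sq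
    · subst h
      simp only [if_true]
      push_cast
      ring
    · simp only [h.ne, h.ne', h, h.asymm, if_true, if_false]
      push_cast
      linear_combination (-(X i j : ℂ) ^ 2) * Complex.I_sq
  simp only [h2] at h1
  have h3 : ∑ i, ∑ j, (traceCoeff N (i, j) * X i j ^ 2 + traceCoeff N (j, i) * X j i ^ 2) =
      ∑ i, eig X i ^ 2 := by exact_mod_cast h1
  simp only [Finset.sum_add_distrib] at h3
  rw [Finset.sum_comm (f := fun i j => traceCoeff N (j, i) * X j i ^ 2)] at h3
  rw [Fintype.sum_prod_type, ← h3]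
  simp only [Function.uncurry]
  ring

/-- The Gaussian weight of the matrix ensemble. -/
def matrixGauss (X : Fin N → Fin N → ℝ) : ℝ := gauss (traceCoeff N) (Function.uncurry X)

theorem matrixGauss_eq (X : Fin N → Fin N → ℝ) :
    matrixGauss X = Real.exp (-(∑ i, eig X i ^ 2) / 2) := by
  rw [matrixGauss, gauss_eq, sum_traceCoeff, neg_div]

theorem evalReal_genMatrix (X : Fin N → Fin N → ℝ) :
    (genMatrix N).map (evalReal (Function.uncurry X)) = hermitian X := by
  ext i j
  rw [Matrix.map_apply, genMatrix, hermitian, Matrix.of_apply, Matrix.of_apply]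
  split_ifs with h1 h2
  · simp [Function.uncurry]
  · simp [Function.uncurry, mul_comm]
  · simp [Function.uncurry, mul_comm]

theorem evalReal_trace_genMatrix (X : Fin N → Fin N → ℝ) (k : ℕ) :
    evalReal (Function.uncurry X) (genMatrix N ^ k).trace = ((∑ i, eig X i ^ k : ℝ) : ℂ) := by
  rw [← trace_hermitian_pow, ← evalReal_genMatrix X, ← RingHom.mapMatrix_apply, ← map_pow,
    AddMonoidHom.map_trace]
  rfl

end

end OneMatrix

namespace OneMatrix

noncomputable section

/-! ### Comparison of the matrix and the eigenvalue ensembles -/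

variable {N : ℕ} {α : Type*} [MeasureSpace α] {e : α → Fin N → ℝ} {g : α → ℝ}

/-- The law of `e` under the measure with density `g`. -/
def densityLaw (e : α → Fin N → ℝ) (g : α → ℝ) : Measure (Fin N → ℝ) :=
  ((volume : Measure α).withDensity fun a => ENNReal.ofReal (g a)).map e

theorem isFiniteMeasure_densityLaw (hg : Integrable g) : IsFiniteMeasure (densityLaw e g) := by
  have := isFiniteMeasure_withDensity_ofReal hg.2
  unfold densityLaw
  infer_instance

theorem integrable_densityLaw (he : Measurable e) (hg : Measurable g) (h0 : ∀ a, 0 ≤ g a)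
    {f : (Fin N → ℝ) → ℝ} (hf : Continuous f) (h : Integrable fun a => f (e a) * g a) :
    Integrable f (densityLaw e g) := by
  rw [densityLaw, integrable_map_measure hf.aestronglyMeasurable he.aemeasurable,
    integrable_withDensity_iff hg.ennreal_ofReal (.of_forall fun _ => ENNReal.ofReal_lt_top)]
  simpa only [ENNReal.toReal_ofReal (h0 _), Function.comp_apply] using h

theorem integral_densityLaw (he : Measurable e) (hg : Measurable g) (h0 : ∀ a, 0 ≤ g a)
    {f : (Fin N → ℝ) → ℝ} (hf : Continuous f) :
    ∫ x, f x ∂(densityLaw e g) = ∫ a, f (e a) * g a := by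
  rw [densityLaw, integral_map he.aemeasurable hf.aestronglyMeasurable,
    integral_withDensity_eq_integral_toReal_smul hg.ennreal_ofReal
      (.of_forall fun _ => ENNReal.ofReal_lt_top)]
  simp only [ENNReal.toReal_ofReal (h0 _), smul_eq_mul, mul_comm]

theorem lintegral_densityLaw (he : Measurable e) (hg : Measurable g)
    {f : (Fin N → ℝ) → ℝ} (hf : Measurable f) (hf0 : ∀ x, 0 ≤ f x) :
    ∫⁻ x, ENNReal.ofReal (f x) ∂(densityLaw e g) = ∫⁻ a, ENNReal.ofReal (f (e a) * g a) := by
  rw [densityLaw, lintegral_map hf.ennreal_ofReal he,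
    lintegral_withDensity_eq_lintegral_mul _ hg.ennreal_ofReal
      (g := fun a => ENNReal.ofReal (f (e a))) (hf.comp he).ennreal_ofReal]
  refine lintegral_congr fun a => ?_
  rw [ENNReal.ofReal_mul (hf0 _), mul_comm]
  rfl

/-- The product of the power sums with the exponents `l`. -/
def powerProd (l : List ℕ) (x : Fin N → ℝ) : ℝ := (l.map fun a => ∑ i, x i ^ a).prod

theorem continuous_powerProd (l : List ℕ) : Continuous (powerProd l : (Fin N → ℝ) → ℝ) := by
  unfold powerProd
  refine continuous_list_prod (f := fun (a : ℕ) (x : Fin N → ℝ) => ∑ i, x i ^ a) l fun a _ => ?_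
  fun_prop

theorem ofReal_list_prod (l : List ℝ) : ((l.prod : ℝ) : ℂ) = (l.map Complex.ofReal).prod :=
  map_list_prod Complex.ofRealHom l

theorem measurable_matrixGauss : Measurable (matrixGauss : (Fin N → Fin N → ℝ) → ℝ) :=
  (continuous_gauss _).measurable.comp measurePreserving_uncurry.measurable

theorem integrable_gauss {ι : Type*} [Fintype ι] {c : ι → ℝ} (hc : ∀ i, 0 < c i) :
    Integrable (gauss c) := by
  simpa using integrable_prod_pow_mul_gauss hc 0

theorem integral_uncurry {E : Type*} [NormedAddCommGroup E] [NormedSpace ℝ E]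
    (f : (Fin N × Fin N → ℝ) → E) :
    ∫ X : Fin N → Fin N → ℝ, f (Function.uncurry X) = ∫ y, f y :=
  measurePreserving_uncurry.integral_comp
    (MeasurableEquiv.curry (Fin N) (Fin N) ℝ).symm.measurableEmbedding f

theorem integral_powerProd_eig (l : List ℕ) :
    ((∫ X : Fin N → Fin N → ℝ, powerProd l (eig X) * matrixGauss X : ℝ) : ℂ) =
      gaussInt traceCoeff_pos (l.map fun k => (genMatrix N ^ k).trace).prod := by
  rw [gaussInt_apply, ← integral_uncurry, ← integral_complex_ofReal]
  refine integral_congr_ae (.of_forall fun X => ?_)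
  simp only [Complex.ofReal_mul, matrixGauss]
  congr 1
  rw [map_list_prod, List.map_map, powerProd, ofReal_list_prod, List.map_map]
  congr 2
  funext k
  exact (evalReal_trace_genMatrix X k).symm

/-- The squared Vandermonde determinant times the Gaussian weight. -/
def eigenGauss (x : Fin N → ℝ) : ℝ :=
  (∏ i, ∏ j ∈ Finset.univ.filter (· < i), (x i - x j) ^ 2) * gauss (fun _ => 1 / 2) x

theorem continuous_eigenGauss : Continuous (eigenGauss : (Fin N → ℝ) → ℝ) := by
  unfold eigenGauss
  exact Continuous.mul (by fun_prop) (continuous_gauss _)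

theorem eigenGauss_nonneg (x : Fin N → ℝ) : 0 ≤ eigenGauss x :=
  mul_nonneg (Finset.prod_nonneg fun _ _ => Finset.prod_nonneg fun _ _ => sq_nonneg _)
    (gauss_pos _ x).le

theorem evalReal_vdm_sq (x : Fin N → ℝ) : evalReal x (vdm N ^ 2) =
    ((∏ i, ∏ j ∈ Finset.univ.filter (· < i), (x i - x j) ^ 2 : ℝ) : ℂ) := by
  simp only [vdm, map_pow, map_prod, map_sub, MvPolynomial.eval_X]
  push_cast
  simp only [Finset.prod_pow]

theorem integrable_vdm_sq_mul_gauss {c : Fin N → ℝ} (hc : ∀ i, 0 < c i) :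
    Integrable fun x : Fin N → ℝ =>
      (∏ i, ∏ j ∈ Finset.univ.filter (· < i), (x i - x j) ^ 2) * gauss c x := by
  have h := (integrable_evalReal_mul_gauss hc (vdm N ^ 2)).re
  simp only [evalReal_vdm_sq, ← Complex.ofReal_mul] at h
  exact h

theorem eigenInt_apply (q : MvPolynomial (Fin N) ℂ) : eigenInt N q =
    ∫ x : Fin N → ℝ, evalReal x (vdm N ^ 2 * q) * (gauss (fun _ => 1 / 2) x : ℂ) := rfl

theorem integral_powerProd (l : List ℕ) :
    ((∫ x : Fin N → ℝ, powerProd l x * eigenGauss x : ℝ) : ℂ) =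
      eigenInt N (l.map (powerSum N)).prod := by
  rw [eigenInt_apply, ← integral_complex_ofReal]
  refine integral_congr_ae (.of_forall fun x => ?_)
  have h : evalReal x (l.map (powerSum N)).prod = (powerProd l x : ℂ) := by
    rw [map_list_prod, List.map_map, powerProd, ofReal_list_prod, List.map_map]
    congr 2
    funext k
    simp [powerSum]
  simp only [map_mul, evalReal_vdm_sq, eigenGauss, Complex.ofReal_mul, h]
  ring

theorem integral_matrixGauss_pos : 0 < ∫ X : Fin N → Fin N → ℝ, matrixGauss X := by
  unfold matrixGauss
  rw [integral_uncurry (gauss (traceCoeff N))]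
  exact integral_pos_of_integrable_nonneg_nonzero (x := 0) (continuous_gauss _)
    (integrable_gauss traceCoeff_pos) (fun x => (gauss_pos _ x).le) (gauss_pos _ _).ne'

theorem integral_eigenGauss_pos : 0 < ∫ x : Fin N → ℝ, eigenGauss x := by
  refine integral_pos_of_integrable_nonneg_nonzero (x := fun i => (i : ℝ)) continuous_eigenGauss
    (integrable_vdm_sq_mul_gauss fun _ => one_half_pos) eigenGauss_nonneg
    (mul_ne_zero ?_ (gauss_pos _ _).ne')
  refine Finset.prod_ne_zero_iff.mpr fun i _ => Finset.prod_ne_zero_iff.mpr fun j hj => ?_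
  have hj : j < i := (Finset.mem_filter.mp hj).2
  refine pow_ne_zero 2 (sub_ne_zero.mpr fun h => ?_)
  exact hj.ne' (Fin.ext (Nat.cast_injective h))

theorem integral_powerProd_eq (l : List ℕ) :
    (∫ x : Fin N → ℝ, eigenGauss x) *
      ∫ X : Fin N → Fin N → ℝ, powerProd l (eig X) * matrixGauss X =
    (∫ X : Fin N → Fin N → ℝ, matrixGauss X) * ∫ x : Fin N → ℝ, powerProd l x * eigenGauss x := by
  have h1 : (((∫ x : Fin N → ℝ, eigenGauss x) : ℝ) : ℂ) = eigenInt N 1 := by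
    simpa [powerProd] using integral_powerProd (N := N) []
  have h2 : (((∫ X : Fin N → Fin N → ℝ, matrixGauss X) : ℝ) : ℂ) = gaussInt (traceCoeff_pos (N := N)) 1 := by
    simpa [powerProd] using integral_powerProd_eig (N := N) []
  have h := loopEq_genMatrix.apply_prod_eq (loopEq_eigenInt (N := N)) l
  rw [← h1, ← h2, ← integral_powerProd_eig, ← integral_powerProd] at h
  exact_mod_cast h

/-- A weak form of Weyl's integration formula. Each density is multiplied by the total mass of the
other, so that the two laws have equal moments of power sums. -/
theorem lintegral_matrix_eq {w : ℝ → ℝ} (hw : Measurable w) (h0 : ∀ x, 0 ≤ w x) :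
    ∫⁻ X : Fin N → Fin N → ℝ, ENNReal.ofReal ((∏ i, w (eig X i)) *
      ((∫ x : Fin N → ℝ, eigenGauss x) * matrixGauss X)) =
    ∫⁻ x : Fin N → ℝ, ENNReal.ofReal ((∏ i, w (x i)) *
      ((∫ X : Fin N → Fin N → ℝ, matrixGauss X) * eigenGauss x)) := by
  set a := ∫ X : Fin N → Fin N → ℝ, matrixGauss X with ha
  set b := ∫ x : Fin N → ℝ, eigenGauss x with hb
  have ha0 : 0 < a := integral_matrixGauss_pos
  have hb0 : 0 < b := integral_eigenGauss_pos
  have hA : Measurable fun X : Fin N → Fin N → ℝ => b * matrixGauss X :=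
    measurable_matrixGauss.const_mul b
  have hB : Measurable fun x : Fin N → ℝ => a * eigenGauss x :=
    continuous_eigenGauss.measurable.const_mul a
  have hA0 : ∀ X : Fin N → Fin N → ℝ, 0 ≤ b * matrixGauss X := fun X =>
    mul_nonneg hb0.le (gauss_pos _ _).le
  have hB0 : ∀ x : Fin N → ℝ, 0 ≤ a * eigenGauss x := fun x =>
    mul_nonneg ha0.le (eigenGauss_nonneg x)
  have : IsFiniteMeasure (densityLaw eig fun X : Fin N → Fin N → ℝ => b * matrixGauss X) :=
    isFiniteMeasure_densityLaw ((measurePreserving_uncurry.integrable_comp_of_integrable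
      (integrable_gauss traceCoeff_pos)).const_mul b)
  have : IsFiniteMeasure (densityLaw id fun x : Fin N → ℝ => a * eigenGauss x) :=
    isFiniteMeasure_densityLaw
      ((integrable_vdm_sq_mul_gauss fun _ => one_half_pos).const_mul a)
  have hc : Continuous fun x : Fin N → ℝ => Real.exp ((∑ i, x i ^ 2) / 4) := by fun_prop
  -- Half of the Gaussian exponent `∑ x_i²/2` is spent on the factor `exp(∑ x_i²/4)`, and the other
  -- half keeps the integral finite.
  have hAi : Integrable (fun x : Fin N → ℝ => Real.exp ((∑ i, x i ^ 2) / 4))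
      (densityLaw eig fun X : Fin N → Fin N → ℝ => b * matrixGauss X) := by
    refine integrable_densityLaw measurable_eig hA hA0 hc ?_
    have h := (measurePreserving_uncurry.integrable_comp_of_integrable (integrable_gauss
      fun q => half_pos (traceCoeff_pos (N := N) q))).const_mul b
    refine h.congr (.of_forall fun X => ?_)
    have h1 : ∑ q, traceCoeff N q / 2 * Function.uncurry X q ^ 2 = (∑ i, eig X i ^ 2) / 4 := by
      have := sum_traceCoeff X
      simp only [div_mul_eq_mul_div, ← Finset.sum_div, this]
      ring
    simp only [Function.comp_apply, gauss_eq, h1, matrixGauss_eq]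
    rw [mul_left_comm, ← Real.exp_add]
    congr 2
    ring
  have hBi : Integrable (fun x : Fin N → ℝ => Real.exp ((∑ i, x i ^ 2) / 4))
      (densityLaw id fun x : Fin N → ℝ => a * eigenGauss x) := by
    refine integrable_densityLaw measurable_id hB hB0 hc ?_
    have h := (integrable_vdm_sq_mul_gauss (N := N) (c := fun _ => 1 / 4)
      fun _ => by norm_num).const_mul a
    refine h.congr (.of_forall fun x => ?_)
    simp only [id, eigenGauss, gauss_eq, ← Finset.mul_sum]
    rw [mul_left_comm (Real.exp _), mul_left_comm (Real.exp _), ← Real.exp_add]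
    congr 3
    ring
  have hlist : ∀ l : List ℕ, ∫ x, (l.map fun a => ∑ i, x i ^ a).prod
      ∂(densityLaw eig fun X : Fin N → Fin N → ℝ => b * matrixGauss X) =
      ∫ x, (l.map fun a => ∑ i, x i ^ a).prod
      ∂(densityLaw id fun x : Fin N → ℝ => a * eigenGauss x) := by
    intro l
    have h := integral_powerProd_eq (N := N) l
    refine (integral_densityLaw measurable_eig hA hA0 (continuous_powerProd l)).trans
      (Eq.trans ?_ (integral_densityLaw measurable_id hB hB0 (continuous_powerProd l)).symm)
    simp only [mul_left_comm _ a, mul_left_comm _ b, integral_const_mul]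
    exact h
  have hm : Measurable fun x : Fin N → ℝ => ∏ i, w (x i) :=
    Finset.measurable_prod _ fun i _ => hw.comp (measurable_pi_apply i)
  have hm0 : ∀ x : Fin N → ℝ, 0 ≤ ∏ i, w (x i) := fun x => Finset.prod_nonneg fun i _ => h0 _
  have key := lintegral_prod_eq (tupleMeasure_eq hAi hBi hlist) hw h0
  rw [lintegral_densityLaw measurable_eig hA hm hm0, lintegral_densityLaw measurable_id hB hm hm0]
    at key
  exact key

theorem matrixWeight_eq {t : Times} (ht : t ∈ timeDomain) (X : Fin N → Fin N → ℝ) :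
    matrixWeight t X = Real.exp (∑ i, pot t (eig X i)) := by
  rw [matrixWeight]
  congr 1
  simp only [trace_hermitian_pow, Complex.ofReal_re, pot, Finset.mul_sum]
  exact Summable.tsum_finsetSum fun i _ => ht.1 _

theorem exists_matrixIntegral_eq (N : ℕ) : ∃ C : ℝ, 0 < C ∧ ∀ t ∈ timeDomain,
    Integrable (matrixWeight t : (Fin N → Fin N → ℝ) → ℝ) ∧ matrixIntegral N t = C * Z N t := by
  have key := fun (w : ℝ → ℝ) hw h0 => lintegral_matrix_eq (N := N) (w := w) hw h0
  have ha0 := integral_matrixGauss_pos (N := N)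
  have hb0 := integral_eigenGauss_pos (N := N)
  set a := ∫ X : Fin N → Fin N → ℝ, matrixGauss X with ha
  set b := ∫ x : Fin N → ℝ, eigenGauss x with hb
  refine ⟨a * N.factorial / b, by positivity, fun t ht => ?_⟩
  have hpot : Measurable (pot t) := (continuous_pot ht.1).measurable
  -- The test function `e^{V + x²/2}` cancels the Gaussian factor in both ensembles.
  have h1 := key (fun x => Real.exp (pot t x + x ^ 2 / 2))
    (hpot.add (by fun_prop)).exp fun x => (Real.exp_pos _).le
  have hL : ∀ X : Fin N → Fin N → ℝ, (∏ i, Real.exp (pot t (eig X i) + eig X i ^ 2 / 2)) *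
      (b * matrixGauss X) = b * matrixWeight t X := by
    intro X
    rw [mul_left_comm, ← Real.exp_sum, matrixGauss_eq, matrixWeight_eq ht, ← Real.exp_add,
      Finset.sum_add_distrib, ← Finset.sum_div]
    congr 2
    ring
  have hR : ∀ x : Fin N → ℝ, (∏ i, Real.exp (pot t (x i) + x i ^ 2 / 2)) *
      (a * eigenGauss x) = a * eigenvalueWeight t x := by
    intro x
    rw [mul_left_comm, ← Real.exp_sum, eigenGauss, gauss_eq, eigenvalueWeight,
      mul_left_comm (Real.exp _), ← Real.exp_add, Finset.sum_add_distrib, ← Finset.sum_div,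
      ← Finset.mul_sum, mul_comm (Real.exp (∑ i, pot t (x i)))]
    congr 3
    ring
  simp only [hL, hR] at h1
  have hmeas : Measurable (matrixWeight t : (Fin N → Fin N → ℝ) → ℝ) := by
    have h : (matrixWeight t : (Fin N → Fin N → ℝ) → ℝ) =
        fun X => Real.exp (∑ i, pot t (eig X i)) := funext (matrixWeight_eq ht)
    rw [h]
    exact (Finset.measurable_sum _ fun i _ =>
      hpot.comp ((measurable_pi_apply i).comp measurable_eig)).exp
  have hint := (integrable_eigenvalueWeight ht N).const_mul a
  have hL0 : ∀ X : Fin N → Fin N → ℝ, 0 ≤ b * matrixWeight t X := fun X =>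
    mul_nonneg hb0.le (Real.exp_pos _).le
  have hR0 : ∀ x : Fin N → ℝ, 0 ≤ a * eigenvalueWeight t x := fun x =>
    mul_nonneg ha0.le (mul_nonneg (Real.exp_pos _).le
      (Finset.prod_nonneg fun _ _ => Finset.prod_nonneg fun _ _ => sq_nonneg _))
  have hLm := (hmeas.const_mul b).aestronglyMeasurable (μ := volume)
  -- The identity between integrals of non-negative functions also transfers finiteness, so
  -- convergence of the matrix integral follows from that of the eigenvalue integral.
  have hLi : Integrable fun X : Fin N → Fin N → ℝ => b * matrixWeight t X := by
    rw [← lintegral_ofReal_ne_top_iff_integrable hLm (.of_forall hL0), h1,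
      lintegral_ofReal_ne_top_iff_integrable hint.1 (.of_forall hR0)]
    exact hint
  have h2 : ∫ X : Fin N → Fin N → ℝ, b * matrixWeight t X =
      ∫ x : Fin N → ℝ, a * eigenvalueWeight t x := by
    rw [integral_eq_lintegral_of_nonneg_ae (.of_forall hL0) hLm,
      integral_eq_lintegral_of_nonneg_ae (.of_forall hR0) hint.1, h1]
  rw [integral_const_mul, integral_const_mul] at h2
  refine ⟨(integrable_const_mul_iff hb0.ne'.isUnit _).mp hLi, ?_⟩
  have h3 : (N.factorial : ℝ) ≠ 0 := by positivity
  rw [matrixIntegral, Z]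
  field_simp
  linarith [h2]

end

end OneMatrix

/-! ### The equivalence of the one-matrix model and the Burgers–Hopf system -/

open OneMatrix in
theorem proposition5p1 :
    (∃ (P : Times → ℕ → Polynomial ℝ) (h : ℕ → Times → ℝ), IsOrthogonal P h) ∧
    ∀ (P : Times → ℕ → Polynomial ℝ) (h : ℕ → Times → ℝ), IsOrthogonal P h →
      (∀ c : ℝ, c ≠ 0 → ∀ Φ : ℕ → Times → ℝ,
        (IsBHOrbit Φ ∧ HasDensity (fun _ => c) (Φ 0)) ↔
          ∀ n, ∀ t ∈ timeDomain, Φ n t = c * h n t) ∧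
      (∀ c : ℝ, c ≠ 0 → ∀ φ : Times → ℝ, HasDensity (fun _ => c) φ →
        ∀ (n : ℕ) (W L : Op), IsGenBH n φ W L ↔
          (HasPolynomialSymbol n P W ∧ OpEq L (dbLax h n))) ∧
      (∀ Φ : ℕ → Times → ℝ, IsBHOrbit Φ → HasDensity (fun _ => 1) (Φ 0) →
        (∀ n, ∀ t ∈ timeDomain, h n t = Φ n t) ∧
        (∀ n, IsGenBH n (Φ 0) (dbDress Φ n) (dbLax Φ n)) ∧
        (∀ n, ∀ t ∈ timeDomain, ∀ x : ℝ, x ≠ 0 →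
          wave P n t x = x ^ n * baFun (dbDress Φ n) t x) ∧
        (∀ n, ∀ t ∈ timeDomain, ∀ x : ℝ,
          wave P n t x = (∑ j ∈ Finset.range (n + 1),
            (dbDress Φ n).coeff (-(j : ℤ)) t * x ^ (n - j)) * Real.exp (pot t x)) ∧
        (∀ n, ∀ t ∈ timeDomain, ∀ r, IsFlow r t → ∀ x : ℝ,
          HasTimeDeriv r (fun u => wave P n u x)
            (((dbLax Φ n).pow dx r).act dx (fun u => wave P n u x) t) t) ∧
        (∀ N, ∀ t ∈ timeDomain,
          MeasureTheory.Integrable (eigenvalueWeight t : (Fin N → ℝ) → ℝ) ∧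
          Z N t = ∏ n ∈ Finset.range N, h n t ∧
          Z N t = ∏ n ∈ Finset.range N, Φ n t ∧
          Z N t = wronskian (fun j : Fin N => dx^[(j : ℕ)] (h 0)) t) ∧
        (∀ N, IsTau (dbDress Φ N) (dbLax Φ N) (Z N)) ∧
        (∀ N, ∃ C : ℝ, 0 < C ∧ ∀ t ∈ timeDomain,
          MeasureTheory.Integrable (matrixWeight t : (Fin N → Fin N → ℝ) → ℝ) ∧
          matrixIntegral N t = C * Z N t)) := by
  refine ⟨⟨_, _, exists_isOrthogonal⟩, fun P h hP => ⟨fun c hc Φ => ?_, fun c hc φ hφ n W L => ?_,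
    fun Φ hΦ h0 => ?_⟩⟩
  · exact (isBHOrbit_iff hc).trans (hP.isMultiple_iff hc)
  · exact hP.isGenBH_iff hc hφ
  · have h1 : IsMultiple one_ne_zero Φ := (isBHOrbit_iff one_ne_zero).mp ⟨hΦ, h0⟩
    have hh : ∀ n, ∀ t ∈ timeDomain, h n t = Φ n t := fun n t ht =>
      (hP.rep n t ht).trans (h1.rep_h n t ht).symm
    have hZ : ∀ N, ∀ t ∈ timeDomain, Z N t = ∏ n ∈ Finset.range N, h n t := by
      intro N t ht
      rw [rep_Z N t ht, hankel_det, map_prod]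
      exact Finset.prod_congr rfl fun n _ => (hP.rep n t ht).symm
    refine ⟨hh, fun n => h1.isGenBH n, fun n t ht x hx => ?_, fun n t ht x => ?_,
      fun n t ht r hr x => hP.hasTimeDeriv_wave (h1.repOp_lax n) ht hr x, fun N t ht =>
      ⟨integrable_eigenvalueWeight ht N, hZ N t ht, ?_, ?_⟩,
      fun N => isTau_of_rep (rep_Z N) (h1.repOp_dress N) (h1.repOp_lax N),
      exists_matrixIntegral_eq⟩
    · rw [hP.wave_eq ht, pow_mul_baFun (h1.repOp_dress n) ht hx]
    · rw [hP.wave_eq ht, eval_map_orthPoly (h1.repOp_dress n) ht]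
    · rw [hZ N t ht]
      exact Finset.prod_congr rfl fun n _ => hh n t ht
    · rw [rep_Z N t ht, wronskian_eq (fun u hu => ?_) N ht]
      rw [hP.rep 0 u hu, momData_h_zero]
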